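/- **Theorem.** Let $n\ge 1$ and let $(M,\omega,\theta)$ be a $2n$-dimensional locally conformally symplectic manifold: $M$ is a smooth (Hausdorff, second countable) manifold, $\omega$ a smooth nondegenerate 2-form and $\theta$ a smooth closed 1-form with $d\omega=\theta\wedge\omega$. Let $\Lambda^\sharp:T^*M\to TM$ be the inverse of $v\mapsto v\lrcorner\omega=\omega(v,\cdot)$, let $\Lambda(\alpha,\beta)=\beta(\Lambda^\sharp\alpha)$, let $E$ be the vector field with $E\lrcorner\omega=-\theta$, and for smooth functions put $$X_f=\Lambda^\sharp(df)+fE\quad(\text{so } X_f\lrcorner\omega=df-f\theta),\qquad \{f,g\}=\Lambda(df,dg)+fE(g)-gE(f).$$ Let $H=f_0\in C^\infty(M)$, and let $(f_1,\dots,f_{2n-2})$ be smooth functions forming a Jacobi $C^\infty$-structure for $H$, i.e. there is an open dense set $U\subseteq M$ such that 1. $X_{f_0},\dots,X_{f_{2n-2}}$ are linearly independent at every point of $U$; 2. for all $0\le i<j\le 2n-2$ there is $F_{ji}\in C^\infty(\mathbb R^{j+1})$ with $\{f_j,f_i\}=F_{ji}(f_0,\dots,f_j)$ on $M$, and 3.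 for these $F_{ji}$ the vector field $\bigl(F_{ji}(f_0,\dots,f_j)-\sum_{k=0}^{j}f_k\,\tfrac{\partial F_{ji}}{\partial u_k}(f_0,\dots,f_j)\bigr)E$ is, near every point of $U$, a combination of $X_{f_0},\dots,X_{f_j}$ with smooth coefficients. Then the Hamiltonian system of $H$ is integrated on $U$ by a sequence of $2n-1$ completely integrable Pfaffian equations built from $H$, the $2n-2$ functions $f_1,\dots,f_{2n-2}$, a vector field $R$ and a volume form $\Omega$, in the following sense. Every point of $U$ has an open neighbourhood $V\subseteq U$ carrying a smooth vector field $R$ with $R(x)\notin\operatorname{span}(X_{f_0}(x),\dots,X_{f_{2n-2}}(x))$ for all $x\in V$ and a nowhere vanishing smooth $2n$-form $\Omega$. For every open $V\subseteq U$ and every such $R$ on $V$: (a) $(X_{f_1},\dots,X_{f_{2n-2}},R)$ is a $C^\infty$-structure on $V$ for the distribution $\mathcal D_H=\langle X_H\rangle$: writing it $(Z_1,\dots,Z_{2n-1})$, each $Z_j$ is pointwise transverse to $\mathcal D_{j-1}=\langle X_H,Z_1,\dots,Z_{j-1}\rangle$ and $[Z_j,\mathcal D_{j-1}]\subseteq\mathcal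 D_{j-1}\oplus\langle Z_j\rangle$ (modules over $C^\infty(V)$). Moreover, for every nowhere vanishing smooth $2n$-form $\Omega$ on $V$, the $2n-1$ one-forms $$\omega_i=\Omega(X_H,Z_1,\dots,\widehat{Z_i},\dots,Z_{2n-1},\,\cdot\,),\qquad 1\le i\le 2n-1,$$ have the following properties. (b) They are smooth on $V$ and pointwise linearly independent, their common kernel is spanned by $X_H$, and $d\omega_i\equiv 0 \bmod \langle\omega_i,\omega_{i+1},\dots,\omega_{2n-1}\rangle$ for each $i$. (c) On an open set $W\subseteq V$, say that a smooth function $I_i$ solves the $i$-th equation, given $I_{i+1},\dots,I_{2n-1}$, if at every $x\in W$, on the common kernel of $dI_{i+1},\dots,dI_{2n-1}$ (the tangent space of the common level set $\Sigma$ of $I_{i+1},\dots,I_{2n-1}$), one has $\omega_i\wedge dI_i=0$ and $dI_i\neq0$. For every $i$, if $I_{2n-1},\dots,I_{i+1}$ on $W$ solve the equations with numbers $2n-1,\dots,i+1$ successively, then every point of $W$ has an open neighbourhood on which a solution $I_i$ of the $i$-th equation exists. (d) If $I_1,\dots,I_{2n-1}$ solve all $2n-1$ equations on an open set $W\subseteq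 V$, then their differentials are linearly independent at each point of $W$, $X_H(I_i)=0$ for all $i$, and every point of $W$ has an open neighbourhood $W'\subseteq W$ in which the common level set of $I_1,\dots,I_{2n-1}$ through any $q\in W'$ is exactly the image of an integral curve $\gamma:(a,b)\to W'$ of $X_H$, with $a<0<b$ and $\gamma(0)=q$. -/

import Mathlib

open scoped Manifold ContDiff Topology

noncomputable section

namespace LCSInt

/-! ### Vector fields, differential forms and the exterior derivative

`M` is a manifold without boundary modelled on a real normed space `E`.  Vector fields and forms
are total functions on `M`; only their values on the open set under consideration matter. -/

section Fields

variable (E : Type*) [NormedAddCommGroup E] [NormedSpace ℝ E]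
  (M : Type*) [TopologicalSpace M] [ChartedSpace E M]

/-- Vector fields on `M`. -/
abbrev VField : Type _ := ∀ x : M, TangentSpace 𝓘(ℝ, E) x

/-- Differential `k`-forms on `M`. -/
abbrev DForm (k : ℕ) : Type _ := ∀ x : M, (TangentSpace 𝓘(ℝ, E) x) [⋀^Fin k]→L[ℝ] ℝ

end Fields

section Calculus

variable {E : Type*} [NormedAddCommGroup E] [NormedSpace ℝ E]
  {M : Type*} [TopologicalSpace M] [ChartedSpace E M]

/-- The vector field `X` is smooth on the set `V`. -/
def SmoothVFOn [IsManifold 𝓘(ℝ, E) ∞ M] (V : Set M) (X : VField E M) : Prop :=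
  ContMDiffOn 𝓘(ℝ, E) (𝓘(ℝ, E).prod 𝓘(ℝ, E)) ∞
    (fun x => (⟨x, X x⟩ : TangentBundle 𝓘(ℝ, E) M)) V

/-- The real function `f` is smooth on the set `V`. -/
def SmoothFunOn (V : Set M) (f : M → ℝ) : Prop :=
  ContMDiffOn 𝓘(ℝ, E) 𝓘(ℝ, ℝ) ∞ f V

/-- The differential of a real function, as a covector at `x`. -/
def dfun (f : M → ℝ) (x : M) : TangentSpace 𝓘(ℝ, E) x →L[ℝ] ℝ :=
  mfderiv 𝓘(ℝ, E) 𝓘(ℝ, ℝ) f x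

/-- Coordinate expression of the form `η` in the preferred chart at `x₀`: the pullback of `η` by
the inverse of the chart. -/
def formInChart {k : ℕ} (η : DForm E M k) (x₀ : M) (y : E) : E [⋀^Fin k]→L[ℝ] ℝ :=
  (η ((extChartAt 𝓘(ℝ, E) x₀).symm y)).compContinuousLinearMap
    (mfderiv 𝓘(ℝ, E) 𝓘(ℝ, E) (extChartAt 𝓘(ℝ, E) x₀).symm y)

/-- The form `η` is smooth on the set `V`: its coordinate expressions are. -/
def SmoothFormOn {k : ℕ} (V : Set M) (η : DForm E M k) : Prop :=
  ∀ x₀ : M, ContDiffOn ℝ ∞ (formInChart η x₀)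
    ((extChartAt 𝓘(ℝ, E) x₀).target ∩ (extChartAt 𝓘(ℝ, E) x₀).symm ⁻¹' V)

/-- Exterior derivative: `(dη)_x` is the exterior derivative of the expression of `η` in the
preferred chart at `x`, pulled back by that chart. -/
def dForm {k : ℕ} (η : DForm E M k) : DForm E M (k + 1) := fun x =>
  (extDeriv (formInChart η x) (extChartAt 𝓘(ℝ, E) x x)).compContinuousLinearMap
    (mfderiv 𝓘(ℝ, E) 𝓘(ℝ, E) (extChartAt 𝓘(ℝ, E) x) x)

end Calculus

/-! ### Locally conformally symplectic manifolds and their Jacobi structure -/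

section Jacobi

variable (E : Type*) [NormedAddCommGroup E] [NormedSpace ℝ E]
  (M : Type*) [TopologicalSpace M] [ChartedSpace E M]

/-- A locally conformally symplectic structure on `M`: a smooth nondegenerate two-form
`ω = form` and a smooth closed one-form `θ = lee` with `dω = θ ∧ ω`. -/
structure LCS where
  form : DForm E M 2
  lee : DForm E M 1
  smooth_form : SmoothFormOn Set.univ form
  smooth_lee : SmoothFormOn Set.univ lee
  nondegenerate : ∀ (x : M) (v : TangentSpace 𝓘(ℝ, E) x),
    (∀ w : TangentSpace 𝓘(ℝ, E) x, form x ![v, w] = 0) → v = 0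
  closed_lee : ∀ x : M, dForm lee x = 0
  d_form : ∀ (x : M) (u v w : TangentSpace 𝓘(ℝ, E) x),
    dForm form x ![u, v, w] =
      lee x ![u] * form x ![v, w] - lee x ![v] * form x ![u, w] + lee x ![w] * form x ![u, v]

/-- A bivector field `Λ`, given by `Λ♯ : T*M → TM`, together with a vector field `E`: the data of
a Jacobi structure. -/
structure BivectorPair where
  sharp : ∀ x : M, (TangentSpace 𝓘(ℝ, E) x →L[ℝ] ℝ) →ₗ[ℝ] TangentSpace 𝓘(ℝ, E) x
  reeb : VField E M

variable {E M}

namespace BivectorPair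

/-- `Λ(α, β) = β (Λ♯ α)`. -/
def bivector (J : BivectorPair E M) (x : M) (α β : TangentSpace 𝓘(ℝ, E) x →L[ℝ] ℝ) : ℝ :=
  β (J.sharp x α)

/-- Hamiltonian vector field `X_f = Λ♯(df) + f E`. -/
def ham (J : BivectorPair E M) (f : M → ℝ) : VField E M := fun x =>
  J.sharp x (dfun f x) + f x • J.reeb x

/-- Jacobi bracket `{f, g} = Λ(df, dg) + f E(g) - g E(f)`. -/
def bracket (J : BivectorPair E M) (f g : M → ℝ) : M → ℝ := fun x =>
  J.bivector x (dfun f x) (dfun g x)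
    + f x * dfun g x (J.reeb x) - g x * dfun f x (J.reeb x)

end BivectorPair

namespace LCS

/-- `v ↦ v ⌟ ω` as a linear map. -/
def flatMap (S : LCS E M) (x : M) :
    TangentSpace 𝓘(ℝ, E) x →ₗ[ℝ] (TangentSpace 𝓘(ℝ, E) x →L[ℝ] ℝ) where
  toFun v := (S.form x).toContinuousLinearMap ![v, 0] 1
  map_add' v v' := by
    ext w
    change S.form x (Function.update ![v + v', 0] 1 w) =
      S.form x (Function.update ![v, 0] 1 w) + S.form x (Function.update ![v', 0] 1 w)
    have h : ∀ z, Function.update ![z, 0] 1 w = Function.update ![v, w] 0 z := by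
      intro z; ext i; fin_cases i <;> rfl
    rw [h, h, h]
    exact (S.form x).map_update_add ![v, w] 0 v v'
  map_smul' c v := by
    ext w
    change S.form x (Function.update ![c • v, 0] 1 w) =
      c • S.form x (Function.update ![v, 0] 1 w)
    have h : ∀ z, Function.update ![z, 0] 1 w = Function.update ![v, w] 0 z := by
      intro z; ext i; fin_cases i <;> rfl
    rw [h, h]
    exact (S.form x).map_update_smul ![v, w] 0 c v

theorem flatMap_apply (S : LCS E M) (x : M) (v w : TangentSpace 𝓘(ℝ, E) x) :
    S.flatMap x v w = S.form x ![v, w] := by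
  have h : Function.update ![v, 0] 1 w = ![v, w] := by
    ext i; fin_cases i <;> rfl
  change (S.form x) (Function.update ![v, 0] 1 w) = _
  rw [h]

variable [FiniteDimensional ℝ E]

theorem flatMap_bijective (S : LCS E M) (x : M) : Function.Bijective (S.flatMap x) := by
  have : FiniteDimensional ℝ (TangentSpace 𝓘(ℝ, E) x) := ‹FiniteDimensional ℝ E›
  have hinj : Function.Injective (S.flatMap x) := by
    rw [injective_iff_map_eq_zero]
    intro v hv
    refine S.nondegenerate x v fun w => ?_
    rw [← flatMap_apply, hv]
    rfl
  refine ⟨hinj, ?_⟩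
  let e : (TangentSpace 𝓘(ℝ, E) x →ₗ[ℝ] ℝ) ≃ₗ[ℝ] (TangentSpace 𝓘(ℝ, E) x →L[ℝ] ℝ) :=
    LinearMap.toContinuousLinearMap (𝕜 := ℝ) (E := E) (F' := ℝ)
  have : FiniteDimensional ℝ (TangentSpace 𝓘(ℝ, E) x →L[ℝ] ℝ) := e.finiteDimensional
  refine (LinearMap.injective_iff_surjective_of_finrank_eq_finrank ?_).1 hinj
  rw [← e.finrank_eq]
  exact (Subspace.dual_finrank_eq (K := ℝ) (V := TangentSpace 𝓘(ℝ, E) x)).symm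

/-- The isomorphism `TM ≃ T*M`, `v ↦ v ⌟ ω`. -/
def flat (S : LCS E M) (x : M) :
    TangentSpace 𝓘(ℝ, E) x ≃ₗ[ℝ] (TangentSpace 𝓘(ℝ, E) x →L[ℝ] ℝ) :=
  LinearEquiv.ofBijective (S.flatMap x) (S.flatMap_bijective x)

/-- The Jacobi structure of a locally conformally symplectic manifold: `Λ♯ = ω♯` is the inverse of
`v ↦ v ⌟ ω`, and `E = Z_θ` is the vector field with `Z_θ ⌟ ω = -θ`. -/
def jacobi (S : LCS E M) : BivectorPair E M where
  sharp x := ((S.flat x).symm : _ →ₗ[ℝ] _)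
  reeb x := (S.flat x).symm
    (-(ContinuousAlternatingMap.ofSubsingleton ℝ _ ℝ (0 : Fin 1)).symm (S.lee x))

/-- The Hamiltonian vector field is characterized by `X_f ⌟ ω = df - f θ`. -/
theorem ham_spec (S : LCS E M) (f : M → ℝ) (x : M) (w : TangentSpace 𝓘(ℝ, E) x) :
    S.form x ![S.jacobi.ham f x, w] = dfun f x w - f x * S.lee x ![w] := by
  have h : S.flat x (S.jacobi.ham f x) = dfun f x +
      f x • (-(ContinuousAlternatingMap.ofSubsingleton ℝ _ ℝ (0 : Fin 1)).symm (S.lee x)) := by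
    simp [BivectorPair.ham, jacobi]
  have h2 := S.flatMap_apply x (S.jacobi.ham f x) w
  change S.flat x (S.jacobi.ham f x) w = _ at h2
  rw [← h2, h]
  have h3 : (ContinuousAlternatingMap.ofSubsingleton ℝ _ ℝ (0 : Fin 1)).symm (S.lee x) w
      = S.lee x ![w] := by
    change S.lee x (fun _ => w) = _
    congr 1
    ext i
    fin_cases i
    rfl
  simp only [smul_neg, add_apply, neg_apply, smul_apply, smul_eq_mul, h3]
  ring

end LCS

/-- `F = (f₁, …, f_N)`, with `N = dim M - 2`, is a Jacobi `C^∞`-structure for the Hamiltonian system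
`(M, H)`, with the open dense set `U` as its set of independence.  Here `f₀ = H`. -/
structure IsJacobiCInfStructure [IsManifold 𝓘(ℝ, E) ∞ M] (J : BivectorPair E M) {N : ℕ}
    (H : M → ℝ) (F : Fin N → M → ℝ) (U : Set M) : Prop where
  card_eq : Module.finrank ℝ E = N + 2
  smooth : ∀ j, SmoothFunOn (E := E) Set.univ (F j)
  isOpen : IsOpen U
  dense : Dense U
  /-- Vector field independence. -/
  independent : ∀ x ∈ U, LinearIndependent ℝ
    (fun k : Fin (N + 1) => J.ham ((Fin.cons H F : Fin (N + 1) → M → ℝ) k) x)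
  /-- Triangular bracket closure `{f_j, f_i} = G (f₀, …, f_j)` and Reeb compatibility: the vector
  field `(G (f₀, …, f_j) - ∑ k ≤ j, f_k ∂G/∂u_k (f₀, …, f_j)) E` belongs locally on `U` to the
  `C^∞`-module generated by `X_{f₀}, …, X_{f_j}`. -/
  closure_reeb : ∀ i j : Fin (N + 1), i < j →
    let f : Fin (N + 1) → M → ℝ := Fin.cons H F
    let f' : Fin (j.val + 1) → M → ℝ := fun k => f (Fin.castLE j.isLt k)
    ∃ G : (Fin (j.val + 1) → ℝ) → ℝ, ContDiff ℝ ∞ G ∧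
      (∀ x, J.bracket (f j) (f i) x = G (fun k => f' k x)) ∧
      ∀ p ∈ U, ∃ W : Set M, IsOpen W ∧ p ∈ W ∧
        ∃ c : Fin (j.val + 1) → M → ℝ, (∀ k, SmoothFunOn (E := E) W (c k)) ∧
          ∀ x ∈ W,
            (G (fun k => f' k x)
              - ∑ k, f' k x * fderiv ℝ G (fun k => f' k x) (Pi.single k 1)) • J.reeb x
            = ∑ k, c k x • J.ham (f' k) x

end Jacobi

/-! ### `C^∞`-structures of distributions and Pfaffian equations -/

section Pfaff

variable {E : Type*} [NormedAddCommGroup E] [NormedSpace ℝ E]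
  {M : Type*} [TopologicalSpace M] [ChartedSpace E M]

/-- On `V`, the vector field `Z` belongs to the `C^∞(V)`-module generated by the family `Y`. -/
def InModuleOn {ι : Type*} [Fintype ι] (V : Set M) (Y : ι → VField E M) (Z : VField E M) : Prop :=
  ∃ c : ι → M → ℝ, (∀ i, SmoothFunOn (E := E) V (c i)) ∧ ∀ x ∈ V, Z x = ∑ i, c i x • Y i x

/-- On `V`, the vector field `X` is a `C^∞`-symmetry of the distribution `D` generated by `Y`:
it is pointwise transverse to `D`, and `[X, D] ⊆ D ⊕ ⟨X⟩`. -/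
def IsCInfSymmetryOn {ι : Type*} [Fintype ι] (V : Set M) (Y : ι → VField E M)
    (X : VField E M) : Prop :=
  (∀ x ∈ V, X x ∉ Submodule.span ℝ (Set.range fun i => Y i x)) ∧
  ∀ Z : VField E M, InModuleOn V Y Z →
    InModuleOn V (Sum.elim Y fun _ : Unit => X) (VectorField.mlieBracket 𝓘(ℝ, E) X Z)

/-- On `V`, the ordered family `X = (X₁, …, X_r)` is a `C^∞`-structure for the distribution `D` of
rank `k` generated by the (pointwise independent) family `Y = (Y₁, …, Y_k)`, where `k + r = dim M`:
each `X_j` is a `C^∞`-symmetry of `D ⊕ ⟨X₁, …, X_{j-1}⟩`. -/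
structure IsCInfStructureOn [IsManifold 𝓘(ℝ, E) ∞ M] {k r : ℕ} (V : Set M)
    (Y : Fin k → VField E M) (X : Fin r → VField E M) : Prop where
  dim_eq : k + r = Module.finrank ℝ E
  smooth_Y : ∀ i, SmoothVFOn V (Y i)
  smooth_X : ∀ j, SmoothVFOn V (X j)
  independent : ∀ x ∈ V, LinearIndependent ℝ (fun i => Y i x)
  symmetry : ∀ j : Fin r,
    IsCInfSymmetryOn V (Sum.elim Y fun i : {i : Fin r // i < j} => X i) (X j)

/-- The one-form `Z ↦ Ω (Y₀, …, Ŷ_i, …, Y_{m-1}, Z)` obtained by contracting the `m`-form `Ω` with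
all members of the frame `Y` but `Y_i`. -/
def pfaffForm {N : ℕ} (Ω : DForm E M (N + 1)) (Y : Fin (N + 1) → VField E M) (i : Fin (N + 1)) :
    DForm E M 1 := fun x =>
  ContinuousAlternatingMap.ofSubsingleton ℝ _ ℝ (0 : Fin 1)
    ((Ω x).toContinuousLinearMap
      (Fin.snoc (α := fun _ => TangentSpace 𝓘(ℝ, E) x) (fun j : Fin N => Y (i.succAbove j) x) 0)
      (Fin.last N))

/-- For the ordered sequence `η₁, …, η_r` of one-forms, `v` is annihilated at `x` by all `η_j` with
`j > i`. -/
def KerAbove {r : ℕ} (η : Fin r → DForm E M 1) (i : Fin r) (x : M)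
    (v : TangentSpace 𝓘(ℝ, E) x) : Prop :=
  ∀ j, i < j → η j x ![v] = 0

/-- The sequence of Pfaffian equations `η_r ≡ 0, …, η₁ ≡ 0` is completely integrable on `V`: the
smooth one-forms `η_i` are pointwise linearly independent and
`dη_i ≡ 0 mod ⟨η_i, η_{i+1}, …, η_r⟩`. -/
structure CompletelyIntegrableOn {r : ℕ} (V : Set M) (η : Fin r → DForm E M 1) : Prop where
  smooth : ∀ i, SmoothFormOn V (η i)
  independent : ∀ x ∈ V, LinearIndependent ℝ (fun i => η i x)
  d_eq_zero_mod : ∀ i, ∀ x ∈ V, ∀ u v : TangentSpace 𝓘(ℝ, E) x,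
    KerAbove η i x u → η i x ![u] = 0 → KerAbove η i x v → η i x ![v] = 0 →
    dForm (η i) x ![u, v] = 0

/-- On the open set `W`, the function `I i` solves the `i`-th Pfaffian equation restricted to the
common level sets `Σ` of the previously found functions `I j`, `j > i`:
`η_i|_Σ ∧ d(I_i|_Σ) = 0`, and `d(I_i|_Σ)` vanishes nowhere.  The tangent space of `Σ` at `x` is the
common kernel of the differentials of the `I j`, `j > i`. -/
structure SolvesPfaffOn {r : ℕ} (W : Set M) (η : Fin r → DForm E M 1) (I : Fin r → M → ℝ)
    (i : Fin r) : Prop where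
  smooth : SmoothFunOn (E := E) W (I i)
  wedge_eq_zero : ∀ x ∈ W, ∀ u v : TangentSpace 𝓘(ℝ, E) x,
    (∀ j, i < j → dfun (I j) x u = 0) → (∀ j, i < j → dfun (I j) x v = 0) →
    η i x ![u] * dfun (I i) x v - η i x ![v] * dfun (I i) x u = 0
  regular : ∀ x ∈ W, ∃ u : TangentSpace 𝓘(ℝ, E) x,
    (∀ j, i < j → dfun (I j) x u = 0) ∧ dfun (I i) x u ≠ 0

/-- The dynamics of the vector field `X` is integrated on `V` by solving successively the Pfaffian
equations `η_r ≡ 0, …, η₁ ≡ 0`. -/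
structure IntegratedByPfaff [IsManifold 𝓘(ℝ, E) ∞ M] {r : ℕ} (V : Set M) (X : VField E M)
    (η : Fin r → DForm E M 1) : Prop where
  /-- The equations define the distribution generated by `X`. -/
  annihilator : ∀ x ∈ V, ∀ v : TangentSpace 𝓘(ℝ, E) x,
    (∀ i, η i x ![v] = 0) ↔ v ∈ Submodule.span ℝ {X x}
  integrable : CompletelyIntegrableOn V η
  /-- Each equation in turn can be solved locally, whatever solutions of the preceding equations
  have been chosen. -/
  step : ∀ (i : Fin r) (W : Set M), IsOpen W → W ⊆ V → ∀ I : Fin r → M → ℝ,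
    (∀ j, i < j → SolvesPfaffOn W η I j) → ∀ p ∈ W,
      ∃ W' : Set M, IsOpen W' ∧ W' ⊆ W ∧ p ∈ W' ∧
        ∃ g : M → ℝ, SolvesPfaffOn W' η (Function.update I i g) i
  /-- Any full sequence of solutions consists of functionally independent first integrals of `X`,
  whose common level sets are locally the orbits of `X`. -/
  orbits : ∀ W : Set M, IsOpen W → W ⊆ V → ∀ I : Fin r → M → ℝ,
    (∀ i, SolvesPfaffOn W η I i) →
      (∀ x ∈ W, LinearIndependent ℝ (fun i => dfun (E := E) (I i) x)) ∧
      (∀ x ∈ W, ∀ i, dfun (I i) x (X x) = 0) ∧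
      ∀ p ∈ W, ∃ W' : Set M, IsOpen W' ∧ W' ⊆ W ∧ p ∈ W' ∧
        ∀ q ∈ W', ∃ (γ : ℝ → M) (a b : ℝ), a < 0 ∧ 0 < b ∧ γ 0 = q ∧
          IsMIntegralCurveOn (I := 𝓘(ℝ, E)) γ X (Set.Ioo a b) ∧
          γ '' Set.Ioo a b = {x ∈ W' | ∀ i, I i x = I i q}

end Pfaff

end LCSInt

end

/-! The map `f ↦ X_f` carries the Jacobi bracket to the Lie bracket (`LCS.mlieBracket_ham`): when
`X_f ⌟ ω = df - f θ` is differentiated, the second derivatives cancel, and `dω = θ ∧ ω`, `dθ = 0`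
take care of the rest. Hence `[X_{f_j}, X_{f_i}]` is the Hamiltonian field of `G(f_0, …, f_j)`. By
the chain rule this is a combination of `X_{f_0}, …, X_{f_j}` plus a multiple of `E`, and Reeb
compatibility puts that multiple in the same span. Appending `R` therefore gives a frame all of
whose initial segments are in involution (`LCS.triangularFrame`). Everything else is a property of
such a `TriangularFrame` `Y`, with `Y 0 = X_H`.

The `C^∞`-structure follows because the coefficients of a smooth field in a smooth frame are smooth.
The Pfaffian forms are, up to nowhere vanishing factors, the dual coframe, so Cartan's formula turns
involutivity of the initial segments into the conditions on `dω_i`. Once the later equations are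
solved, solving the `i`-th one is a triangular condition: `dI_i` kills the frame members before the
`i`-th one and not that member itself (`TriangularFrame.dfun_of_solves`,
`TriangularFrame.solves_of_dfun`). A solution is thus a first integral of one initial segment that
is not a first integral of the next. The Frobenius theorem provides it on `M` itself, without
passing to level sets. A full set of solutions has independent differentials with common kernel
spanned by `X_H`; one more linear coordinate, increasing along `X_H`, gives a chart in which the
level sets are segments, and a change of time makes them integral curves (`exists_orbit_box`).

The Frobenius theorem (`exists_first_integral`) is proved with flows: displace the base point along
the frame members outside `S`, then follow a combination of those in `S` for unit time. Smooth
dependence on the parameters is the inverse function theorem in a Banach space of curves.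
Involutivity and Grönwall's inequality keep the derivatives in the `S`-parameters inside the span of
the `S`-members, so the other parameters, read off by the inverse map, are first integrals. -/

set_option linter.unusedSectionVars false

noncomputable section

namespace LCSInt

/-! ### Calculus on spaces of continuous curves -/

section Curves

open ContinuousMap

universe u

variable {K : Type*} [TopologicalSpace K] [CompactSpace K]

/-- Pointwise evaluation `C(K, G →L G') → C(K, G) →L C(K, G')`. -/
def pointwiseApply (K : Type*) [TopologicalSpace K] [CompactSpace K] (G G' : Type*)
    [NormedAddCommGroup G] [NormedSpace ℝ G] [NormedAddCommGroup G'] [NormedSpace ℝ G'] :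
    C(K, G →L[ℝ] G') →L[ℝ] C(K, G) →L[ℝ] C(K, G') :=
  LinearMap.mkContinuous₂
    (LinearMap.mk₂ ℝ (fun (A : C(K, G →L[ℝ] G')) (v : C(K, G)) =>
        (⟨fun t => A t (v t), by fun_prop⟩ : C(K, G')))
      (fun _ _ _ => by ext; simp) (fun _ _ _ => by ext; simp)
      (fun _ _ _ => by ext; simp) (fun _ _ _ => by ext; simp)) 1
    (fun A v => by
      refine (ContinuousMap.norm_le _ (by positivity)).2 fun t => ?_
      rw [one_mul]
      exact ((A t).le_opNorm _).trans
        (mul_le_mul (A.norm_coe_le_norm t) (v.norm_coe_le_norm t) (norm_nonneg _)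
          ((norm_nonneg (A t)).trans (A.norm_coe_le_norm t))))

@[simp]
theorem pointwiseApply_apply {G G' : Type*}
    [NormedAddCommGroup G] [NormedSpace ℝ G] [NormedAddCommGroup G'] [NormedSpace ℝ G']
    (A : C(K, G →L[ℝ] G')) (v : C(K, G)) (t : K) : pointwiseApply K G G' A v t = A t (v t) := rfl

/-- The mean value inequality on the segment from `y t` to `y t + v t` gives the estimate for each
`t`. It is uniform in `t` because `y ↦ f' ∘ y` is continuous for the supremum norm. -/
theorem hasFDerivAt_postcomp {G G' : Type*} [NormedAddCommGroup G] [NormedSpace ℝ G]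
    [NormedAddCommGroup G'] [NormedSpace ℝ G'] (f : C(G, G')) (f' : C(G, G →L[ℝ] G'))
    (hf : ∀ x, HasFDerivAt f (f' x) x) (y : C(K, G)) :
    HasFDerivAt (fun y : C(K, G) => f.comp y) (pointwiseApply K G G' (f'.comp y)) y := by
  rw [hasFDerivAt_iff_isLittleO_nhds_zero, Asymptotics.isLittleO_iff]
  intro ε hε
  have hc : Continuous fun y : C(K, G) => f'.comp y := f'.continuous_postcomp
  obtain ⟨δ, hδ, hball⟩ := (Metric.continuousAt_iff (f := fun y : C(K, G) => f'.comp y) (a := y)).1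
    hc.continuousAt ε hε
  filter_upwards [Metric.ball_mem_nhds (0 : C(K, G)) hδ] with v hv
  rw [mem_ball_zero_iff] at hv
  refine (ContinuousMap.norm_le _ (by positivity)).2 fun t => ?_
  have key : ‖f (y t + v t) - f (y t) - f' (y t) (y t + v t - y t)‖ ≤ ε * ‖y t + v t - y t‖ := by
    refine (convex_segment (𝕜 := ℝ) (y t) (y t + v t)).norm_image_sub_le_of_norm_hasFDerivWithin_le'
      (fun x _ => (hf x).hasFDerivWithinAt) (fun x hx => ?_)
      (left_mem_segment ℝ _ _) (right_mem_segment ℝ _ _)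
    rw [segment_eq_image'] at hx
    obtain ⟨s, hs, rfl⟩ := hx
    -- A point of the segment is the value at `t` of the curve `y + s • v`, which is as close to `y`
    -- as `v` is to `0`, so the choice of `δ` applies to it.
    have h1 : dist (y + s • v) y < δ := by
      rw [dist_eq_norm, add_sub_cancel_left, norm_smul, Real.norm_of_nonneg hs.1]
      exact (mul_le_of_le_one_left (norm_nonneg _) hs.2).trans_lt hv
    have h2 := (hball h1).le
    have h3 := (ContinuousMap.dist_apply_le_dist t).trans h2
    rw [dist_eq_norm] at h3
    simpa using h3
  simp only [add_sub_cancel_left] at key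
  exact key.trans (mul_le_mul_of_nonneg_left (v.norm_coe_le_norm t) hε.le)

/-- Induction on the order: the derivative is postcomposition with `fderiv ℝ f` followed by the
bounded operator `pointwiseApply`. The target varies in the induction and becomes `G →L[ℝ] G'`,
which is why both spaces share a universe. -/
theorem contDiff_postcomp_nat {K : Type*} [TopologicalSpace K] [CompactSpace K]
    {G : Type u} [NormedAddCommGroup G] [NormedSpace ℝ G] (n : ℕ) :
    ∀ {G' : Type u} [NormedAddCommGroup G'] [NormedSpace ℝ G'] (f : C(G, G')),
      ContDiff ℝ n f → ContDiff ℝ n (fun y : C(K, G) => f.comp y) := by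
  induction n with
  | zero =>
    intro G' _ _ f _
    exact contDiff_zero.2 f.continuous_postcomp
  | succ n ih =>
    intro G' _ _ f hf
    have hf' := (contDiff_succ_iff_fderiv (n := n)).1 (by exact_mod_cast hf)
    have hn : ContDiff ℝ ((n : WithTop ℕ∞) + 1) (fun y : C(K, G) => f.comp y) := by
      let f' : C(G, G →L[ℝ] G') := ⟨fderiv ℝ f, hf'.2.2.continuous⟩
      refine contDiff_succ_iff_hasFDerivAt.2
        ⟨fun y => pointwiseApply K G G' (f'.comp y), ?_, fun y =>
          hasFDerivAt_postcomp f f' (fun x => (hf'.1 x).hasFDerivAt) y⟩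
      exact (pointwiseApply K G G').contDiff.comp (ih f' hf'.2.2)
    exact_mod_cast hn

/-- Composition with a smooth map is a smooth operation on continuous curves. -/
theorem contDiff_postcomp {G : Type u} [NormedAddCommGroup G] [NormedSpace ℝ G]
    {G' : Type u} [NormedAddCommGroup G'] [NormedSpace ℝ G'] (f : C(G, G'))
    (hf : ContDiff ℝ ∞ f) : ContDiff ℝ ∞ (fun y : C(K, G) => f.comp y) :=
  contDiff_infty.2 fun n => contDiff_postcomp_nat n f (contDiff_infty.1 hf n)

/-- Integration from `0`, as an operator on curves over the unit interval. -/
def curveIntegral (G : Type*) [NormedAddCommGroup G] [NormedSpace ℝ G] [CompleteSpace G] :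
    C(unitInterval, G) →L[ℝ] C(unitInterval, G) :=
  LinearMap.mkContinuous
    { toFun := fun y => ⟨fun t => ∫ s in (0 : ℝ)..t, y (Set.projIcc 0 1 zero_le_one s),
        (intervalIntegral.continuous_primitive (fun _ _ =>
          (y.continuous.comp continuous_projIcc).intervalIntegrable _ _) 0).comp
            continuous_subtype_val⟩
      map_add' := fun y z => by
        ext t
        exact intervalIntegral.integral_add
          ((y.continuous.comp continuous_projIcc).intervalIntegrable _ _)
          ((z.continuous.comp continuous_projIcc).intervalIntegrable _ _)
      map_smul' := fun c y => by
        ext t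
        exact intervalIntegral.integral_smul c _ } 1
    (fun y => by
      refine (ContinuousMap.norm_le _ (by positivity)).2 fun t => ?_
      have h := intervalIntegral.norm_integral_le_of_norm_le_const (a := (0 : ℝ)) (b := t)
        (f := fun s => y (Set.projIcc 0 1 zero_le_one s)) (C := ‖y‖)
        (fun s _ => y.norm_coe_le_norm _)
      refine h.trans ?_
      rw [sub_zero, abs_of_nonneg t.2.1, one_mul]
      exact mul_le_of_le_one_right (norm_nonneg _) t.2.2)

theorem curveIntegral_apply {G : Type*} [NormedAddCommGroup G] [NormedSpace ℝ G] [CompleteSpace G]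
    (y : C(unitInterval, G)) (t : unitInterval) :
    curveIntegral G y t = ∫ s in (0 : ℝ)..t, y (Set.projIcc 0 1 zero_le_one s) := rfl

/-- A curve satisfying an integral equation, extended to the real line, is right differentiable. -/
theorem hasDerivWithinAt_of_eq_curveIntegral {G : Type*} [NormedAddCommGroup G] [NormedSpace ℝ G]
    [CompleteSpace G] {y z : C(unitInterval, G)} {v : G}
    (h : y = ContinuousMap.const _ v + curveIntegral G z) {t : ℝ} (ht : t ∈ Set.Ico (0 : ℝ) 1) :
    HasDerivWithinAt (fun s => y (Set.projIcc 0 1 zero_le_one s))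
      (z (Set.projIcc 0 1 zero_le_one t)) (Set.Ici t) t := by
  have h1 : HasDerivAt (fun u => v + ∫ s in (0 : ℝ)..u, z (Set.projIcc 0 1 zero_le_one s))
      (z (Set.projIcc 0 1 zero_le_one t)) t :=
    (intervalIntegral.integral_hasDerivAt_right
      ((z.continuous.comp continuous_projIcc).intervalIntegrable _ _)
      (z.continuous.comp continuous_projIcc).stronglyMeasurable.stronglyMeasurableAtFilter
      (z.continuous.comp continuous_projIcc).continuousAt).const_add v
  have h2 : ∀ s ∈ Set.Icc t 1, y (Set.projIcc 0 1 zero_le_one s) =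
      v + ∫ s in (0 : ℝ)..s, z (Set.projIcc 0 1 zero_le_one s) := fun s hs => by
    rw [h]
    simp [curveIntegral_apply, Set.projIcc_of_mem zero_le_one ⟨ht.1.trans hs.1, hs.2⟩]
  refine h1.hasDerivWithinAt.congr_of_eventuallyEq ?_ (h2 t ⟨le_rfl, ht.2.le⟩)
  filter_upwards [Icc_mem_nhdsGE ht.2] with s hs using h2 s hs

end Curves

/-! ### The inverse function theorem with smoothness on the whole domain -/

/-- Invertible operators form an open set and the derivative is continuous. Shrinking the source
therefore makes the derivative invertible at each of its points, and the inverse is then smooth at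
each point of the target, not just at the image of `a`. -/
theorem exists_smooth_openPartialHomeomorph {G G' : Type*} [NormedAddCommGroup G] [NormedSpace ℝ G]
    [CompleteSpace G] [NormedAddCommGroup G'] [NormedSpace ℝ G'] [CompleteSpace G'] {f : G → G'}
    {a : G} (hf : ∀ᶠ x in 𝓝 a, ContDiffAt ℝ ∞ f x) (f' : G ≃L[ℝ] G')
    (hf' : HasFDerivAt f (f' : G →L[ℝ] G') a) :
    ∃ e : OpenPartialHomeomorph G G', a ∈ e.source ∧ (e : G → G') = f ∧
      (∀ x ∈ e.source, ContDiffAt ℝ ∞ f x ∧ ∃ A : G ≃L[ℝ] G', HasFDerivAt f (A : G →L[ℝ] G') x) ∧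
      ∀ z ∈ e.target, ContDiffAt ℝ ∞ e.symm z := by
  have hfa : ContDiffAt ℝ ∞ f a := hf.self_of_nhds
  have hne : (∞ : WithTop ℕ∞) ≠ 0 := by simp
  let e₀ := hfa.toOpenPartialHomeomorph f hf' hne
  have hcont : ContinuousAt (fderiv ℝ f) a :=
    (hfa.fderiv_right (m := 0) (by simp)).continuousAt
  have hinv : ∀ᶠ x in 𝓝 a, ∃ A : G ≃L[ℝ] G', HasFDerivAt f (A : G →L[ℝ] G') x := by
    have h1 : ∀ᶠ x in 𝓝 a, fderiv ℝ f x ∈ Set.range ((↑) : (G ≃L[ℝ] G') → G →L[ℝ] G') :=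
      hcont.eventually (by rw [hf'.fderiv]; exact ContinuousLinearEquiv.nhds f')
    filter_upwards [h1, hf] with x ⟨A, hA⟩ hx
    exact ⟨A, hA ▸ (hx.differentiableAt hne).hasFDerivAt⟩
  obtain ⟨O, hO, hOo, haO⟩ := eventually_nhds_iff.1 (hf.and hinv)
  refine ⟨e₀.restrOpen O hOo, ⟨hfa.mem_toOpenPartialHomeomorph_source hf' hne, haO⟩, rfl, ?_, ?_⟩
  · intro x hx
    exact hO x hx.2
  · intro z hz
    have hz' := (e₀.restrOpen O hOo).map_target hz
    obtain ⟨h1, A, hA⟩ := hO _ hz'.2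
    exact (e₀.restrOpen O hOo).contDiffAt_symm hz hA h1

/-! ### First integrals of involutive families of vector fields in a vector space -/

section Frobenius

universe u

variable {E : Type u} [NormedAddCommGroup E] [NormedSpace ℝ E] [CompleteSpace E]
  {ι : Type*} [Fintype ι]

/-- The time-`t` curves of the vector fields `∑ a, c a • Z a`, starting at `p + L c`, form a smooth
family of curves over the unit interval, for small `c`. -/
theorem exists_smooth_flow_family (Z : ι → C(E, E)) (hZ : ∀ a, ContDiff ℝ ∞ (Z a)) (p : E)
    (L : (ι → ℝ) →L[ℝ] E) :
    ∃ Φ : (ι → ℝ) → C(unitInterval, E), Φ 0 = ContinuousMap.const _ p ∧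
      ∀ᶠ c in 𝓝 0, ContDiffAt ℝ ∞ Φ c ∧
        Φ c = ContinuousMap.const _ (p + L c)
          + curveIntegral E (∑ a, c a • (Z a).comp (Φ c)) := by
  let C := C(unitInterval, E)
  let κ : E →L[ℝ] C := ContinuousLinearMap.const ℝ unitInterval
  have hN : ∀ a, ContDiff ℝ ∞ (fun y : C => (Z a).comp y) := fun a => contDiff_postcomp _ (hZ a)
  -- A curve solves the integral equation with parameter `c` exactly when `f` sends the pair to `(c,
  -- 0)`. Since `f` keeps the parameter, inverting it plays the role of the implicit function
  -- theorem.
  let f : (ι → ℝ) × C → (ι → ℝ) × C := fun q =>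
    (q.1, q.2 - κ (p + L q.1) - curveIntegral E (∑ a, q.1 a • (Z a).comp q.2))
  have hf : ContDiff ℝ ∞ f := by
    have h1 : ContDiff ℝ ∞ fun q : (ι → ℝ) × C => ∑ a, q.1 a • (Z a).comp q.2 :=
      ContDiff.sum fun a _ => ContDiff.smul
        (((ContinuousLinearMap.proj (R := ℝ) (φ := fun _ : ι => ℝ) a) ∘L
          ContinuousLinearMap.fst ℝ (ι → ℝ) C).contDiff) ((hN a).comp contDiff_snd)
    have h2 : ContDiff ℝ ∞ fun q : (ι → ℝ) × C => κ (p + L q.1) := by fun_prop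
    exact contDiff_fst.prodMk ((contDiff_snd.sub h2).sub ((curveIntegral E).contDiff.comp h1))
  -- At `c = 0` the integrand is multiplied by vanishing coefficients, so varying the curve changes
  -- it only to second order. The derivative of `f` is then `(k, v) ↦ (k, v - B k)`, with inverse
  -- `(k, v) ↦ (k, v + B k)`.
  let B : (ι → ℝ) →L[ℝ] C := κ ∘L L + curveIntegral E ∘L
    ∑ a, (ContinuousLinearMap.proj a).smulRight ((Z a).comp (κ p))
  let f' : ((ι → ℝ) × C) ≃L[ℝ] (ι → ℝ) × C := ContinuousLinearEquiv.equivOfInverse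
    ((ContinuousLinearMap.fst ℝ _ _).prod
      (ContinuousLinearMap.snd ℝ _ _ - B ∘L ContinuousLinearMap.fst ℝ _ _))
    ((ContinuousLinearMap.fst ℝ _ _).prod
      (ContinuousLinearMap.snd ℝ _ _ + B ∘L ContinuousLinearMap.fst ℝ _ _))
    (fun q => by simp) (fun q => by simp)
  have hf' : HasFDerivAt f (f' : _ →L[ℝ] _) (0, κ p) := by
    have h1 : ∀ a, HasFDerivAt (fun q : (ι → ℝ) × C => q.1 a • (Z a).comp q.2)
        (((ContinuousLinearMap.proj a).smulRight ((Z a).comp (κ p))) ∘L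
          ContinuousLinearMap.fst ℝ (ι → ℝ) C) (0, κ p) := by
      intro a
      have h2 : HasFDerivAt (fun q : (ι → ℝ) × C => q.1 a)
          ((ContinuousLinearMap.proj a) ∘L ContinuousLinearMap.fst ℝ (ι → ℝ) C) (0, κ p) :=
        ((ContinuousLinearMap.proj (R := ℝ) (φ := fun _ : ι => ℝ) a) ∘L
          ContinuousLinearMap.fst ℝ (ι → ℝ) C).hasFDerivAt
      have h3 := ((hN a).comp (contDiff_snd (E := ι → ℝ))).differentiable (by simp)
        ((0, κ p) : (ι → ℝ) × C)
      have h4 := h2.smul h3.hasFDerivAt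
      refine h4.congr_fderiv ?_
      refine ContinuousLinearMap.ext fun q => ?_
      simp
    have h5 : HasFDerivAt (fun q : (ι → ℝ) × C => κ (p + L q.1))
        ((κ ∘L L) ∘L ContinuousLinearMap.fst ℝ (ι → ℝ) C) (0, κ p) := by
      have := ((κ ∘L L) ∘L ContinuousLinearMap.fst ℝ (ι → ℝ) C).hasFDerivAt.const_add (κ p)
        (x := (0, κ p))
      refine this.congr_of_eventuallyEq (.of_forall fun q => by simp)
    have h6 := (curveIntegral E).hasFDerivAt.comp (0, κ p)
      (HasFDerivAt.fun_sum (u := Finset.univ) fun a _ => h1 a)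
    have h7 : HasFDerivAt (Prod.fst : (ι → ℝ) × C → _) (ContinuousLinearMap.fst ℝ _ _) (0, κ p) :=
      hasFDerivAt_fst
    have h8 : HasFDerivAt (Prod.snd : (ι → ℝ) × C → _) (ContinuousLinearMap.snd ℝ _ _) (0, κ p) :=
      hasFDerivAt_snd
    refine (h7.prodMk ((h8.sub h5).sub h6)).congr_fderiv ?_
    refine ContinuousLinearMap.ext fun q => ?_
    simp [f', B, sub_sub]
  obtain ⟨e, he, hef, -, hes⟩ := exists_smooth_openPartialHomeomorph
    (.of_forall fun x => hf.contDiffAt) f' hf'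
  have hf0 : f (0, κ p) = (0, 0) := by simp [f]
  have hmem : ((0 : ι → ℝ), (0 : C)) ∈ e.target := by
    have := e.map_source he
    rwa [hef, hf0] at this
  refine ⟨fun c => (e.symm (c, 0)).2, ?_, ?_⟩
  · have := e.left_inv he
    rw [hef, hf0] at this
    simp only [this]
    rfl
  · have hev : ∀ᶠ c : ι → ℝ in 𝓝 0, (c, (0 : C)) ∈ e.target :=
      (Continuous.prodMk_left (0 : C)).continuousAt.eventually (e.open_target.mem_nhds hmem)
    filter_upwards [hev] with c hc
    refine ⟨?_, ?_⟩
    · have h1 : ContDiffAt ℝ ∞ (fun c : ι → ℝ => (c, (0 : C))) c := by fun_prop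
      exact contDiffAt_snd.comp c (ContDiffAt.comp c (hes _ hc) h1)
    · have h1 := e.right_inv hc
      rw [hef] at h1
      have h2 : (e.symm (c, 0)).1 = c := congrArg Prod.fst h1
      have h3 := congrArg Prod.snd h1
      simp only [f, h2] at h3
      rw [sub_sub, sub_eq_zero] at h3
      exact h3

/-- The variational equation of the smooth family of curves. -/
theorem fderiv_flow_family {Z : ι → C(E, E)} (hZ : ∀ a, ContDiff ℝ ∞ (Z a)) {p : E}
    {L : (ι → ℝ) →L[ℝ] E} {Φ : (ι → ℝ) → C(unitInterval, E)} {c : ι → ℝ}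
    (hd : ContDiffAt ℝ ∞ Φ c)
    (hΦ : ∀ᶠ c in 𝓝 c, Φ c = ContinuousMap.const _ (p + L c)
          + curveIntegral E (∑ a, c a • (Z a).comp (Φ c))) (k : ι → ℝ) :
    fderiv ℝ Φ c k = ContinuousMap.const _ (L k) + curveIntegral E
      (∑ a, (k a • (Z a).comp (Φ c) + c a • pointwiseApply _ E E
        ((⟨fderiv ℝ (Z a), (hZ a).continuous_fderiv (by simp)⟩ : C(E, E →L[ℝ] E)).comp (Φ c))
        (fderiv ℝ Φ c k))) := by
  let C := C(unitInterval, E)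
  let κ : E →L[ℝ] C := ContinuousLinearMap.const ℝ unitInterval
  have h0 : HasFDerivAt Φ (fderiv ℝ Φ c) c := (hd.differentiableAt (by simp)).hasFDerivAt
  have h1 : ∀ a, HasFDerivAt (fun c => (Z a).comp (Φ c)) _ c := fun a =>
    (hasFDerivAt_postcomp (Z a) ⟨fderiv ℝ (Z a), (hZ a).continuous_fderiv (by simp)⟩
      (fun x => ((hZ a).differentiable (by simp) x).hasFDerivAt) (Φ c)).comp c h0
  have h2 : ∀ a, HasFDerivAt (fun c : ι → ℝ => c a) (ContinuousLinearMap.proj a) c := fun a =>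
    (ContinuousLinearMap.proj (R := ℝ) (φ := fun _ : ι => ℝ) a).hasFDerivAt
  have h3 := (curveIntegral E).hasFDerivAt.comp c
      (HasFDerivAt.fun_sum (u := Finset.univ) fun a _ => (h2 a).smul (h1 a))
  have h4 : HasFDerivAt (fun c => κ (p + L c)) (κ ∘L L) c :=
    κ.hasFDerivAt.comp c (L.hasFDerivAt.const_add p)
  have h5 := (h4.add h3).congr_of_eventuallyEq hΦ
  have h6 := congrArg (fun A => A k) h5.fderiv
  refine h6.trans ?_
  change κ (L k) + curveIntegral E ((∑ a, _ : (ι → ℝ) →L[ℝ] C) k) = _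
  rw [sum_apply]
  refine congrArg (fun v => κ (L k) + curveIntegral E v) (Finset.sum_congr rfl fun a _ => ?_)
  exact add_comm _ _

end Frobenius

/-- A map which is smooth near a point of a finite-dimensional space agrees near that point with a
globally smooth map. -/
theorem exists_contDiff_eventuallyEq {G G' : Type*} [NormedAddCommGroup G] [NormedSpace ℝ G]
    [FiniteDimensional ℝ G] [NormedAddCommGroup G'] [NormedSpace ℝ G'] {f : G → G'} {p : G}
    (hf : ∀ᶠ x in 𝓝 p, ContDiffAt ℝ ∞ f x) :
    ∃ g : G → G', ContDiff ℝ ∞ g ∧ g =ᶠ[𝓝 p] f := by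
  obtain ⟨r, hr, hball⟩ := Metric.eventually_nhds_iff_ball.1 hf
  -- The cutoff vanishes beyond distance `r / 2`, well inside the ball of radius `r` where `f` is
  -- smooth, so `χ • f` is smooth everywhere.
  let χ : ContDiffBump p := ⟨r / 4, r / 2, by positivity, by linarith⟩
  refine ⟨fun x => χ x • f x, contDiff_iff_contDiffAt.2 fun x => ?_, ?_⟩
  · by_cases hx : x ∈ Metric.ball p r
    · exact χ.contDiff.contDiffAt.smul (hball x hx)
    · have h1 : (fun x => χ x • f x) =ᶠ[𝓝 x] fun _ => 0 := by
        have h2 : x ∈ (Metric.closedBall p (r / 2))ᶜ := by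
          simp only [Set.mem_compl_iff, Metric.mem_closedBall, Metric.mem_ball] at hx ⊢
          linarith
        filter_upwards [Metric.isClosed_closedBall.isOpen_compl.mem_nhds h2] with z hz
        simp only [Set.mem_compl_iff, Metric.mem_closedBall, not_le] at hz
        rw [χ.zero_of_le_dist hz.le, zero_smul]
      exact contDiffAt_const.congr_of_eventuallyEq h1
  · filter_upwards [χ.eventuallyEq_one] with x hx
    rw [hx, Pi.one_apply, one_smul]

/-! ### Frames of a vector space and their coordinates -/

section Frame

variable {E : Type*} [NormedAddCommGroup E] [NormedSpace ℝ E] {ι : Type*} [Fintype ι]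

/-- The map `c ↦ ∑ a, c a • Y a` given by a family of vectors. -/
def frameMap (Y : ι → E) : (ι → ℝ) →L[ℝ] E :=
  ∑ a, (ContinuousLinearMap.proj a).smulRight (Y a)

theorem frameMap_apply (Y : ι → E) (c : ι → ℝ) : frameMap Y c = ∑ a, c a • Y a := by
  simp [frameMap]

theorem frameMap_single [DecidableEq ι] (Y : ι → E) (a : ι) :
    frameMap Y (Pi.single a 1) = Y a := by
  simp [frameMap_apply, Pi.single_apply]

theorem frameMap_isInvertible [FiniteDimensional ℝ E] {Y : ι → E} (hY : LinearIndependent ℝ Y)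
    (hc : Fintype.card ι = Module.finrank ℝ E) : (frameMap Y).IsInvertible := by
  -- `basisOfLinearIndependentOfCardEqFinrank` needs a nonempty index type; an empty frame lives in
  -- the zero space.
  cases isEmpty_or_nonempty ι
  · have : Subsingleton E := Module.finrank_zero_iff.1 (by rw [← hc, Fintype.card_eq_zero])
    exact ⟨⟨0, by fun_prop, by fun_prop⟩, by ext x; exact Subsingleton.elim _ _⟩
  · let b := basisOfLinearIndependentOfCardEqFinrank hY hc
    refine ⟨b.equivFun.symm.toContinuousLinearEquiv, ?_⟩
    ext c
    simp [frameMap_apply, b, Module.Basis.equivFun_symm_apply]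

theorem contDiffAt_frameMap {G : Type*} [NormedAddCommGroup G] [NormedSpace ℝ G] {Y : ι → G → E}
    {n : WithTop ℕ∞} {x : G}
    (hY : ∀ a, ContDiffAt ℝ n (Y a) x) : ContDiffAt ℝ n (fun x => frameMap (Y · x)) x :=
  ContDiffAt.sum fun a _ => ((ContinuousLinearMap.smulRightL ℝ (ι → ℝ) E
    (ContinuousLinearMap.proj a)).contDiff.contDiffAt).comp x (hY a)

theorem hasDerivWithinAt_frameMap {Y : ι → ℝ → E} {Y' : ι → E} {s : Set ℝ} {t : ℝ}
    (hY : ∀ a, HasDerivWithinAt (Y a) (Y' a) s t) :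
    HasDerivWithinAt (fun t => frameMap (Y · t)) (frameMap Y') s t := by
  have h : ∀ a, HasDerivWithinAt
      (fun t => (ContinuousLinearMap.proj (R := ℝ) (φ := fun _ : ι => ℝ) a).smulRight (Y a t))
      ((ContinuousLinearMap.proj a).smulRight (Y' a)) s t := fun a => by
    let B : E →L[ℝ] (ι → ℝ) →L[ℝ] E :=
      ContinuousLinearMap.smulRightL ℝ (ι → ℝ) E (ContinuousLinearMap.proj a)
    exact B.hasFDerivAt.comp_hasDerivWithinAt t (hY a)
  exact HasDerivWithinAt.fun_sum fun a _ => h a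

theorem contDiffAt_frameMap_inverse [CompleteSpace E] {G : Type*} [NormedAddCommGroup G]
    [NormedSpace ℝ G] {Y : ι → G → E} {n : WithTop ℕ∞} {x : G} (hY : ∀ a, ContDiffAt ℝ n (Y a) x)
    (hx : (frameMap (Y · x)).IsInvertible) :
    ContDiffAt ℝ n (fun x => (frameMap (Y · x)).inverse) x := by
  obtain ⟨A, hA⟩ := hx
  have h : ContDiffAt ℝ n ContinuousLinearMap.inverse (A : (ι → ℝ) →L[ℝ] E) :=
    contDiffAt_map_inverse A
  rw [hA] at h
  exact h.comp x (contDiffAt_frameMap hY)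

theorem eventually_frameMap_isInvertible [CompleteSpace E] {G : Type*} [TopologicalSpace G]
    {Y : ι → G → E} {x : G} (hY : ∀ a, ContinuousAt (Y a) x)
    (hx : (frameMap (Y · x)).IsInvertible) : ∀ᶠ y in 𝓝 x, (frameMap (Y · y)).IsInvertible := by
  obtain ⟨A, hA⟩ := hx
  have h1 : ContinuousAt (fun x => frameMap (Y · x)) x := by
    refine tendsto_finsetSum _ fun a _ => ?_
    exact ((ContinuousLinearMap.smulRightL ℝ (ι → ℝ) E
      (ContinuousLinearMap.proj a)).continuous.continuousAt (x := Y a x)).comp (hY a)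
  have h2 := h1.eventually (p := fun B => B ∈ Set.range ((↑) : ((ι → ℝ) ≃L[ℝ] E) → _))
    (by change ∀ᶠ B in 𝓝 (frameMap (Y · x)), _; rw [← hA]; exact ContinuousLinearEquiv.nhds A)
  exact h2

theorem inverse_frameMap_apply {Y : ι → E} (hY : (frameMap Y).IsInvertible) (c : ι → ℝ) :
    (frameMap Y).inverse (frameMap Y c) = c := by
  obtain ⟨A, hA⟩ := hY
  rw [← hA, ContinuousLinearMap.inverse_equiv]
  exact A.symm_apply_apply c

theorem frameMap_inverse_apply {Y : ι → E} (hY : (frameMap Y).IsInvertible) (v : E) :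
    frameMap Y ((frameMap Y).inverse v) = v := by
  obtain ⟨A, hA⟩ := hY
  rw [← hA, ContinuousLinearMap.inverse_equiv]
  exact A.apply_symm_apply v

theorem inverse_frameMap_of_mem_span {Y : ι → E} (hY : (frameMap Y).IsInvertible) {S : Set ι}
    {v : E} (hv : v ∈ Submodule.span ℝ (Y '' S)) {l : ι} (hl : l ∉ S) :
    (frameMap Y).inverse v l = 0 := by
  classical
  induction hv using Submodule.span_induction with
  | mem x hx =>
    obtain ⟨a, ha, rfl⟩ := hx
    rw [← frameMap_single Y a, inverse_frameMap_apply hY,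
      Pi.single_eq_of_ne (by rintro rfl; exact hl ha)]
  | zero => simp
  | add x y _ _ hx hy => simp [hx, hy]
  | smul c x _ hx => simp [hx]

end Frame

/-! ### The Frobenius theorem in a vector space -/

section Frobenius

universe u

variable {E : Type u} [NormedAddCommGroup E] [NormedSpace ℝ E] [CompleteSpace E]
  {ι : Type*} [Fintype ι]

open VectorField in
/-- Solutions of the variational equation along a flow curve of an involutive family stay in the
span of that family. -/
theorem frame_coordinates_eq_zero {Y Z : ι → E → E} {S : Set ι} {O : Set E} {K : ℝ}
    {c k : ι → ℝ} {y w : ℝ → E}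
    (hY : ∀ x ∈ O, ∀ a, ContDiffAt ℝ 1 (Y a) x)
    (hinv : ∀ x ∈ O, (frameMap (Y · x)).IsInvertible)
    (hbr : ∀ x ∈ O, ∀ a ∈ S, ∀ b,
      lieBracket ℝ (Y a) (Z b) x ∈ Submodule.span ℝ ((Y · x) '' S))
    (hK : ∀ x ∈ O, ∀ a b, ‖(frameMap (Y · x)).inverse (lieBracket ℝ (Y a) (Z b) x)‖ ≤ K)
    (hZk : ∀ x ∈ O, ∑ a, k a • Z a x ∈ Submodule.span ℝ ((Y · x) '' S))
    (hyc : ContinuousOn y (Set.Icc 0 1)) (hwc : ContinuousOn w (Set.Icc 0 1))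
    (hyO : ∀ t ∈ Set.Icc (0 : ℝ) 1, y t ∈ O) (hw0 : w 0 = 0)
    (hy : ∀ t ∈ Set.Ico (0 : ℝ) 1, HasDerivWithinAt y (∑ a, c a • Z a (y t)) (Set.Ici t) t)
    (hw : ∀ t ∈ Set.Ico (0 : ℝ) 1, HasDerivWithinAt w
      (∑ a, (k a • Z a (y t) + c a • fderiv ℝ (Z a) (y t) (w t))) (Set.Ici t) t)
    {t : ℝ} (ht : t ∈ Set.Icc (0 : ℝ) 1) {l : ι} (hl : l ∉ S) :
    (frameMap (Y · (y t))).inverse (w t) l = 0 := by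
  classical
  let lam : E → E →L[ℝ] (ι → ℝ) := fun x => (frameMap (Y · x)).inverse
  let z : ℝ → ι → ℝ := fun t => lam (y t) (w t)
  have hlamd : ∀ x ∈ O, ContDiffAt ℝ 1 lam x := fun x hx =>
    contDiffAt_frameMap_inverse (hY x hx) (hinv x hx)
  -- `π` keeps the coordinates outside `S` and kills the others; the aim is `π (z t) = 0`.
  let π : (ι → ℝ) →L[ℝ] (ι → ℝ) :=
    ContinuousLinearMap.pi fun l => if l ∈ S then 0 else ContinuousLinearMap.proj l
  have hπ : ∀ v l, π v l = if l ∈ S then 0 else v l := fun v l => by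
    by_cases h : l ∈ S <;> simp [π, h]
  have hπ0 : ∀ x ∈ O, ∀ v ∈ Submodule.span ℝ ((Y · x) '' S), π (lam x v) = 0 := by
    intro x hx v hv
    ext l
    rw [hπ]
    split_ifs with h
    · rfl
    · exact inverse_frameMap_of_mem_span (hinv x hx) hv h
  -- Differentiate `w = ∑ z_a Y_a(y)` along the curve: the terms with derivatives of `Y_a` and those
  -- of the variational equation combine into the brackets `[Y_a, Z_b]`.
  have hderiv : ∀ t ∈ Set.Ico (0 : ℝ) 1, HasDerivWithinAt z
      (lam (y t) (∑ a, k a • Z a (y t)) +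
        ∑ a, z t a • ∑ b, c b • lam (y t) (lieBracket ℝ (Y a) (Z b) (y t))) (Set.Ici t) t := by
    intro t ht
    have hO := hyO t ⟨ht.1, ht.2.le⟩
    have hz : DifferentiableWithinAt ℝ z (Set.Ici t) t :=
      (((hlamd _ hO).differentiableAt one_ne_zero).comp_differentiableWithinAt t
        (hy t ht).differentiableWithinAt).clm_apply (hw t ht).differentiableWithinAt
    have hYd : ∀ a, HasDerivWithinAt (fun s => Y a (y s))
        (fderiv ℝ (Y a) (y t) (∑ b, c b • Z b (y t))) (Set.Ici t) t := fun a =>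
      ((hY _ hO a).differentiableAt one_ne_zero).hasFDerivAt.comp_hasDerivWithinAt t (hy t ht)
    have h1 := (hasDerivWithinAt_frameMap hYd).clm_apply hz.hasDerivWithinAt
    have h2 : HasDerivWithinAt (fun s => frameMap (Y · (y s)) (z s))
        (∑ a, (k a • Z a (y t) + c a • fderiv ℝ (Z a) (y t) (w t))) (Set.Ici t) t := by
      refine (hw t ht).congr_of_eventuallyEq ?_
        (frameMap_inverse_apply (hinv _ hO) _)
      filter_upwards [Icc_mem_nhdsGE ht.2] with s hs
      exact frameMap_inverse_apply (hinv _ (hyO s ⟨ht.1.trans hs.1, hs.2⟩)) _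
    have h3 := (uniqueDiffWithinAt_Ici t).eq_deriv _ h1 h2
    have hwz : w t = ∑ a, z t a • Y a (y t) := by
      rw [← frameMap_apply]
      exact (frameMap_inverse_apply (hinv _ hO) _).symm
    have h4 : frameMap (Y · (y t)) (derivWithin z (Set.Ici t) t) = (∑ a, k a • Z a (y t)) +
        ∑ a, z t a • ∑ b, c b • lieBracket ℝ (Y a) (Z b) (y t) := by
      rw [← eq_sub_iff_add_eq'] at h3
      rw [h3, Finset.sum_add_distrib, add_sub_assoc, frameMap_apply]
      congr 1
      simp only [lieBracket, smul_sub, Finset.sum_sub_distrib, map_sum, map_smul]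
      congr 1
      rw [hwz]
      simp only [map_sum, map_smul, Finset.smul_sum]
      rw [Finset.sum_comm]
      exact Finset.sum_congr rfl fun a _ => Finset.sum_congr rfl fun b _ => smul_comm _ _ _
    have h5 : derivWithin z (Set.Ici t) t = _ :=
      (inverse_frameMap_apply (hinv _ hO) _).symm.trans (congrArg (lam (y t)) h4)
    have h6 := hz.hasDerivWithinAt
    rw [h5] at h6
    simpa only [map_add, map_sum, map_smul] using h6
  -- After projection the terms with `a ∈ S` vanish by involutivity and the inhomogeneous term
  -- vanishes by `hZk`. What remains is linear and homogeneous in `π z`, so Grönwall's inequality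
  -- applies with zero initial value.
  have hπz : ∀ t ∈ Set.Ico (0 : ℝ) 1, HasDerivWithinAt (fun t => π (z t))
      (∑ a, π (z t) a • ∑ b, c b • π (lam (y t) (lieBracket ℝ (Y a) (Z b) (y t))))
      (Set.Ici t) t := by
    intro t ht
    have hO := hyO t ⟨ht.1, ht.2.le⟩
    have h1 := π.hasFDerivAt.comp_hasDerivWithinAt t (hderiv t ht)
    refine h1.congr_deriv ?_
    rw [map_add, hπ0 _ hO _ (hZk _ hO), zero_add, map_sum]
    refine Finset.sum_congr rfl fun a _ => ?_
    symm
    simp only [map_smul, map_sum]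
    rw [hπ]
    split_ifs with h
    · rw [Finset.sum_eq_zero fun b _ => by rw [hπ0 _ hO _ (hbr _ hO a h b), smul_zero]]
      simp
    · rfl
  have hπnorm : ∀ v, ‖π v‖ ≤ ‖v‖ := fun v => (pi_norm_le_iff_of_nonneg (norm_nonneg _)).2 fun l => by
    rw [hπ]
    split_ifs
    · simp
    · exact norm_le_pi_norm v l
  have hbound : ∀ t ∈ Set.Ico (0 : ℝ) 1,
      ‖∑ a, π (z t) a • ∑ b, c b • π (lam (y t) (lieBracket ℝ (Y a) (Z b) (y t)))‖
        ≤ (∑ _a : ι, ∑ b, ‖c b‖ * K) * ‖π (z t)‖ + 0 := by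
    intro t ht
    have hO := hyO t ⟨ht.1, ht.2.le⟩
    rw [add_zero, Finset.sum_mul]
    refine norm_sum_le_of_le _ fun a _ => ?_
    rw [norm_smul, mul_comm]
    refine mul_le_mul ?_ (norm_le_pi_norm _ a) (norm_nonneg _) ?_
    · refine norm_sum_le_of_le _ fun b _ => ?_
      rw [norm_smul]
      exact mul_le_mul_of_nonneg_left ((hπnorm _).trans (hK _ hO a b)) (norm_nonneg _)
    · exact Finset.sum_nonneg fun b _ =>
        mul_nonneg (norm_nonneg _) ((norm_nonneg _).trans (hK _ hO a b))
  have hzc : ContinuousOn (fun t => π (z t)) (Set.Icc 0 1) := by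
    refine π.continuous.comp_continuousOn (ContinuousOn.clm_apply (fun t ht => ?_) hwc)
    exact ((hlamd _ (hyO t ht)).continuousAt).comp_continuousWithinAt (hyc t ht)
  have h0 : ‖π (z 0)‖ ≤ 0 := by simp [z, hw0]
  have hfin := norm_le_gronwallBound_of_norm_deriv_right_le hzc hπz h0 hbound t ht
  rw [gronwallBound_ε0_δ0, norm_le_zero_iff] at hfin
  have := congrFun hfin l
  rw [hπ, if_neg hl] at this
  exact this

end Frobenius

section Frobenius

universe u

variable {E : Type u} [NormedAddCommGroup E] [NormedSpace ℝ E] [FiniteDimensional ℝ E]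
  {ι : Type*} [Fintype ι]

open VectorField in
/-- **Frobenius theorem** for a smooth frame of a finite-dimensional space whose members with index
in `S` are in involution: for `b ∉ S` there is a local first integral of the members with index in
`S` which is not a first integral of the `b`-th member. -/
theorem exists_first_integral {Y : ι → E → E} {p : E} {S : Set ι}
    (hY : ∀ᶠ x in 𝓝 p, ∀ a, ContDiffAt ℝ ∞ (Y a) x)
    (hp : (frameMap (Y · p)).IsInvertible)
    (hS : ∀ᶠ x in 𝓝 p, ∀ a ∈ S, ∀ b ∈ S,
      lieBracket ℝ (Y a) (Y b) x ∈ Submodule.span ℝ ((Y · x) '' S)) {b : ι} (hb : b ∉ S) :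
    ∃ g : E → ℝ, (∀ᶠ x in 𝓝 p, ContDiffAt ℝ ∞ g x) ∧
      (∀ᶠ x in 𝓝 p, ∀ a ∈ S, fderiv ℝ g x (Y a x) = 0) ∧ fderiv ℝ g p (Y b p) = 1 := by
  classical
  have : CompleteSpace E := FiniteDimensional.complete ℝ E
  -- The flow uses only the members in `S`: the others are replaced by zero, and all are made global
  -- by a cutoff.
  have hZ : ∀ a, ∃ Z : E → E, ContDiff ℝ ∞ Z ∧ Z =ᶠ[𝓝 p] fun x => if a ∈ S then Y a x else 0 := by
    intro a
    refine exists_contDiff_eventuallyEq ?_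
    filter_upwards [hY] with x hx
    split_ifs
    · exact hx a
    · exact contDiffAt_const
  choose Z hZs hZe using hZ
  have hZY : ∀ᶠ x in 𝓝 p, ∀ a, Z a =ᶠ[𝓝 x] fun x => if a ∈ S then Y a x else 0 :=
    Filter.eventually_all.2 fun a => (hZe a).eventuallyEq_nhds
  have hZS : ∀ᶠ x in 𝓝 p, ∀ a, Z a x ∈ Submodule.span ℝ ((Y · x) '' S) := by
    filter_upwards [hZY] with x hx a
    rw [(hx a).eq_of_nhds]
    split_ifs with h
    · exact Submodule.subset_span ⟨a, h, rfl⟩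
    · exact zero_mem _
  have hinv : ∀ᶠ x in 𝓝 p, (frameMap (Y · x)).IsInvertible :=
    eventually_frameMap_isInvertible (fun a => (hY.self_of_nhds a).continuousAt) hp
  have hbr : ∀ᶠ x in 𝓝 p, ∀ a ∈ S, ∀ b,
      lieBracket ℝ (Y a) (Z b) x ∈ Submodule.span ℝ ((Y · x) '' S) := by
    filter_upwards [hZY, hS] with x hx hSx a ha b
    rw [Filter.EventuallyEq.lieBracket_vectorField_eq (Filter.EventuallyEq.refl _ (Y a)) (hx b)]
    by_cases h : b ∈ S
    · simpa only [if_pos h] using hSx a ha b h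
    · simp only [if_neg h]
      have h0 : lieBracket ℝ (Y a) (fun _ => (0 : E)) x = 0 := by simp [lieBracket]
      rw [h0]
      exact zero_mem _
  -- Each norm is continuous at `p`, hence below its value at `p` plus one nearby; the sum over all
  -- pairs is a common bound.
  obtain ⟨K, hK⟩ : ∃ K, ∀ᶠ x in 𝓝 p, ∀ a b,
      ‖(frameMap (Y · x)).inverse (lieBracket ℝ (Y a) (Z b) x)‖ ≤ K := by
    have hc : ∀ a b, ContinuousAt (fun x =>
        ‖(frameMap (Y · x)).inverse (lieBracket ℝ (Y a) (Z b) x)‖) p := by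
      intro a b
      have h1 := hY.self_of_nhds
      have h2 : ContDiffAt ℝ 0 (lieBracket ℝ (Y a) (Z b)) p :=
        (h1 a).lieBracket_vectorField (hZs b).contDiffAt (by simp)
      exact ((contDiffAt_frameMap_inverse h1 hp).continuousAt.clm_apply h2.continuousAt).norm
    let C : ι → ι → ℝ := fun a b => ‖(frameMap (Y · p)).inverse (lieBracket ℝ (Y a) (Z b) p)‖ + 1
    have hC : ∀ a b, 0 ≤ C a b := fun a b => by positivity
    refine ⟨∑ a, ∑ b, C a b, Filter.eventually_all.2 fun a => Filter.eventually_all.2 fun b => ?_⟩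
    filter_upwards [(hc a b).eventually (gt_mem_nhds (lt_add_one _))] with x hx
    exact hx.le.trans <| (Finset.single_le_sum (fun b _ => hC a b) (Finset.mem_univ b)).trans <|
      Finset.single_le_sum (f := fun a => ∑ b, C a b)
        (fun a _ => Finset.sum_nonneg fun b _ => hC a b) (Finset.mem_univ a)
  have hall := hY.and (hinv.and (hbr.and (hK.and hZS)))
  obtain ⟨r, hr, hO⟩ := Metric.eventually_nhds_iff_ball.1 hall
  -- Parameters outside `S` move the starting point, while those in `S` select the flow, so each
  -- parameter is used exactly once.
  let L : (ι → ℝ) →L[ℝ] E := frameMap fun a => if a ∈ S then 0 else Y a p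
  obtain ⟨Φ, hΦ0, hΦ⟩ := exists_smooth_flow_family
    (fun a => ⟨Z a, (hZs a).continuous⟩) hZs p L
  have hΦe := hΦ.eventually_nhds
  have hΦO : ∀ᶠ c in 𝓝 0, ∀ t, Φ c t ∈ Metric.ball p r := by
    have h1 : ContinuousAt Φ 0 := hΦ.self_of_nhds.1.continuousAt
    filter_upwards [(Metric.continuousAt_iff'.1 h1) r hr] with c hc t
    have h2 := (ContinuousMap.dist_apply_le_dist t).trans_lt hc
    rw [hΦ0] at h2
    exact h2
  let ev : C(unitInterval, E) →L[ℝ] E := ContinuousMap.evalCLM ℝ 1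
  let ψ : (ι → ℝ) → E := fun c => Φ c 1
  have hψd : ∀ᶠ c in 𝓝 0, ContDiffAt ℝ ∞ ψ c := by
    filter_upwards [hΦ] with c hc
    exact ev.contDiff.contDiffAt.comp c hc.1
  have hψ : ∀ᶠ c in 𝓝 0, HasFDerivAt ψ (ev ∘L fderiv ℝ Φ c) c := by
    filter_upwards [hΦ] with c hc
    exact ev.hasFDerivAt.comp c (hc.1.differentiableAt (by simp)).hasFDerivAt
  -- the derivative maps parameters supported on `S` into the span of the family
  have hspan : ∀ᶠ c in 𝓝 0, ∀ k : ι → ℝ, (∀ l ∉ S, k l = 0) →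
      ∀ l ∉ S, (frameMap (Y · (ψ c))).inverse (fderiv ℝ Φ c k 1) l = 0 := by
    filter_upwards [hΦe, hΦO] with c hc hcO k hk l hl
    have hfk := fderiv_flow_family hZs hc.self_of_nhds.1 (hc.mono fun _ h => h.2) k
    have hyE := hc.self_of_nhds.2
    have hLk : L k = 0 := by
      rw [frameMap_apply]
      refine Finset.sum_eq_zero fun a _ => ?_
      split_ifs with h
      · simp
      · rw [hk a h, zero_smul]
    have hres := frame_coordinates_eq_zero (Y := Y) (Z := Z) (S := S) (O := Metric.ball p r)
      (K := K) (c := c) (k := k) (y := fun s => Φ c (Set.projIcc 0 1 zero_le_one s))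
      (w := fun s => fderiv ℝ Φ c k (Set.projIcc 0 1 zero_le_one s))
      (fun x hx a => ((hO x hx).1 a).of_le (by simp)) (fun x hx => (hO x hx).2.1)
      (fun x hx => (hO x hx).2.2.1) (fun x hx => (hO x hx).2.2.2.1)
      (fun x hx => Submodule.sum_mem _ fun a _ => Submodule.smul_mem _ _ ((hO x hx).2.2.2.2 a))
      ((Φ c).continuous.comp continuous_projIcc).continuousOn
      ((fderiv ℝ Φ c k).continuous.comp continuous_projIcc).continuousOn
      (fun t _ => hcO _) ?_ ?_ ?_ (t := 1) ⟨zero_le_one, le_rfl⟩ hl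
    · simpa using hres
    · rw [hfk, hLk]
      simp [curveIntegral_apply]
    · intro t ht
      refine (hasDerivWithinAt_of_eq_curveIntegral hyE ht).congr_deriv ?_
      simp
    · intro t ht
      refine (hasDerivWithinAt_of_eq_curveIntegral hfk ht).congr_deriv ?_
      simp
  obtain ⟨A₀, hA₀⟩ := hp
  -- At `c = 0` the curve is constant. The displacement contributes `Y_a p` for `a ∉ S` and the flow
  -- contributes `Y_a p` for `a ∈ S`, so the derivative is the frame map at `p`.
  have hψ0 : HasFDerivAt ψ (A₀ : (ι → ℝ) →L[ℝ] E) 0 := by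
    refine hψ.self_of_nhds.congr_fderiv (ContinuousLinearMap.ext fun k => ?_)
    have hfk := fderiv_flow_family hZs hΦ.self_of_nhds.1 (hΦ.mono fun _ h => h.2) k
    have h1 : fderiv ℝ Φ 0 k 1 = L k + ∑ a, k a • Z a p := by
      rw [hfk]
      simp [curveIntegral_apply, hΦ0]
    change fderiv ℝ Φ 0 k 1 = A₀ k
    rw [h1, ← ContinuousLinearEquiv.coe_coe, hA₀, frameMap_apply, frameMap_apply,
      ← Finset.sum_add_distrib]
    refine Finset.sum_congr rfl fun a _ => ?_
    rw [(hZY.self_of_nhds a).eq_of_nhds]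
    split_ifs <;> simp
  obtain ⟨e, he, hef, hesrc, hes⟩ := exists_smooth_openPartialHomeomorph hψd A₀ hψ0
  have hψp : ψ 0 = p := by simp [ψ, hΦ0]
  have hpt : p ∈ e.target := by
    have := e.map_source he
    rwa [hef, hψp] at this
  have hep : e.symm p = 0 := by
    have := e.left_inv he
    rwa [hef, hψp] at this
  have htar : ∀ᶠ x in 𝓝 p, x ∈ e.target := e.open_target.mem_nhds hpt
  have hcoord : ∀ x ∈ e.target, HasFDerivAt (fun x => e.symm x b)
      ((ContinuousLinearMap.proj b) ∘L fderiv ℝ e.symm x) x := fun x hx =>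
    (ContinuousLinearMap.proj (R := ℝ) (φ := fun _ : ι => ℝ) b).hasFDerivAt.comp x
      ((hes x hx).differentiableAt (by simp)).hasFDerivAt
  have hinvd : ∀ x ∈ e.target, ∀ k, fderiv ℝ e.symm x (fderiv ℝ ψ (e.symm x) k) = k := by
    intro x hx k
    obtain ⟨h1, A, hA⟩ := hesrc _ (e.map_target hx)
    have h2 := e.hasFDerivAt_symm hx (f' := A) (by rw [hef]; exact hA)
    rw [h2.fderiv, hA.fderiv]
    exact A.symm_apply_apply k
  -- The first integral is the `b`-th parameter, read off by the inverse of `ψ`.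
  refine ⟨fun x => e.symm x b, ?_, ?_, ?_⟩
  · filter_upwards [htar] with x hx
    exact (ContinuousLinearMap.proj (R := ℝ) (φ := fun _ : ι => ℝ) b).contDiff.contDiffAt.comp x
      (hes x hx)
  · have hesc : Filter.Tendsto e.symm (𝓝 p) (𝓝 0) := by
      have := (hes p hpt).continuousAt
      rwa [ContinuousAt, hep] at this
    filter_upwards [htar, hesc.eventually hspan, hesc.eventually hψ, hinv] with x hx hsp hψx hinvx
      a ha
    have hψx' : ψ (e.symm x) = x := by
      have := e.right_inv hx
      rwa [hef] at this
    rw [hψx'] at hsp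
    -- the subspace of parameters supported on `S`
    let P : Submodule ℝ (ι → ℝ) :=
      { carrier := {k | ∀ l ∉ S, k l = 0}
        add_mem' := fun {k k'} hk hk' l hl => by simp [hk l hl, hk' l hl]
        zero_mem' := fun _ _ => rfl
        smul_mem' := fun c k hk l hl => by simp [hk l hl] }
    let T : (ι → ℝ) →ₗ[ℝ] (ι → ℝ) :=
      ((frameMap (Y · x)).inverse ∘L fderiv ℝ ψ (e.symm x) : (ι → ℝ) →L[ℝ] (ι → ℝ))
    have hTP : ∀ k ∈ P, T k ∈ P := by
      intro k hk l hl
      have := hsp k hk l hl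
      change (frameMap (Y · x)).inverse (fderiv ℝ ψ (e.symm x) k) l = 0
      rw [hψx.fderiv]
      exact this
    have hTinj : Function.Injective (T.restrict hTP) := by
      intro k k' h
      have h1 : T k = T k' := congrArg Subtype.val h
      have h2 := congrArg (frameMap (Y · x)) h1
      have h3 : ∀ k, frameMap (Y · x) (T k) = fderiv ℝ ψ (e.symm x) k := fun k =>
        frameMap_inverse_apply hinvx _
      rw [h3, h3] at h2
      have h4 := congrArg (fderiv ℝ e.symm x) h2
      rw [hinvd x hx, hinvd x hx] at h4
      exact Subtype.ext h4
    -- An injective endomorphism of the finite-dimensional space `P` is onto. So `Y a x` is the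
    -- derivative of `ψ` along a parameter vector supported on `S`, and the inverse of `ψ` sends it
    -- to a vector with zero `b`-th entry.
    obtain ⟨⟨k, hk⟩, hka⟩ := (LinearMap.injective_iff_surjective.1 hTinj)
      ⟨Pi.single a 1, fun l hl => Pi.single_eq_of_ne (by rintro rfl; exact hl ha) _⟩
    have hka' : (frameMap (Y · x)).inverse (fderiv ℝ ψ (e.symm x) k) = Pi.single a 1 :=
      congrArg Subtype.val hka
    have hYk : Y a x = fderiv ℝ ψ (e.symm x) k := by
      rw [← frameMap_inverse_apply hinvx (fderiv ℝ ψ (e.symm x) k), hka', frameMap_single]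
    rw [(hcoord x hx).fderiv, hYk]
    change fderiv ℝ e.symm x (fderiv ℝ ψ (e.symm x) k) b = 0
    rw [hinvd x hx]
    exact hk b hb
  · have h1 : Y b p = fderiv ℝ ψ (e.symm p) (Pi.single b 1) := by
      rw [hep, hψ0.fderiv, hA₀, frameMap_single]
    rw [(hcoord p hpt).fderiv, h1]
    change fderiv ℝ e.symm p (fderiv ℝ ψ (e.symm p) (Pi.single b 1)) b = 1
    rw [hinvd p hpt, Pi.single_eq_same]

end Frobenius

/-! ### Coordinate expressions of functions, vector fields and forms -/

theorem inverse_apply_of_eq {G G' : Type*} [TopologicalSpace G] [AddCommGroup G] [Module ℝ G]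
    [TopologicalSpace G'] [AddCommGroup G'] [Module ℝ G'] {A : G →L[ℝ] G'} (hA : A.IsInvertible)
    {v : G} {w : G'} (h : A v = w) : A.inverse w = v := by
  obtain ⟨B, rfl⟩ := hA
  rw [ContinuousLinearMap.inverse_equiv]
  exact B.symm_apply_eq.2 h.symm

theorem apply_inverse {G G' : Type*} [TopologicalSpace G] [AddCommGroup G] [Module ℝ G]
    [TopologicalSpace G'] [AddCommGroup G'] [Module ℝ G'] {A : G →L[ℝ] G'} (hA : A.IsInvertible)
    (w : G') : A (A.inverse w) = w := by
  obtain ⟨B, rfl⟩ := hA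
  rw [ContinuousLinearMap.inverse_equiv]
  exact B.apply_symm_apply w

section Charts

variable {E : Type*} [NormedAddCommGroup E] [NormedSpace ℝ E]
  {M : Type*} [TopologicalSpace M] [ChartedSpace E M]

/-- Coordinate expression of a vector field in the preferred chart at `x₀`. -/
def vfInChart (X : VField E M) (x₀ : M) (y : E) : E :=
  VectorField.mpullback 𝓘(ℝ, E) 𝓘(ℝ, E) (extChartAt 𝓘(ℝ, E) x₀).symm X y

/-- Coordinate expression of a function in the preferred chart at `x₀`. -/
def funInChart (f : M → ℝ) (x₀ : M) (y : E) : ℝ := f ((extChartAt 𝓘(ℝ, E) x₀).symm y)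

/-- Derivative of the inverse of the preferred chart at `x₀`. -/
def chartSymmDeriv (x₀ : M) (y : E) :
    E →L[ℝ] TangentSpace 𝓘(ℝ, E) ((extChartAt 𝓘(ℝ, E) x₀).symm y) :=
  mfderiv 𝓘(ℝ, E) 𝓘(ℝ, E) (extChartAt 𝓘(ℝ, E) x₀).symm y

theorem formInChart_apply {k : ℕ} (η : DForm E M k) (x₀ : M) (y : E) (v : Fin k → E) :
    formInChart η x₀ y v =
      η ((extChartAt 𝓘(ℝ, E) x₀).symm y) (fun i => chartSymmDeriv x₀ y (v i)) := rfl

variable [IsManifold 𝓘(ℝ, E) ∞ M] {x₀ : M} {y : E}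

theorem contMDiffAt_chart_symm (hy : y ∈ (extChartAt 𝓘(ℝ, E) x₀).target) :
    ContMDiffAt 𝓘(ℝ, E) 𝓘(ℝ, E) ∞ (extChartAt 𝓘(ℝ, E) x₀).symm y :=
  (contMDiffOn_extChartAt_symm x₀).contMDiffAt ((isOpen_extChartAt_target x₀).mem_nhds hy)

theorem contMDiffAt_chart {x : M} (hx : x ∈ (extChartAt 𝓘(ℝ, E) x₀).source) :
    ContMDiffAt 𝓘(ℝ, E) 𝓘(ℝ, E) ∞ (extChartAt 𝓘(ℝ, E) x₀) x :=
  contMDiffAt_extChartAt' (by rwa [← extChartAt_source 𝓘(ℝ, E)])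

theorem chartSymmDeriv_isInvertible (hy : y ∈ (extChartAt 𝓘(ℝ, E) x₀).target) :
    (chartSymmDeriv x₀ y).IsInvertible := by
  have : IsManifold 𝓘(ℝ, E) 1 M := .of_le (n := ∞) (by simp)
  have h := isInvertible_mfderivWithin_extChartAt_symm (I := 𝓘(ℝ, E)) hy
  simp only [modelWithCornersSelf_coe, Set.range_id, mfderivWithin_univ] at h
  exact h

theorem chartSymmDeriv_vfInChart (hy : y ∈ (extChartAt 𝓘(ℝ, E) x₀).target) (X : VField E M) :
    chartSymmDeriv x₀ y (vfInChart X x₀ y) = X ((extChartAt 𝓘(ℝ, E) x₀).symm y) := by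
  exact apply_inverse (chartSymmDeriv_isInvertible hy) _

theorem formInChart_vfInChart {k : ℕ} (η : DForm E M k) (X : Fin k → VField E M)
    (hy : y ∈ (extChartAt 𝓘(ℝ, E) x₀).target) :
    formInChart η x₀ y (fun i => vfInChart (X i) x₀ y) =
      funInChart (fun x => η x (fun i => X i x)) x₀ y := by
  rw [formInChart_apply]
  simp only [chartSymmDeriv_vfInChart hy]
  rfl

variable {V : Set M}

theorem eventually_mem_chart (hV : IsOpen V) (hy : y ∈ (extChartAt 𝓘(ℝ, E) x₀).target)
    (hyV : (extChartAt 𝓘(ℝ, E) x₀).symm y ∈ V) :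
    ∀ᶠ z in 𝓝 y, z ∈ (extChartAt 𝓘(ℝ, E) x₀).target ∧ (extChartAt 𝓘(ℝ, E) x₀).symm z ∈ V :=
  Filter.Eventually.and ((isOpen_extChartAt_target x₀).mem_nhds hy)
    ((continuousAt_extChartAt_symm'' hy).eventually (hV.mem_nhds hyV))

theorem SmoothFormOn.contDiffAt {k : ℕ} {η : DForm E M k} (h : SmoothFormOn V η) (hV : IsOpen V)
    (hy : y ∈ (extChartAt 𝓘(ℝ, E) x₀).target) (hyV : (extChartAt 𝓘(ℝ, E) x₀).symm y ∈ V) :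
    ContDiffAt ℝ ∞ (formInChart η x₀) y :=
  (h x₀).contDiffAt (eventually_mem_chart hV hy hyV)

theorem smoothFormOn_iff {k : ℕ} {η : DForm E M k} (hV : IsOpen V) :
    SmoothFormOn V η ↔ ∀ x₀ : M, ∀ y ∈ (extChartAt 𝓘(ℝ, E) x₀).target,
      (extChartAt 𝓘(ℝ, E) x₀).symm y ∈ V → ContDiffAt ℝ ∞ (formInChart η x₀) y :=
  ⟨fun h _ _ hy hyV => h.contDiffAt hV hy hyV,
    fun h x₀ y hy => (h x₀ y hy.1 hy.2).contDiffWithinAt⟩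

theorem contDiffAt_funInChart {f : M → ℝ} (hy : y ∈ (extChartAt 𝓘(ℝ, E) x₀).target)
    (hf : ContMDiffAt 𝓘(ℝ, E) 𝓘(ℝ, ℝ) ∞ f ((extChartAt 𝓘(ℝ, E) x₀).symm y)) :
    ContDiffAt ℝ ∞ (funInChart f x₀) y :=
  contMDiffAt_iff_contDiffAt.1 (hf.comp y (contMDiffAt_chart_symm hy))

theorem contMDiffAt_of_funInChart {f : M → ℝ} {x : M} (hx : x ∈ (extChartAt 𝓘(ℝ, E) x₀).source)
    (hf : ContDiffAt ℝ ∞ (funInChart f x₀) (extChartAt 𝓘(ℝ, E) x₀ x)) :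
    ContMDiffAt 𝓘(ℝ, E) 𝓘(ℝ, ℝ) ∞ f x := by
  have h := (contMDiffAt_iff_contDiffAt.2 hf).comp x (contMDiffAt_chart hx)
  refine h.congr_of_eventuallyEq ?_
  filter_upwards [(isOpen_extChartAt_source (I := 𝓘(ℝ, E)) x₀).mem_nhds hx] with z hz
  exact congrArg f ((extChartAt 𝓘(ℝ, E) x₀).left_inv hz).symm

theorem SmoothFunOn.contMDiffAt {f : M → ℝ} (h : SmoothFunOn (E := E) V f) (hV : IsOpen V) {x : M}
    (hx : x ∈ V) : ContMDiffAt 𝓘(ℝ, E) 𝓘(ℝ, ℝ) ∞ f x :=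
  ContMDiffOn.contMDiffAt h (hV.mem_nhds hx)

theorem dfun_chartSymmDeriv {f : M → ℝ} (hy : y ∈ (extChartAt 𝓘(ℝ, E) x₀).target)
    (hf : ContMDiffAt 𝓘(ℝ, E) 𝓘(ℝ, ℝ) ∞ f ((extChartAt 𝓘(ℝ, E) x₀).symm y)) (v : E) :
    dfun f ((extChartAt 𝓘(ℝ, E) x₀).symm y) (chartSymmDeriv x₀ y v)
      = fderiv ℝ (funInChart f x₀) y v := by
  have h := mfderiv_comp y (hf.mdifferentiableAt (by simp))
    ((contMDiffAt_chart_symm hy).mdifferentiableAt (by simp))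
  have h2 : mfderiv 𝓘(ℝ, E) 𝓘(ℝ, ℝ) (f ∘ (extChartAt 𝓘(ℝ, E) x₀).symm) y
      = fderiv ℝ (funInChart f x₀) y := mfderiv_eq_fderiv
  rw [← h2, h]
  rfl

theorem dfun_vfield {f : M → ℝ} (hy : y ∈ (extChartAt 𝓘(ℝ, E) x₀).target)
    (hf : ContMDiffAt 𝓘(ℝ, E) 𝓘(ℝ, ℝ) ∞ f ((extChartAt 𝓘(ℝ, E) x₀).symm y)) (X : VField E M) :
    dfun f ((extChartAt 𝓘(ℝ, E) x₀).symm y) (X ((extChartAt 𝓘(ℝ, E) x₀).symm y))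
      = fderiv ℝ (funInChart f x₀) y (vfInChart X x₀ y) := by
  rw [← dfun_chartSymmDeriv hy hf, chartSymmDeriv_vfInChart hy]

variable [CompleteSpace E]

theorem contDiffAt_vfInChart {X : VField E M} (hy : y ∈ (extChartAt 𝓘(ℝ, E) x₀).target)
    (hX : ContMDiffAt 𝓘(ℝ, E) (𝓘(ℝ, E).prod 𝓘(ℝ, E)) ∞
      (fun x => (⟨x, X x⟩ : TangentBundle 𝓘(ℝ, E) M)) ((extChartAt 𝓘(ℝ, E) x₀).symm y)) :
    ContDiffAt ℝ ∞ (vfInChart X x₀) y := by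
  have h : (mfderiv 𝓘(ℝ, E) 𝓘(ℝ, E) (extChartAt 𝓘(ℝ, E) x₀).symm y).IsInvertible :=
    chartSymmDeriv_isInvertible (E := E) hy
  have h2 := ContMDiffAt.mpullback_vectorField_preimage (I := 𝓘(ℝ, E)) (I' := 𝓘(ℝ, E)) (n := ∞)
    hX (contMDiffAt_chart_symm hy) h (by simp)
  exact contMDiffAt_vectorSpace_iff_contDiffAt.1 h2

theorem SmoothVFOn.contMDiffAt {X : VField E M} (h : SmoothVFOn V X) (hV : IsOpen V) {x : M}
    (hx : x ∈ V) : ContMDiffAt 𝓘(ℝ, E) (𝓘(ℝ, E).prod 𝓘(ℝ, E)) ∞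
      (fun x => (⟨x, X x⟩ : TangentBundle 𝓘(ℝ, E) M)) x :=
  ContMDiffOn.contMDiffAt h (hV.mem_nhds hx)

theorem SmoothVFOn.contDiffAt {X : VField E M} (h : SmoothVFOn V X) (hV : IsOpen V)
    (hy : y ∈ (extChartAt 𝓘(ℝ, E) x₀).target) (hyV : (extChartAt 𝓘(ℝ, E) x₀).symm y ∈ V) :
    ContDiffAt ℝ ∞ (vfInChart X x₀) y :=
  contDiffAt_vfInChart hy (h.contMDiffAt hV hyV)

theorem mpullback_chart_isInvertible {x : M} (hx : x ∈ (extChartAt 𝓘(ℝ, E) x₀).source) :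
    (mfderiv 𝓘(ℝ, E) 𝓘(ℝ, E) (extChartAt 𝓘(ℝ, E) x₀) x).IsInvertible := by
  have : IsManifold 𝓘(ℝ, E) 1 M := .of_le (n := ∞) (by simp)
  exact isInvertible_mfderiv_extChartAt hx

/-- A vector field with prescribed coordinate expression in the preferred chart at `x₀`. -/
def vfOfChart (x₀ : M) (Y : E → E) : VField E M :=
  VectorField.mpullback 𝓘(ℝ, E) 𝓘(ℝ, E) (extChartAt 𝓘(ℝ, E) x₀)
    (fun y => (Y y : TangentSpace 𝓘(ℝ, E) y))

theorem contMDiffAt_vfOfChart {Y : E → E} {x : M} (hx : x ∈ (extChartAt 𝓘(ℝ, E) x₀).source)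
    (hY : ContDiffAt ℝ ∞ Y (extChartAt 𝓘(ℝ, E) x₀ x)) :
    ContMDiffAt 𝓘(ℝ, E) (𝓘(ℝ, E).prod 𝓘(ℝ, E)) ∞
      (fun x => (⟨x, vfOfChart x₀ Y x⟩ : TangentBundle 𝓘(ℝ, E) M)) x :=
  ContMDiffAt.mpullback_vectorField_preimage (n := ∞)
    (contMDiffAt_vectorSpace_iff_contDiffAt.2 hY) (contMDiffAt_chart hx)
    (mpullback_chart_isInvertible hx) (by simp)

theorem mfderiv_chart_chartSymmDeriv (hy : y ∈ (extChartAt 𝓘(ℝ, E) x₀).target) (v : E) :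
    mfderiv 𝓘(ℝ, E) 𝓘(ℝ, E) (extChartAt 𝓘(ℝ, E) x₀) ((extChartAt 𝓘(ℝ, E) x₀).symm y)
      (chartSymmDeriv x₀ y v) = v := by
  have : IsManifold 𝓘(ℝ, E) 1 M := .of_le (n := ∞) (by simp)
  have h := mfderiv_extChartAt_comp_mfderivWithin_extChartAt_symm (I := 𝓘(ℝ, E)) hy
  simp only [modelWithCornersSelf_coe, Set.range_id, mfderivWithin_univ] at h
  exact congrArg (fun A => A v) h

theorem chartSymmDeriv_eq_vfOfChart (hy : y ∈ (extChartAt 𝓘(ℝ, E) x₀).target) (Y : E → E) :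
    vfOfChart x₀ Y ((extChartAt 𝓘(ℝ, E) x₀).symm y) = chartSymmDeriv x₀ y (Y y) := by
  have hx := (extChartAt 𝓘(ℝ, E) x₀).map_target hy
  have h := inverse_apply_of_eq (mpullback_chart_isInvertible hx)
    (mfderiv_chart_chartSymmDeriv hy (Y y))
  have h2 := (extChartAt 𝓘(ℝ, E) x₀).right_inv hy
  refine Eq.trans ?_ h
  exact congrArg (fun z => (mfderiv 𝓘(ℝ, E) 𝓘(ℝ, E) (extChartAt 𝓘(ℝ, E) x₀)
    ((extChartAt 𝓘(ℝ, E) x₀).symm y)).inverse (Y z)) h2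

theorem vfOfChart_vfInChart (X : VField E M) {x : M}
    (hx : x ∈ (extChartAt 𝓘(ℝ, E) x₀).source) : vfOfChart x₀ (vfInChart X x₀) x = X x := by
  have hy := (extChartAt 𝓘(ℝ, E) x₀).map_source hx
  have h := (chartSymmDeriv_eq_vfOfChart hy (vfInChart X x₀)).trans (chartSymmDeriv_vfInChart hy X)
  rwa [(extChartAt 𝓘(ℝ, E) x₀).left_inv hx] at h

theorem contMDiffAt_of_vfInChart {X : VField E M} {x : M}
    (hx : x ∈ (extChartAt 𝓘(ℝ, E) x₀).source)
    (hX : ContDiffAt ℝ ∞ (vfInChart X x₀) (extChartAt 𝓘(ℝ, E) x₀ x)) :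
    ContMDiffAt 𝓘(ℝ, E) (𝓘(ℝ, E).prod 𝓘(ℝ, E)) ∞
      (fun x => (⟨x, X x⟩ : TangentBundle 𝓘(ℝ, E) M)) x := by
  refine (contMDiffAt_vfOfChart hx hX).congr_of_eventuallyEq ?_
  filter_upwards [(isOpen_extChartAt_source (I := 𝓘(ℝ, E)) x₀).mem_nhds hx] with z hz
  rw [vfOfChart_vfInChart X hz]

/-- Naturality of the Lie bracket under pullback by the inverse chart. It lets bracket identities
and the Frobenius theorem pass between `M` and the model space. -/
theorem vfInChart_mlieBracket {X Y : VField E M} (hy : y ∈ (extChartAt 𝓘(ℝ, E) x₀).target)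
    (hX : ContMDiffAt 𝓘(ℝ, E) (𝓘(ℝ, E).prod 𝓘(ℝ, E)) ∞
      (fun x => (⟨x, X x⟩ : TangentBundle 𝓘(ℝ, E) M)) ((extChartAt 𝓘(ℝ, E) x₀).symm y))
    (hY : ContMDiffAt 𝓘(ℝ, E) (𝓘(ℝ, E).prod 𝓘(ℝ, E)) ∞
      (fun x => (⟨x, Y x⟩ : TangentBundle 𝓘(ℝ, E) M)) ((extChartAt 𝓘(ℝ, E) x₀).symm y)) :
    vfInChart (VectorField.mlieBracket 𝓘(ℝ, E) X Y) x₀ y =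
      VectorField.lieBracket ℝ (vfInChart X x₀) (vfInChart Y x₀) y := by
  have : IsManifold 𝓘(ℝ, E) (minSmoothness ℝ 3) M := .of_le (n := ∞) (by
    rw [minSmoothness_of_isRCLikeNormedField]; exact ENat.LEInfty.out)
  have h := VectorField.mpullback_mlieBracket (x₀ := y) (hX.mdifferentiableAt (by simp))
    (hY.mdifferentiableAt (by simp)) (contMDiffAt_chart_symm hy) (by
      rw [minSmoothness_of_isRCLikeNormedField]; exact ENat.LEInfty.out)
  refine h.trans ?_
  have h2 := VectorField.mlieBracketWithin_eq_lieBracketWithin (𝕜 := ℝ) (E := E) (s := Set.univ)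
    (V := vfInChart X x₀) (W := vfInChart Y x₀)
  rw [VectorField.lieBracketWithin_univ] at h2
  exact congrFun h2 y

end Charts

/-! ### Evaluation of forms on vector fields -/

section FormCalculus

variable {E : Type*} [NormedAddCommGroup E] [NormedSpace ℝ E]
  {G : Type*} [NormedAddCommGroup G] [NormedSpace ℝ G]

/-- Evaluation is analytic jointly in the form and its arguments, being continuous and multilinear.
-/
theorem contDiffAt_form_apply {k : ℕ} {β : G → E [⋀^Fin k]→L[ℝ] ℝ} {v : Fin k → G → E} {x : G}
    {n : WithTop ℕ∞} (hβ : ContDiffAt ℝ n β x) (hv : ∀ i, ContDiffAt ℝ n (v i) x) :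
    ContDiffAt ℝ n (fun x => β x (fun i => v i x)) x := by
  let T : (E [⋀^Fin k]→L[ℝ] ℝ) →L[ℝ] ContinuousMultilinearMap ℝ (fun _ : Fin k => E) ℝ :=
    ContinuousAlternatingMap.toContinuousMultilinearMapCLM ℝ
  have h1 : ContDiffAt ℝ n (fun x => (β x, fun i => v i x)) x := hβ.prodMk (contDiffAt_pi.2 hv)
  exact (T.analyticAt_uncurry_of_multilinear (x := (β x, fun i => v i x))).contDiffAt.comp x h1

/-- An alternating form is determined by its values on tuples of basis vectors. This linear map to a
finite-dimensional space is injective, and a linear left inverse recovers the form from finitely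
many smooth functions. -/
theorem contDiffAt_form_of_apply [FiniteDimensional ℝ E] {k : ℕ} {β : G → E [⋀^Fin k]→L[ℝ] ℝ}
    {x : G} {n : WithTop ℕ∞} (h : ∀ v : Fin k → E, ContDiffAt ℝ n (fun x => β x v) x) :
    ContDiffAt ℝ n β x := by
  let b := Module.finBasis ℝ E
  let T : (E [⋀^Fin k]→L[ℝ] ℝ) →ₗ[ℝ] ((Fin k → Fin (Module.finrank ℝ E)) → ℝ) :=
    { toFun := fun f s => f fun i => b (s i)
      map_add' := fun _ _ => rfl
      map_smul' := fun _ _ => rfl }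
  have hT : LinearMap.ker T = ⊥ := by
    refine LinearMap.ker_eq_bot.2 fun f g hfg => ?_
    refine ContinuousAlternatingMap.toAlternatingMap_injective ?_
    refine Module.Basis.ext_alternating b fun s _ => ?_
    exact congrFun hfg s
  obtain ⟨L, hL⟩ := T.exists_leftInverse_of_injective hT
  have h1 : ContDiffAt ℝ n (fun x => T (β x)) x := contDiffAt_pi.2 fun s => h _
  have h2 : ContDiffAt ℝ n (fun x => (LinearMap.toContinuousLinearMap L) (T (β x))) x :=
    (LinearMap.toContinuousLinearMap L).contDiff.contDiffAt.comp x h1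
  refine h2.congr_of_eventuallyEq (.of_forall fun x => ?_)
  exact (congrArg (fun A : (E [⋀^Fin k]→L[ℝ] ℝ) →ₗ[ℝ] _ => A (β x)) hL).symm

open VectorField in
theorem extDeriv_one_apply {η : E → E [⋀^Fin 1]→L[ℝ] ℝ} {X Y : E → E} {x : E}
    (hη : DifferentiableAt ℝ η x) (hX : DifferentiableAt ℝ X x) (hY : DifferentiableAt ℝ Y x) :
    extDeriv η x ![X x, Y x] = fderiv ℝ (fun x => η x ![Y x]) x (X x)
      - fderiv ℝ (fun x => η x ![X x]) x (Y x) - η x ![lieBracket ℝ X Y x] := by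
  have h := extDeriv_apply_vectorField (V := ![X, Y]) hη
    (by intro i; fin_cases i <;> simpa)
  have h0 : (fun i => (![X, Y] : Fin 2 → E → E) i x) = ![X x, Y x] := by
    ext i; fin_cases i <;> rfl
  have h1 : ∀ z, (0 : Fin 2).removeNth (fun i => (![X, Y] : Fin 2 → E → E) i z) = ![Y z] := by
    intro z; ext i; fin_cases i; rfl
  have h2 : ∀ z, (1 : Fin 2).removeNth (fun i => (![X, Y] : Fin 2 → E → E) i z) = ![X z] := by
    intro z; ext i; fin_cases i; rfl
  rw [h0] at h
  rw [h, Fin.sum_univ_two]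
  simp only [h1, h2]
  have h3 : ∀ v : E, ∀ u : Fin 0 → E, Matrix.vecCons v u = ![v] := fun v u => by
    ext i; fin_cases i; rfl
  simp [h3]
  ring

/-- The derivative of the evaluation of a two-form on a vector field and a constant vector. -/
theorem fderiv_two_form_apply {β : E → E [⋀^Fin 2]→L[ℝ] ℝ} {X Y : E → E} {x : E}
    (hβ : DifferentiableAt ℝ β x) (hX : DifferentiableAt ℝ X x) (hY : DifferentiableAt ℝ Y x)
    (u : E) : fderiv ℝ (fun x => β x ![X x, Y x]) x u =
      fderiv ℝ β x u ![X x, Y x] + β x ![fderiv ℝ X x u, Y x] + β x ![X x, fderiv ℝ Y x u] := by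
  have h := fderiv_continuousAlternatingMap_apply_apply (f := β) (g := ![X, Y]) hβ
    (by intro i; fin_cases i <;> simpa) u
  have h0 : ∀ z, (fun i => (![X, Y] : Fin 2 → E → E) i z) = ![X z, Y z] := by
    intro z; ext i; fin_cases i <;> rfl
  have h1 : ∀ a b c : E, Function.update ![a, b] 0 c = ![c, b] := by
    intro a b c; ext i; fin_cases i <;> rfl
  have h2 : ∀ a b c : E, Function.update ![a, b] 1 c = ![a, c] := by
    intro a b c; ext i; fin_cases i <;> rfl
  simp only [h0] at h
  rw [h]
  simp [Fin.sum_univ_two, h1, h2, add_assoc]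

open VectorField in
/-- In coordinates: if `X ⌟ β = df - f θ` and `Y ⌟ β = dg - g θ`, where `dβ = θ ∧ β` and `dθ = 0`,
then `[X, Y] ⌟ β = dh - h θ` with `h = β(Y, X)`. -/
theorem lieBracket_contact {β : E → E [⋀^Fin 2]→L[ℝ] ℝ} {θ : E → E [⋀^Fin 1]→L[ℝ] ℝ}
    {f g : E → ℝ} {X Y : E → E} {x : E}
    (hβ : DifferentiableAt ℝ β x) (hθ : DifferentiableAt ℝ θ x)
    (hf : ContDiffAt ℝ 2 f x) (hg : ContDiffAt ℝ 2 g x)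
    (hX : DifferentiableAt ℝ X x) (hY : DifferentiableAt ℝ Y x)
    (hdθ : extDeriv θ x = 0)
    (hdβ : ∀ u v w, extDeriv β x ![u, v, w] =
      θ x ![u] * β x ![v, w] - θ x ![v] * β x ![u, w] + θ x ![w] * β x ![u, v])
    (hXf : ∀ᶠ z in 𝓝 x, ∀ w, β z ![X z, w] = fderiv ℝ f z w - f z * θ z ![w])
    (hYg : ∀ᶠ z in 𝓝 x, ∀ w, β z ![Y z, w] = fderiv ℝ g z w - g z * θ z ![w]) (w : E) :
    β x ![lieBracket ℝ X Y x, w] = fderiv ℝ (fun z => β z ![Y z, X z]) x w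
      - β x ![Y x, X x] * θ x ![w] := by
  have swap : ∀ (α : E [⋀^Fin 2]→L[ℝ] ℝ) (u v : E), α ![u, v] = - α ![v, u] := by
    intro α u v
    have h : α (![v, u] ∘ Equiv.swap 0 1) = - α ![v, u] :=
      α.map_swap ![v, u] (i := 0) (j := 1) (by simp)
    rw [← h]
    congr 1
    ext i; fin_cases i <;> rfl
  -- Differentiate `X ⌟ β = df - f θ`, evaluated on a constant vector `w`, in the direction `u`.
  have hdf : ∀ {f : E → ℝ} {X : E → E}, ContDiffAt ℝ 2 f x → DifferentiableAt ℝ X x →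
      (∀ᶠ z in 𝓝 x, ∀ w, β z ![X z, w] = fderiv ℝ f z w - f z * θ z ![w]) → ∀ u w,
      fderiv ℝ β x u ![X x, w] + β x ![fderiv ℝ X x u, w] = fderiv ℝ (fderiv ℝ f) x u w
        - (fderiv ℝ f x u * θ x ![w] + f x * fderiv ℝ θ x u ![w]) := by
    intro f X hf hX hXf u w
    have h1 : (fun z => β z ![X z, (fun _ => w) z]) =ᶠ[𝓝 x]
        fun z => fderiv ℝ f z w - f z * θ z ![w] := hXf.mono fun z hz => hz w
    have h2 := fderiv_two_form_apply hβ hX (differentiableAt_const w) u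
    rw [h1.fderiv_eq] at h2
    have hd1 : HasFDerivAt (fun z => fderiv ℝ f z w)
        ((ContinuousLinearMap.apply ℝ ℝ w) ∘L fderiv ℝ (fderiv ℝ f) x) x :=
      (ContinuousLinearMap.apply ℝ ℝ w).hasFDerivAt.comp x
        (((hf.fderiv_right (m := 1) (by norm_num)).differentiableAt one_ne_zero).hasFDerivAt)
    have hd2 : HasFDerivAt (fun z => θ z ![w])
        ((ContinuousAlternatingMap.apply ℝ E ℝ ![w]) ∘L fderiv ℝ θ x) x :=
      (ContinuousAlternatingMap.apply ℝ E ℝ ![w]).hasFDerivAt.comp x hθ.hasFDerivAt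
    have hd3 : HasFDerivAt f (fderiv ℝ f x) x := (hf.differentiableAt (by simp)).hasFDerivAt
    have hd := (hd1.sub (hd3.mul hd2)).fderiv
    have h3 : fderiv ℝ (fun z => fderiv ℝ f z w - f z * θ z ![w]) x u =
        fderiv ℝ (fderiv ℝ f) x u w
        - (fderiv ℝ f x u * θ x ![w] + f x * fderiv ℝ θ x u ![w]) := by
      refine (congrArg (fun A => A u) hd).trans ?_
      simp only [sub_apply, add_apply, smul_apply, smul_eq_mul, ContinuousLinearMap.comp_apply,
        ContinuousLinearMap.apply_apply, ContinuousAlternatingMap.apply_apply]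
      ring
    rw [← h3, h2]
    have h0 : β x ![X x, fderiv ℝ (fun _ : E => w) x u] = 0 := by
      refine (β x).map_coord_zero 1 ?_
      simp
    rw [h0, add_zero]
  have hsymm : ∀ {f : E → ℝ}, ContDiffAt ℝ 2 f x → ∀ u v,
      fderiv ℝ (fderiv ℝ f) x u v = fderiv ℝ (fderiv ℝ f) x v u := fun hf u v =>
    (hf.isSymmSndFDerivAt (by simp)).eq u v
  -- On constant fields the bracket is zero, so `dθ = 0` says that the derivative of `θ` is
  -- symmetric.
  have hθs : ∀ u v, fderiv ℝ θ x u ![v] = fderiv ℝ θ x v ![u] := by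
    intro u v
    have h := extDeriv_one_apply hθ (differentiableAt_const u) (differentiableAt_const v)
    have hd2 : ∀ w : E, HasFDerivAt (fun z => θ z ![w])
        ((ContinuousAlternatingMap.apply ℝ E ℝ ![w]) ∘L fderiv ℝ θ x) x := fun w =>
      (ContinuousAlternatingMap.apply ℝ E ℝ ![w]).hasFDerivAt.comp x hθ.hasFDerivAt
    have h0 : θ x ![lieBracket ℝ (fun _ => u) (fun _ => v) x] = 0 := by
      refine (θ x).map_coord_zero 0 ?_
      simp [lieBracket]
    rw [hdθ, h0, (hd2 u).fderiv, (hd2 v).fderiv] at h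
    simp only [ContinuousLinearMap.comp_apply, ContinuousAlternatingMap.apply_apply,
      sub_zero] at h
    exact sub_eq_zero.1 h.symm
  have hdβ' : ∀ u v w, extDeriv β x ![u, v, w] =
      fderiv ℝ β x u ![v, w] - fderiv ℝ β x v ![u, w] + fderiv ℝ β x w ![u, v] := by
    intro u v w
    rw [extDeriv_apply hβ, Fin.sum_univ_three]
    have h0 : (0 : Fin 3).removeNth ![u, v, w] = ![v, w] := by
      ext i; fin_cases i <;> rfl
    have h1 : (1 : Fin 3).removeNth ![u, v, w] = ![u, w] := by
      ext i; fin_cases i <;> rfl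
    have h2 : (2 : Fin 3).removeNth ![u, v, w] = ![u, v] := by
      ext i; fin_cases i <;> rfl
    have hd : ∀ a u v : E, fderiv ℝ (fun z => β z ![u, v]) x a = fderiv ℝ β x a ![u, v] :=
      fun a u v => congrArg (fun A => A a)
        ((ContinuousAlternatingMap.apply ℝ E ℝ ![u, v]).hasFDerivAt.comp x hβ.hasFDerivAt).fderiv
    simp only [h0, h1, h2]
    simp [hd]
    ring
  have hX0 := hXf.self_of_nhds
  have hY0 := hYg.self_of_nhds
  have hbr : β x ![lieBracket ℝ X Y x, w] =
      β x ![fderiv ℝ Y x (X x), w] - β x ![fderiv ℝ X x (Y x), w] := by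
    have h := (β x).map_update_sub ![0, w] 0 (fderiv ℝ Y x (X x)) (fderiv ℝ X x (Y x))
    have h1 : ∀ a b c : E, Function.update ![a, b] 0 c = ![c, b] := by
      intro a b c; ext i; fin_cases i <;> rfl
    simp only [h1] at h
    exact h
  rw [hbr, fderiv_two_form_apply hβ hY hX]
  -- The differentiated identities are taken with both orders of the arguments. Hessians cancel by
  -- symmetry, the derivatives of `β` assemble into `dβ(X, Y, w)` and are traded for `θ ∧ β` by
  -- `e5`, and the defining identities of `X` and `Y` absorb the remaining `θ`-terms.
  have e1 := hdf hf hX hXf (Y x) w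
  have e2 := hdf hg hY hYg (X x) w
  have e3 := hdf hf hX hXf w (Y x)
  have e4 := hdf hg hY hYg w (X x)
  have e5 := (hdβ (X x) (Y x) w).symm.trans (hdβ' (X x) (Y x) w)
  have s1 := swap (β x) (Y x) (fderiv ℝ X x w)
  have f1 := hX0 w
  have f2 := hY0 w
  have f3 := hX0 (Y x)
  have f4 := hY0 (X x)
  have g1 := hsymm hf (Y x) w
  have g2 := hsymm hg (X x) w
  have g3 := hθs (Y x) w
  have g4 := hθs (X x) w
  rw [g1, g3] at e1
  rw [g2, g4] at e2
  rw [f1, f2] at e5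
  linear_combination e2 - e1 - e4 + e3 + e5 - s1 + (θ x ![w]) * f4 - (θ x ![w]) * f3

end FormCalculus

theorem contDiffAt_clm_of_apply {E F G : Type*} [NormedAddCommGroup E] [NormedSpace ℝ E]
    [FiniteDimensional ℝ E] [NormedAddCommGroup F] [NormedSpace ℝ F] [NormedAddCommGroup G]
    [NormedSpace ℝ G] {A : G → E →L[ℝ] F} {x : G} {n : WithTop ℕ∞}
    (h : ∀ v, ContDiffAt ℝ n (fun x => A x v) x) : ContDiffAt ℝ n A x := by
  let b := Module.finBasis ℝ E
  have h1 : A = fun x => ∑ i, ContinuousLinearMap.smulRightL ℝ E F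
      (LinearMap.toContinuousLinearMap (b.coord i)) (A x (b i)) := by
    ext x v
    calc A x v = A x (∑ i, b.repr v i • b i) := by rw [b.sum_repr]
      _ = ∑ i, b.repr v i • A x (b i) := by simp only [map_sum, map_smul]
      _ = _ := by simp
  rw [h1]
  exact ContDiffAt.sum fun i _ => (ContinuousLinearMap.contDiff _).contDiffAt.comp x (h _)

/-! ### Pointwise smoothness and Cartan's formula on the manifold -/

section Manifold

variable {E : Type*} [NormedAddCommGroup E] [NormedSpace ℝ E]
  {M : Type*} [TopologicalSpace M] [ChartedSpace E M] [IsManifold 𝓘(ℝ, E) ∞ M] [CompleteSpace E]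

/-- The vector field `X` is smooth at the point `x`. -/
def SmoothVFAt (X : VField E M) (x : M) : Prop :=
  ContMDiffAt 𝓘(ℝ, E) (𝓘(ℝ, E).prod 𝓘(ℝ, E)) ∞
      (fun x => (⟨x, X x⟩ : TangentBundle 𝓘(ℝ, E) M)) x

/-- The real function `f` is smooth at the point `x`. -/
def SmoothFunAt (f : M → ℝ) (x : M) : Prop := ContMDiffAt 𝓘(ℝ, E) 𝓘(ℝ, ℝ) ∞ f x

theorem smoothFunOn_iff {V : Set M} (hV : IsOpen V) {f : M → ℝ} :
    SmoothFunOn (E := E) V f ↔ ∀ x ∈ V, SmoothFunAt (E := E) f x :=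
  ⟨fun h _ hx => h.contMDiffAt hV hx, fun h x hx => (h x hx).contMDiffWithinAt⟩

theorem smoothVFOn_iff {V : Set M} (hV : IsOpen V) {X : VField E M} :
    SmoothVFOn V X ↔ ∀ x ∈ V, SmoothVFAt X x :=
  ⟨fun h _ hx => h.contMDiffAt hV hx, fun h x hx => ContMDiffAt.contMDiffWithinAt (h x hx)⟩

theorem smoothFunAt_iff {f : M → ℝ} {x₀ x : M} (hx : x ∈ (extChartAt 𝓘(ℝ, E) x₀).source) :
    SmoothFunAt (E := E) f x ↔
      ContDiffAt ℝ ∞ (funInChart f x₀) (extChartAt 𝓘(ℝ, E) x₀ x) := by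
  refine ⟨fun h => contDiffAt_funInChart ((extChartAt 𝓘(ℝ, E) x₀).map_source hx) ?_,
    fun h => contMDiffAt_of_funInChart hx h⟩
  rwa [(extChartAt 𝓘(ℝ, E) x₀).left_inv hx]

theorem smoothVFAt_iff {X : VField E M} {x₀ x : M}
    (hx : x ∈ (extChartAt 𝓘(ℝ, E) x₀).source) :
    SmoothVFAt X x ↔ ContDiffAt ℝ ∞ (vfInChart X x₀) (extChartAt 𝓘(ℝ, E) x₀ x) := by
  refine ⟨fun h => contDiffAt_vfInChart ((extChartAt 𝓘(ℝ, E) x₀).map_source hx) ?_,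
    fun h => contMDiffAt_of_vfInChart hx h⟩
  rwa [(extChartAt 𝓘(ℝ, E) x₀).left_inv hx]

theorem eventually_chart_symm {P : M → Prop} {x₀ x : M}
    (hx : x ∈ (extChartAt 𝓘(ℝ, E) x₀).source) (h : ∀ᶠ z in 𝓝 x, P z) :
    ∀ᶠ y in 𝓝 (extChartAt 𝓘(ℝ, E) x₀ x), P ((extChartAt 𝓘(ℝ, E) x₀).symm y) := by
  have h1 := continuousAt_extChartAt_symm' (I := 𝓘(ℝ, E)) hx
  rw [ContinuousAt, (extChartAt 𝓘(ℝ, E) x₀).left_inv hx] at h1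
  exact h1.eventually h

theorem eventually_target {x₀ x : M} (hx : x ∈ (extChartAt 𝓘(ℝ, E) x₀).source) :
    ∀ᶠ y in 𝓝 (extChartAt 𝓘(ℝ, E) x₀ x), y ∈ (extChartAt 𝓘(ℝ, E) x₀).target :=
  (isOpen_extChartAt_target x₀).mem_nhds ((extChartAt 𝓘(ℝ, E) x₀).map_source hx)

theorem eventually_of_chart {P : E → Prop} {x₀ x : M}
    (hx : x ∈ (extChartAt 𝓘(ℝ, E) x₀).source)
    (h : ∀ᶠ y in 𝓝 (extChartAt 𝓘(ℝ, E) x₀ x), P y) :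
    ∀ᶠ z in 𝓝 x, z ∈ (extChartAt 𝓘(ℝ, E) x₀).source ∧ P (extChartAt 𝓘(ℝ, E) x₀ z) :=
  Filter.Eventually.and ((isOpen_extChartAt_source x₀).mem_nhds hx)
    ((continuousAt_extChartAt' hx).eventually h)

section

variable {x₀ x : M} (hx : x ∈ (extChartAt 𝓘(ℝ, E) x₀).source)
include hx

theorem form_vfield_eq {k : ℕ} (η : DForm E M k) (X : Fin k → VField E M) :
    η x (fun i => X i x) = formInChart η x₀ (extChartAt 𝓘(ℝ, E) x₀ x)
      (fun i => vfInChart (X i) x₀ (extChartAt 𝓘(ℝ, E) x₀ x)) := by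
  rw [formInChart_vfInChart η X ((extChartAt 𝓘(ℝ, E) x₀).map_source hx)]
  exact (congrArg (fun z => η z fun i => X i z) ((extChartAt 𝓘(ℝ, E) x₀).left_inv hx)).symm

theorem dfun_vfield_eq {f : M → ℝ} (hf : SmoothFunAt (E := E) f x) (X : VField E M) :
    dfun f x (X x) = fderiv ℝ (funInChart f x₀) (extChartAt 𝓘(ℝ, E) x₀ x)
      (vfInChart X x₀ (extChartAt 𝓘(ℝ, E) x₀ x)) := by
  have hl := (extChartAt 𝓘(ℝ, E) x₀).left_inv hx
  have h := dfun_vfield (f := f) ((extChartAt 𝓘(ℝ, E) x₀).map_source hx) (by rwa [hl]) X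
  rwa [hl] at h

theorem mfderiv_chart_vfield (X : VField E M) :
    mfderiv 𝓘(ℝ, E) 𝓘(ℝ, E) (extChartAt 𝓘(ℝ, E) x₀) x (X x)
      = vfInChart X x₀ (extChartAt 𝓘(ℝ, E) x₀ x) := by
  have hy := (extChartAt 𝓘(ℝ, E) x₀).map_source hx
  have h := mfderiv_chart_chartSymmDeriv hy (vfInChart X x₀ (extChartAt 𝓘(ℝ, E) x₀ x))
  rw [chartSymmDeriv_vfInChart hy, (extChartAt 𝓘(ℝ, E) x₀).left_inv hx] at h
  exact h

end

/-- Only the preferred chart at `x` itself appears, since that chart defines `dForm` at `x`.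
Independence of the chart is never needed. -/
theorem dForm_vfield_eq {k : ℕ} (η : DForm E M k) (X : Fin (k + 1) → VField E M) (x : M) :
    dForm η x (fun i => X i x) = extDeriv (formInChart η x) (extChartAt 𝓘(ℝ, E) x x)
      (fun i => vfInChart (X i) x (extChartAt 𝓘(ℝ, E) x x)) := by
  refine congrArg (extDeriv (formInChart η x) (extChartAt 𝓘(ℝ, E) x x)) ?_
  funext i
  exact mfderiv_chart_vfield (mem_extChartAt_source x) (X i)

theorem vfInChart_vfOfChart {x₀ : M} {y : E}
    (hy : y ∈ (extChartAt 𝓘(ℝ, E) x₀).target)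
    (Y : E → E) : vfInChart (vfOfChart x₀ Y) x₀ y = Y y :=
  inverse_apply_of_eq (chartSymmDeriv_isInvertible (E := E) hy)
    (chartSymmDeriv_eq_vfOfChart hy Y).symm

/-- Every tangent vector is the value of a vector field with constant coordinates. -/
theorem exists_constant_vfield (x : M) (v : TangentSpace 𝓘(ℝ, E) x) :
    ∃ u : E, vfOfChart x (fun _ => u) x = v := by
  refine ⟨mfderiv 𝓘(ℝ, E) 𝓘(ℝ, E) (extChartAt 𝓘(ℝ, E) x) x v, ?_⟩
  exact inverse_apply_of_eq (mpullback_chart_isInvertible (mem_extChartAt_source x)) rfl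

/-- The form `η` is smooth near the point `x`. -/
def SmoothFormNear {k : ℕ} (η : DForm E M k) (x : M) : Prop :=
  ∃ V : Set M, IsOpen V ∧ x ∈ V ∧ SmoothFormOn V η

theorem SmoothFormNear.contDiffAt {k : ℕ} {η : DForm E M k} {x₀ x : M} (h : SmoothFormNear η x)
    (hx : x ∈ (extChartAt 𝓘(ℝ, E) x₀).source) :
    ContDiffAt ℝ ∞ (formInChart η x₀) (extChartAt 𝓘(ℝ, E) x₀ x) := by
  obtain ⟨V, hV, hxV, h⟩ := h
  refine h.contDiffAt hV ((extChartAt 𝓘(ℝ, E) x₀).map_source hx) ?_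
  rwa [(extChartAt 𝓘(ℝ, E) x₀).left_inv hx]

theorem SmoothFormNear.smoothFunAt_apply {k : ℕ} {η : DForm E M k} {x : M}
    (h : SmoothFormNear η x) {X : Fin k → VField E M} (hX : ∀ i, SmoothVFAt (X i) x) :
    SmoothFunAt (E := E) (fun x => η x (fun i => X i x)) x := by
  have hx := mem_extChartAt_source (I := 𝓘(ℝ, E)) x
  rw [smoothFunAt_iff hx]
  refine (contDiffAt_form_apply (h.contDiffAt hx)
    fun i => (smoothVFAt_iff hx).1 (hX i)).congr_of_eventuallyEq ?_
  filter_upwards [eventually_target hx] with y hy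
  exact (formInChart_vfInChart η X hy).symm

theorem funInChart_form_eventuallyEq {k : ℕ} (η : DForm E M k) (X : Fin k → VField E M) {x₀ x : M}
    (hx : x ∈ (extChartAt 𝓘(ℝ, E) x₀).source) :
    funInChart (fun x => η x (fun i => X i x)) x₀ =ᶠ[𝓝 (extChartAt 𝓘(ℝ, E) x₀ x)]
      fun y => formInChart η x₀ y (fun i => vfInChart (X i) x₀ y) := by
  filter_upwards [eventually_target hx] with y hy
  exact (formInChart_vfInChart η X hy).symm

theorem vec_one {α : Type*} (a : Fin 1 → α) : a = ![a 0] := by ext i; fin_cases i; rfl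

theorem vec_two {α : Type*} (a : Fin 2 → α) : a = ![a 0, a 1] := by ext i; fin_cases i <;> rfl

theorem vec_three {α : Type*} (a : Fin 3 → α) : a = ![a 0, a 1, a 2] := by
  ext i; fin_cases i <;> rfl

/-- Cartan's formula for the exterior derivative of a one-form. -/
theorem dForm_one_apply {η : DForm E M 1} {X Y : VField E M} {x : M}
    (hη : SmoothFormNear η x) (hX : SmoothVFAt X x) (hY : SmoothVFAt Y x) :
    dForm η x ![X x, Y x] = dfun (fun x => η x ![Y x]) x (X x)
      - dfun (fun x => η x ![X x]) x (Y x)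
      - η x ![VectorField.mlieBracket 𝓘(ℝ, E) X Y x] := by
  have hx := mem_extChartAt_source (I := 𝓘(ℝ, E)) x
  have e1 : ∀ (Z : VField E M) (z : M), (fun _ : Fin 1 => Z z) = ![Z z] := fun Z z => vec_one _
  have hs : ∀ {Z : VField E M}, SmoothVFAt Z x →
      SmoothFunAt (E := E) (fun x => η x ![Z x]) x := fun {Z} hZ => by
    have := hη.smoothFunAt_apply (X := fun _ => Z) fun _ => hZ
    simpa only [e1] using this
  have hc : ∀ Z : VField E M, funInChart (fun x => η x ![Z x]) x
      =ᶠ[𝓝 (extChartAt 𝓘(ℝ, E) x x)] fun y => formInChart η x y ![vfInChart Z x y] := fun Z => by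
    have := funInChart_form_eventuallyEq η (fun _ => Z) hx
    simp only [e1] at this
    filter_upwards [this] with y hy
    rw [hy, vec_one fun _ : Fin 1 => vfInChart Z x y]
  have h1 : dForm η x ![X x, Y x] = extDeriv (formInChart η x) (extChartAt 𝓘(ℝ, E) x x)
      ![vfInChart X x (extChartAt 𝓘(ℝ, E) x x), vfInChart Y x (extChartAt 𝓘(ℝ, E) x x)] := by
    have h := dForm_vfield_eq η ![X, Y] x
    rw [vec_two fun i => (![X, Y] : Fin 2 → VField E M) i x,
      vec_two fun i => vfInChart ((![X, Y] : Fin 2 → VField E M) i) x _] at h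
    exact h
  have h2 := form_vfield_eq hx η (fun _ => VectorField.mlieBracket 𝓘(ℝ, E) X Y)
  rw [vec_one fun _ => VectorField.mlieBracket 𝓘(ℝ, E) X Y x,
    vec_one fun _ => vfInChart (VectorField.mlieBracket 𝓘(ℝ, E) X Y) x _] at h2
  have hl := (extChartAt 𝓘(ℝ, E) x).left_inv hx
  rw [vfInChart_mlieBracket ((extChartAt 𝓘(ℝ, E) x).map_source hx) (by rwa [hl])
    (by rwa [hl])] at h2
  rw [h1, h2, dfun_vfield_eq hx (hs hX), dfun_vfield_eq hx (hs hY), (hc X).fderiv_eq,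
    (hc Y).fderiv_eq]
  exact extDeriv_one_apply ((hη.contDiffAt hx).differentiableAt (by simp))
    (((smoothVFAt_iff hx).1 hX).differentiableAt (by simp))
    (((smoothVFAt_iff hx).1 hY).differentiableAt (by simp))

/-! ### Hamiltonian vector fields -/

namespace LCS

variable [FiniteDimensional ℝ E] (S : LCS E M)

theorem ham_unique {f : M → ℝ} {x : M} {v : TangentSpace 𝓘(ℝ, E) x}
    (h : ∀ w, S.form x ![v, w] = dfun f x w - f x * S.lee x ![w]) : v = S.jacobi.ham f x := by
  refine (S.flatMap_bijective x).1 (ContinuousLinearMap.ext fun w => ?_)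
  rw [flatMap_apply, flatMap_apply, h, ham_spec]

theorem form_swap (x : M) (u v : TangentSpace 𝓘(ℝ, E) x) :
    S.form x ![u, v] = - S.form x ![v, u] := by
  have h : S.form x (![v, u] ∘ Equiv.swap 0 1) = - S.form x ![v, u] :=
    (S.form x).map_swap ![v, u] (i := 0) (j := 1) (by simp)
  rw [← h]
  congr 1
  ext i; fin_cases i <;> rfl

theorem form_reeb (x : M) (w : TangentSpace 𝓘(ℝ, E) x) :
    S.form x ![S.jacobi.reeb x, w] = - S.lee x ![w] := by
  rw [← flatMap_apply]
  have h : S.flat x (S.jacobi.reeb x) =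
      -(ContinuousAlternatingMap.ofSubsingleton ℝ _ ℝ (0 : Fin 1)).symm (S.lee x) := by
    simp [jacobi]
  change S.flat x (S.jacobi.reeb x) w = _
  rw [h]
  change - S.lee x (fun _ => w) = _
  rw [vec_one fun _ => w]

/-- The Jacobi bracket in terms of Hamiltonian vector fields: `{f, g} = ω(X_g, X_f)`. -/
theorem bracket_eq (f g : M → ℝ) (x : M) :
    S.jacobi.bracket f g x = S.form x ![S.jacobi.ham g x, S.jacobi.ham f x] := by
  -- From `ω(E, E) = 0` follows `θ(E) = 0`, and then `θ(X_f) = ω(X_f, E) = df(E)`.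
  have h1 : S.lee x ![S.jacobi.ham f x] = dfun f x (S.jacobi.reeb x) := by
    have h2 := S.form_reeb x (S.jacobi.ham f x)
    have h3 := S.form_swap x (S.jacobi.reeb x) (S.jacobi.ham f x)
    have h4 := S.ham_spec f x (S.jacobi.reeb x)
    have h5 := S.form_reeb x (S.jacobi.reeb x)
    have h6 := S.form_swap x (S.jacobi.reeb x) (S.jacobi.reeb x)
    have h7 : S.lee x ![S.jacobi.reeb x] = 0 := by linarith
    rw [h7] at h4
    linarith
  rw [ham_spec, h1]
  simp only [BivectorPair.bracket, BivectorPair.bivector, BivectorPair.ham, map_add, map_smul,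
    smul_eq_mul]

theorem smoothFormNear_form (x : M) : SmoothFormNear S.form x :=
  ⟨Set.univ, isOpen_univ, trivial, S.smooth_form⟩

theorem smoothFormNear_lee (x : M) : SmoothFormNear S.lee x :=
  ⟨Set.univ, isOpen_univ, trivial, S.smooth_lee⟩

/-- The equation `X_f ⌟ ω = df - f θ` in coordinates. -/
theorem ham_spec_inChart {f : M → ℝ} {x₀ : M} {y : E}
    (hy : y ∈ (extChartAt 𝓘(ℝ, E) x₀).target)
    (hf : SmoothFunAt (E := E) f ((extChartAt 𝓘(ℝ, E) x₀).symm y)) (w : E) :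
    formInChart S.form x₀ y ![vfInChart (S.jacobi.ham f) x₀ y, w] =
      fderiv ℝ (funInChart f x₀) y w - funInChart f x₀ y * formInChart S.lee x₀ y ![w] := by
  have h1 : ∀ v : E, (fun i => chartSymmDeriv x₀ y ((![v, w] : Fin 2 → E) i)) =
      ![chartSymmDeriv x₀ y v, chartSymmDeriv x₀ y w] := fun v => vec_two _
  have h2 : (fun i => chartSymmDeriv x₀ y ((![w] : Fin 1 → E) i)) =
      ![chartSymmDeriv x₀ y w] := vec_one _
  rw [formInChart_apply, formInChart_apply, h1, h2, chartSymmDeriv_vfInChart hy, ham_spec,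
    dfun_chartSymmDeriv hy hf]
  rfl

theorem nondegenerate_inChart {x₀ : M} {y : E} (hy : y ∈ (extChartAt 𝓘(ℝ, E) x₀).target) {v : E}
    (h : ∀ w, formInChart S.form x₀ y ![v, w] = 0) : v = 0 := by
  obtain ⟨A, hA⟩ := chartSymmDeriv_isInvertible (E := E) hy
  refine A.injective ?_
  rw [map_zero]
  refine S.nondegenerate _ _ fun w => ?_
  have h1 := h (A.symm w)
  rw [formInChart_apply, vec_two (fun i => chartSymmDeriv x₀ y _), ← hA] at h1
  change S.form _ ![A v, A (A.symm w)] = 0 at h1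
  rwa [A.apply_symm_apply] at h1

/-- In a chart, pairing `X_f ⌟ ω = df - f θ` with a basis gives a linear system for `X_f` with
smooth coefficients. Nondegeneracy makes it invertible, and inversion of operators is smooth. -/
theorem smoothVFAt_ham {f : M → ℝ} {x : M} (hf : ∀ᶠ z in 𝓝 x, SmoothFunAt (E := E) f z) :
    SmoothVFAt (S.jacobi.ham f) x := by
  have hx := mem_extChartAt_source (I := 𝓘(ℝ, E)) x
  have hy := (extChartAt 𝓘(ℝ, E) x).map_source hx
  rw [smoothVFAt_iff hx]
  set y₀ := extChartAt 𝓘(ℝ, E) x x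
  let b := Module.finBasis ℝ E
  let B : E → E →L[ℝ] (Fin (Module.finrank ℝ E) → ℝ) := fun y =>
    ContinuousLinearMap.pi fun j => (formInChart S.form x y).toContinuousLinearMap ![0, b j] 0
  have hB : ∀ y v j, B y v j = formInChart S.form x y ![v, b j] := by
    intro y v j
    change formInChart S.form x y (Function.update ![0, b j] 0 v) = _
    congr 1
    ext i; fin_cases i <;> rfl
  have hBinj : ∀ y ∈ (extChartAt 𝓘(ℝ, E) x).target, Function.Injective (B y) := by
    intro y hy
    rw [injective_iff_map_eq_zero]
    intro v hv
    refine S.nondegenerate_inChart hy fun w => ?_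
    have h1 : ((formInChart S.form x y).toContinuousLinearMap ![v, 0] 1 : E →ₗ[ℝ] ℝ) = 0 := by
      refine b.ext fun j => ?_
      have h2 := hB y v j
      rw [hv] at h2
      change formInChart S.form x y (Function.update ![v, 0] 1 (b j)) = 0
      rw [show Function.update ![v, 0] 1 (b j) = ![v, b j] by ext i; fin_cases i <;> rfl, ← h2]
      rfl
    have h3 := congrArg (fun A : E →ₗ[ℝ] ℝ => A w) h1
    change formInChart S.form x y (Function.update ![v, 0] 1 w) = 0 at h3
    rwa [show Function.update ![v, 0] 1 w = ![v, w] by ext i; fin_cases i <;> rfl] at h3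
  have hBinv : ∀ y ∈ (extChartAt 𝓘(ℝ, E) x).target, (B y).IsInvertible := by
    intro y hy
    have hsurj : Function.Surjective (B y : E →ₗ[ℝ] _) :=
      (LinearMap.injective_iff_surjective_of_finrank_eq_finrank
        (Module.finrank_fin_fun ℝ).symm).1 (hBinj y hy)
    refine ⟨(LinearEquiv.ofBijective (B y : E →ₗ[ℝ] _)
      ⟨hBinj y hy, hsurj⟩).toContinuousLinearEquiv, ?_⟩
    ext v : 1
    rfl
  have hform := (S.smoothFormNear_form x).contDiffAt hx
  have hlee := (S.smoothFormNear_lee x).contDiffAt hx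
  have hfc := (smoothFunAt_iff hx).1 hf.self_of_nhds
  have hBs : ContDiffAt ℝ ∞ B y₀ := by
    refine contDiffAt_clm_of_apply fun v => contDiffAt_pi.2 fun j => ?_
    simp only [hB]
    exact (ContinuousAlternatingMap.apply ℝ E ℝ ![v, b j]).contDiff.contDiffAt.comp y₀ hform
  let r : E → Fin (Module.finrank ℝ E) → ℝ := fun y j =>
    fderiv ℝ (funInChart f x) y (b j) - funInChart f x y * formInChart S.lee x y ![b j]
  have hr : ContDiffAt ℝ ∞ r y₀ := by
    refine contDiffAt_pi.2 fun j => ContDiffAt.sub ?_ (hfc.mul ?_)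
    · exact (ContinuousLinearMap.apply ℝ ℝ (b j)).contDiff.contDiffAt.comp y₀
        (hfc.fderiv_right (by simp))
    · exact (ContinuousAlternatingMap.apply ℝ E ℝ ![b j]).contDiff.contDiffAt.comp y₀ hlee
  have hBi : ContDiffAt ℝ ∞ (fun y => (B y).inverse) y₀ := by
    obtain ⟨A, hA⟩ := hBinv y₀ hy
    have h : ContDiffAt ℝ ∞ ContinuousLinearMap.inverse
      (A : E →L[ℝ] (Fin (Module.finrank ℝ E) → ℝ)) := contDiffAt_map_inverse A
    rw [hA] at h
    exact h.comp y₀ hBs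
  refine (hBi.clm_apply hr).congr_of_eventuallyEq ?_
  filter_upwards [eventually_target hx, eventually_chart_symm hx hf] with y hyt hyf
  refine (inverse_apply_of_eq (hBinv y hyt) ?_).symm
  ext j
  rw [hB, S.ham_spec_inChart hyt hyf]

/-- `X_f` is a Lie algebra homomorphism: `[X_f, X_g] = X_{f, g}`. -/
theorem mlieBracket_ham {f g : M → ℝ} {x : M} (hf : ∀ᶠ z in 𝓝 x, SmoothFunAt (E := E) f z)
    (hg : ∀ᶠ z in 𝓝 x, SmoothFunAt (E := E) g z) :
    VectorField.mlieBracket 𝓘(ℝ, E) (S.jacobi.ham f) (S.jacobi.ham g) x =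
      S.jacobi.ham (S.jacobi.bracket f g) x := by
  have hx := mem_extChartAt_source (I := 𝓘(ℝ, E)) x
  have hy := (extChartAt 𝓘(ℝ, E) x).map_source hx
  have hl := (extChartAt 𝓘(ℝ, E) x).left_inv hx
  have hXf := S.smoothVFAt_ham hf
  have hXg := S.smoothVFAt_ham hg
  have hbr : S.jacobi.bracket f g = fun z => S.form z
      (fun i => (![S.jacobi.ham g, S.jacobi.ham f] : Fin 2 → VField E M) i z) := by
    funext z
    rw [bracket_eq, vec_two (fun i => (![S.jacobi.ham g, S.jacobi.ham f] : Fin 2 → VField E M) i z)]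
    rfl
  have hbrs : SmoothFunAt (E := E) (S.jacobi.bracket f g) x := by
    rw [hbr]
    refine (S.smoothFormNear_form x).smoothFunAt_apply fun i => ?_
    fin_cases i
    · exact hXg
    · exact hXf
  -- It suffices to check the equation characterizing the Hamiltonian field of the bracket. The
  -- vector `w` is extended by a field with constant coordinates, and the identity becomes
  -- `lieBracket_contact` in the chart at `x`, since the bracket is `ω(X_g, X_f)`.
  refine S.ham_unique fun w => ?_
  obtain ⟨u, hu⟩ := exists_constant_vfield x w
  have hform := (S.smoothFormNear_form x).contDiffAt hx
  have hlee := (S.smoothFormNear_lee x).contDiffAt hx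
  have key := lieBracket_contact (β := formInChart S.form x) (θ := formInChart S.lee x)
    (f := funInChart f x) (g := funInChart g x) (X := vfInChart (S.jacobi.ham f) x)
    (Y := vfInChart (S.jacobi.ham g) x) (x := extChartAt 𝓘(ℝ, E) x x)
    (hform.differentiableAt (by simp)) (hlee.differentiableAt (by simp))
    (((smoothFunAt_iff hx).1 hf.self_of_nhds).of_le (by exact ENat.LEInfty.out))
    (((smoothFunAt_iff hx).1 hg.self_of_nhds).of_le (by exact ENat.LEInfty.out))
    (((smoothVFAt_iff hx).1 hXf).differentiableAt (by simp))
    (((smoothVFAt_iff hx).1 hXg).differentiableAt (by simp)) ?_ ?_ ?_ ?_ u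
  · have hcomm := vfInChart_mlieBracket hy (X := S.jacobi.ham f) (Y := S.jacobi.ham g)
      (by rwa [hl]) (by rwa [hl])
    have hwc : vfInChart (vfOfChart x (fun _ => u)) x (extChartAt 𝓘(ℝ, E) x x) = u :=
      vfInChart_vfOfChart hy _
    have e1 := form_vfield_eq hx S.form
      ![VectorField.mlieBracket 𝓘(ℝ, E) (S.jacobi.ham f) (S.jacobi.ham g), vfOfChart x (fun _ => u)]
    rw [vec_two (fun i => (_ : TangentSpace 𝓘(ℝ, E) x)), vec_two (fun i => vfInChart _ x _)] at e1
    change S.form x ![VectorField.mlieBracket 𝓘(ℝ, E) (S.jacobi.ham f) (S.jacobi.ham g) x,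
      vfOfChart x (fun _ => u) x] = formInChart S.form x _
        ![vfInChart (VectorField.mlieBracket 𝓘(ℝ, E) (S.jacobi.ham f) (S.jacobi.ham g)) x _,
          vfInChart (vfOfChart x (fun _ => u)) x _] at e1
    rw [hu, hwc, hcomm, key] at e1
    rw [e1]
    have e2 := dfun_vfield_eq hx hbrs (vfOfChart x (fun _ => u))
    rw [hu, hwc] at e2
    rw [e2]
    have e3 := form_vfield_eq hx S.lee ![vfOfChart x (fun _ => u)]
    rw [vec_one (fun i => (_ : TangentSpace 𝓘(ℝ, E) x)), vec_one (fun i => vfInChart _ x _)] at e3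
    change S.lee x ![vfOfChart x (fun _ => u) x] = formInChart S.lee x _
        ![vfInChart (vfOfChart x (fun _ => u)) x _] at e3
    rw [hu, hwc] at e3
    rw [e3]
    have e4 := funInChart_form_eventuallyEq S.form ![S.jacobi.ham g, S.jacobi.ham f] hx
    rw [← hbr] at e4
    have e5 : funInChart (S.jacobi.bracket f g) x =ᶠ[𝓝 (extChartAt 𝓘(ℝ, E) x x)] fun y =>
        formInChart S.form x y ![vfInChart (S.jacobi.ham g) x y, vfInChart (S.jacobi.ham f) x y] :=
      e4.mono fun y h => h.trans (congrArg (formInChart S.form x y) (vec_two _))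
    rw [e5.fderiv_eq, ← e5.eq_of_nhds]
    simp only [funInChart, hl]
  · ext v
    have h1 := dForm_vfield_eq S.lee (fun i => vfOfChart x (fun _ => v i)) x
    simp only [vfInChart_vfOfChart hy] at h1
    rw [← h1, S.closed_lee x]
    rfl
  · intro u v w
    have h1 := dForm_vfield_eq S.form (fun i => vfOfChart x (fun _ => ![u, v, w] i)) x
    have hone : ∀ u, S.lee x ![vfOfChart x (fun _ => u) x] = formInChart S.lee x
        (extChartAt 𝓘(ℝ, E) x x) ![u] := fun u => by
      have h := form_vfield_eq hx S.lee (fun _ => vfOfChart x (fun _ => u))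
      simp only [vfInChart_vfOfChart hy] at h
      rw [vec_one fun _ => u, vec_one fun _ => vfOfChart x (fun _ => u) x] at h
      exact h
    have htwo : ∀ u v, S.form x ![vfOfChart x (fun _ => u) x, vfOfChart x (fun _ => v) x] =
        formInChart S.form x (extChartAt 𝓘(ℝ, E) x x) ![u, v] := fun u v => by
      have h := form_vfield_eq hx S.form (fun i => vfOfChart x (fun _ => ![u, v] i))
      simp only [vfInChart_vfOfChart hy] at h
      rw [vec_two fun i => vfOfChart x (fun _ => ![u, v] i) x] at h
      exact h
    simp only [vfInChart_vfOfChart hy] at h1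
    rw [vec_three fun i => vfOfChart x (fun _ => ![u, v, w] i) x] at h1
    have h2 := h1.symm.trans (S.d_form x (vfOfChart x (fun _ => u) x) (vfOfChart x (fun _ => v) x)
      (vfOfChart x (fun _ => w) x))
    rw [hone, hone, hone, htwo, htwo, htwo] at h2
    exact h2
  · filter_upwards [eventually_target hx, eventually_chart_symm hx hf] with y hyt hyf w
    exact S.ham_spec_inChart hyt hyf w
  · filter_upwards [eventually_target hx, eventually_chart_symm hx hg] with y hyt hyf w
    exact S.ham_spec_inChart hyt hyf w

end LCS

end Manifold

/-! ### The triangular frame of a Jacobi structure -/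

section Jacobi

variable {E : Type*} [NormedAddCommGroup E] [NormedSpace ℝ E] [FiniteDimensional ℝ E]
  {M : Type*} [TopologicalSpace M] [ChartedSpace E M] [IsManifold 𝓘(ℝ, E) ∞ M]

theorem dfun_comp_pi {κ : Type*} [Fintype κ] [DecidableEq κ] {G : (κ → ℝ) → ℝ} {f : κ → M → ℝ}
    {x : M} (hG : ContDiff ℝ ∞ G) (hf : ∀ k, SmoothFunAt (E := E) (f k) x) :
    SmoothFunAt (E := E) (fun z => G (fun k => f k z)) x ∧
    dfun (E := E) (fun z => G (fun k => f k z)) x =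
      ∑ k, fderiv ℝ G (fun k => f k x) (Pi.single k 1) • dfun (f k) x := by
  have hx := mem_extChartAt_source (I := 𝓘(ℝ, E)) x
  have hl := (extChartAt 𝓘(ℝ, E) x).left_inv hx
  have hf' := fun k => (smoothFunAt_iff hx).1 (hf k)
  have hs : SmoothFunAt (E := E) (fun z => G (fun k => f k z)) x :=
    (smoothFunAt_iff hx).2 (hG.contDiffAt.comp _ (contDiffAt_pi.2 hf'))
  refine ⟨hs, ContinuousLinearMap.ext fun w => ?_⟩
  obtain ⟨u, rfl⟩ := exists_constant_vfield x w
  rw [dfun_vfield_eq hx hs, sum_apply]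
  simp only [smul_apply, dfun_vfield_eq hx (hf _)]
  have h1 : HasFDerivAt (fun y k => funInChart (f k) x y)
      (ContinuousLinearMap.pi fun k => fderiv ℝ (funInChart (f k) x) (extChartAt 𝓘(ℝ, E) x x))
      (extChartAt 𝓘(ℝ, E) x x) :=
    hasFDerivAt_pi.2 fun k => ((hf' k).differentiableAt (by simp)).hasFDerivAt
  have h2 := (((hG.differentiable (by simp)).differentiableAt.hasFDerivAt).comp _ h1).fderiv
  refine (congrArg (fun A : E →L[ℝ] ℝ =>
    A (vfInChart (vfOfChart x fun _ => u) x (extChartAt 𝓘(ℝ, E) x x))) h2).trans ?_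
  rw [ContinuousLinearMap.comp_apply]
  refine (LinearMap.pi_apply_eq_sum_univ (fderiv ℝ G fun k => funInChart (f k) x
    (extChartAt 𝓘(ℝ, E) x x) : (κ → ℝ) →ₗ[ℝ] ℝ) _).trans ?_
  have h3 : (fun k => funInChart (f k) x (extChartAt 𝓘(ℝ, E) x x)) = fun k => f k x := by
    funext k
    exact congrArg (f k) hl
  refine Finset.sum_congr rfl fun k _ => ?_
  rw [smul_eq_mul, smul_eq_mul, mul_comm]
  have h4 : (fun j => if k = j then (1 : ℝ) else 0) = Pi.single k 1 := by
    funext j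
    rw [Pi.single_apply]
    simp only [eq_comm]
  refine congrArg (· * _) ?_
  refine (congrArg _ h4).trans ?_
  exact congrArg (fun z => fderiv ℝ G z (Pi.single k 1)) h3

/-- The Hamiltonian vector field of a function of functions. -/
theorem BivectorPair.ham_comp (J : BivectorPair E M) {κ : Type*} [Fintype κ] [DecidableEq κ]
    {G : (κ → ℝ) → ℝ} {f : κ → M → ℝ} {x : M} (hG : ContDiff ℝ ∞ G)
    (hf : ∀ k, SmoothFunAt (E := E) (f k) x) :
    J.ham (fun z => G (fun k => f k z)) x =
      (∑ k, fderiv ℝ G (fun k => f k x) (Pi.single k 1) • J.ham (f k) x) +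
      (G (fun k => f k x) - ∑ k, f k x * fderiv ℝ G (fun k => f k x) (Pi.single k 1)) •
        J.reeb x := by
  simp only [BivectorPair.ham]
  rw [(dfun_comp_pi hG hf).2]
  simp only [map_sum, map_smul, smul_add, Finset.sum_add_distrib, sub_smul, Finset.sum_smul,
    smul_smul]
  have h : ∀ k, f k x * fderiv ℝ G (fun k => f k x) (Pi.single k 1) =
    fderiv ℝ G (fun k => f k x) (Pi.single k 1) * f k x := fun k => mul_comm _ _
  simp only [h]
  abel

/-- A frame on the open set `V` whose successive spans are involutive. -/
structure TriangularFrame {m : ℕ} (V : Set M) (Y : Fin m → VField E M) : Prop where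
  isOpen : IsOpen V
  finrank_eq : Module.finrank ℝ E = m
  smooth : ∀ a, SmoothVFOn V (Y a)
  independent : ∀ x ∈ V, LinearIndependent ℝ (fun a => Y a x)
  bracket : ∀ x ∈ V, ∀ a b, a < b → VectorField.mlieBracket 𝓘(ℝ, E) (Y a) (Y b) x ∈
    Submodule.span ℝ ((fun c => Y c x) '' Set.Iic b)

theorem span_range_eq_top {m : ℕ} (hE : Module.finrank ℝ E = m) {x : M}
    {Y : Fin m → TangentSpace 𝓘(ℝ, E) x} (hY : LinearIndependent ℝ Y) :
    Submodule.span ℝ (Set.range Y) = ⊤ := by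
  rcases m with _ | m
  · have h : FiniteDimensional ℝ (TangentSpace 𝓘(ℝ, E) x) := ‹FiniteDimensional ℝ E›
    have h2 : Module.finrank ℝ (TangentSpace 𝓘(ℝ, E) x) = 0 := hE
    have := Module.finrank_zero_iff.1 h2
    exact Subsingleton.elim _ _
  · exact hY.span_eq_top_of_card_eq_finrank (by rw [Fintype.card_fin]; exact hE.symm)

/-- For two Hamiltonian members the bracket is the Hamiltonian field of `G(f_0, …, f_j)`. By
`BivectorPair.ham_comp` it consists of a combination of `X_{f_0}, …, X_{f_j}` and the multiple of
the Reeb field controlled by Reeb compatibility. Brackets with `R` impose nothing, as `R` comes last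
and the whole frame spans. -/
theorem LCS.triangularFrame (S : LCS E M) {N : ℕ} {H : M → ℝ}
    (hH : SmoothFunOn (E := E) Set.univ H) {F : Fin N → M → ℝ} {U V : Set M}
    (hF : IsJacobiCInfStructure S.jacobi H F U) (hV : IsOpen V) (hVU : V ⊆ U) {R : VField E M}
    (hR : SmoothVFOn V R)
    (hRs : ∀ x ∈ V, R x ∉ Submodule.span ℝ (Set.range fun k : Fin (N + 1) =>
      S.jacobi.ham ((Fin.cons H F : Fin (N + 1) → M → ℝ) k) x)) :
    TriangularFrame V (Fin.snoc (α := fun _ => VField E M)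
      (fun k => S.jacobi.ham ((Fin.cons H F : Fin (N + 1) → M → ℝ) k)) R) := by
  set f : Fin (N + 1) → M → ℝ := Fin.cons H F with hf
  have hfs : ∀ k x, SmoothFunAt (E := E) (f k) x := by
    intro k x
    refine Fin.cases ?_ (fun j => ?_) k
    · exact (smoothFunOn_iff isOpen_univ).1 hH x trivial
    · exact (smoothFunOn_iff isOpen_univ).1 (hF.smooth j) x trivial
  have hind : ∀ x ∈ V, LinearIndependent ℝ (fun a => (Fin.snoc (α := fun _ => VField E M)
      (fun k => S.jacobi.ham (f k)) R : Fin (N + 2) → VField E M) a x) := by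
    intro x hx
    have h : (fun a => (Fin.snoc (α := fun _ => VField E M)
      (fun k => S.jacobi.ham (f k)) R : Fin (N + 2) → VField E M) a x) =
      Fin.snoc (α := fun _ => TangentSpace 𝓘(ℝ, E) x) (fun k => S.jacobi.ham (f k) x) (R x) := by
      funext a
      refine Fin.lastCases ?_ (fun k => ?_) a <;> simp
    rw [h]
    exact linearIndependent_finSnoc.2 ⟨hF.independent x (hVU hx), hRs x hx⟩
  refine ⟨hV, hF.card_eq, fun a => ?_, hind, fun x hx a b hab => ?_⟩
  · refine Fin.lastCases ?_ (fun k => ?_) a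
    · simpa using hR
    · simp only [Fin.snoc_castSucc]
      exact (smoothVFOn_iff hV).2 fun x _ => S.smoothVFAt_ham (.of_forall (hfs k))
  · revert hab
    refine Fin.lastCases (fun hab => ?_) (fun j hab => ?_) b
    · have h : Set.Iic (Fin.last (N + 1)) = Set.univ := by
        ext a; simp [Fin.le_last]
      rw [h, Set.image_univ, span_range_eq_top hF.card_eq (hind x hx)]
      trivial
    · obtain ⟨i, rfl⟩ : ∃ i : Fin (N + 1), a = i.castSucc :=
        ⟨a.castPred (ne_of_lt (hab.trans_le (Fin.le_last _))), by simp⟩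
      have hij : i < j := by simpa using hab
      simp only [Fin.snoc_castSucc]
      have hspan : ∀ k ≤ j, S.jacobi.ham (f k) x ∈ Submodule.span ℝ
          ((fun c => (Fin.snoc (α := fun _ => VField E M)
            (fun k => S.jacobi.ham (f k)) R : Fin (N + 2) → VField E M) c x) ''
              Set.Iic j.castSucc) := fun k hk =>
        Submodule.subset_span ⟨k.castSucc, by simpa using hk, by simp⟩
      obtain ⟨G, hG, hbr, hreeb⟩ := hF.closure_reeb i j hij
      obtain ⟨W, hW, hxW, c, -, hc⟩ := hreeb x (hVU hx)
      -- The closure hypothesis has the larger index first, `{f_j, f_i}`, so the bracket is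
      -- reversed.
      rw [VectorField.mlieBracket_swap_apply, Submodule.neg_mem_iff, S.mlieBracket_ham
        (.of_forall (hfs j)) (.of_forall (hfs i)), funext hbr, S.jacobi.ham_comp hG
        fun k => hfs _ x]
      refine add_mem (sum_mem fun k _ => Submodule.smul_mem _ _ (hspan _ ?_)) ?_
      · exact Fin.le_def.2 (Nat.lt_succ_iff.1 k.isLt)
      · rw [hc x hxW]
        refine sum_mem fun k _ => Submodule.smul_mem _ _ (hspan _ ?_)
        exact Fin.le_def.2 (Nat.lt_succ_iff.1 k.isLt)

end Jacobi

/-! ### Smooth coefficients in a frame and `C^∞`-structures -/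

section Coefficients

variable {E : Type*} [NormedAddCommGroup E] [NormedSpace ℝ E] [FiniteDimensional ℝ E]
  {M : Type*} [TopologicalSpace M] [ChartedSpace E M] [IsManifold 𝓘(ℝ, E) ∞ M]

theorem linearIndependent_inChart {κ : Type*} {Y : κ → VField E M} {x₀ : M} {y : E}
    (hy : y ∈ (extChartAt 𝓘(ℝ, E) x₀).target)
    (h : LinearIndependent ℝ (fun a => Y a ((extChartAt 𝓘(ℝ, E) x₀).symm y))) :
    LinearIndependent ℝ (fun a => vfInChart (Y a) x₀ y) := by
  refine LinearIndependent.of_comp (chartSymmDeriv x₀ y).toLinearMap ?_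
  have h1 : (⇑(chartSymmDeriv x₀ y).toLinearMap ∘ fun a => vfInChart (Y a) x₀ y) =
      fun a => Y a ((extChartAt 𝓘(ℝ, E) x₀).symm y) :=
    funext fun a => chartSymmDeriv_vfInChart hy (Y a)
  rwa [h1]

theorem SmoothVFAt.sum_smul {κ : Type*} (s : Finset κ) {c : κ → M → ℝ} {Y : κ → VField E M} {x : M}
    (hc : ∀ k, SmoothFunAt (E := E) (c k) x) (hY : ∀ k, SmoothVFAt (Y k) x) :
    SmoothVFAt (fun z => ∑ k ∈ s, c k z • Y k z) x :=
  ContMDiffAt.sum_section (t := fun k z => c k z • Y k z) fun k _ =>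
    ContMDiffAt.smul_section (hc k) (hY k)

/-- The Leibniz rule `[X, c Y] = X(c) Y + c [X, Y]`: both terms stay in `T`, so generators suffice
for testing module membership of brackets. -/
theorem mlieBracket_sum_smul_mem {κ : Type*} (s : Finset κ) {c : κ → M → ℝ} {Y : κ → VField E M}
    {X : VField E M} {x : M} {T : Submodule ℝ (TangentSpace 𝓘(ℝ, E) x)}
    (hc : ∀ k, SmoothFunAt (E := E) (c k) x) (hY : ∀ k, SmoothVFAt (Y k) x)
    (hYT : ∀ k, Y k x ∈ T) (hXT : ∀ k, VectorField.mlieBracket 𝓘(ℝ, E) X (Y k) x ∈ T) :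
    VectorField.mlieBracket 𝓘(ℝ, E) X (fun z => ∑ k ∈ s, c k z • Y k z) x ∈ T := by
  classical
  induction s using Finset.induction_on with
  | empty =>
    simp only [Finset.sum_empty]
    have h := congrFun (VectorField.mlieBracket_zero_right (I := 𝓘(ℝ, E)) (W := X)) x
    exact h ▸ T.zero_mem
  | insert k s hk ih =>
    simp only [Finset.sum_insert hk]
    have h1 : ContMDiffAt 𝓘(ℝ, E) (𝓘(ℝ, E).prod 𝓘(ℝ, E)) ∞
        (fun x => (⟨x, (c k • Y k) x⟩ : TangentBundle 𝓘(ℝ, E) M)) x :=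
      ContMDiffAt.smul_section (hc k) (hY k)
    have h2 := SmoothVFAt.sum_smul s hc hY
    have h3 := VectorField.mlieBracket_add_right (V := X) (h1.mdifferentiableAt (by simp))
      (ContMDiffAt.mdifferentiableAt h2 (by simp))
    have h4 := VectorField.mlieBracket_smul_right (V := X)
      (ContMDiffAt.mdifferentiableAt (hc k) (by simp))
      (ContMDiffAt.mdifferentiableAt (hY k) (by simp))
    refine (h3.trans (congrArg (· + _) h4)) ▸ T.add_mem (T.add_mem ?_ ?_) ih
    · exact T.smul_mem _ (hYT k)
    · exact T.smul_mem _ (hXT k)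

/-- Coefficients of a vector field with respect to a frame. -/
def frameCoeff {m : ℕ} (Y : Fin m → VField E M) (Z : VField E M) (a : Fin m) (x : M) : ℝ :=
  (frameMap (E := E) (fun a => Y a x)).inverse (Z x) a

namespace TriangularFrame

variable {m : ℕ} {V : Set M} {Y : Fin m → VField E M} (h : TriangularFrame V Y)
include h

theorem smoothVFAt {x : M} (hx : x ∈ V) (a : Fin m) : SmoothVFAt (Y a) x :=
  (smoothVFOn_iff h.isOpen).1 (h.smooth a) x hx

theorem isInvertible {x : M} (hx : x ∈ V) : (frameMap (E := E) (fun a => Y a x)).IsInvertible :=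
  frameMap_isInvertible (h.independent x hx) (by rw [h.finrank_eq, Fintype.card_fin])

theorem isInvertible_inChart {x₀ : M} {y : E} (hy : y ∈ (extChartAt 𝓘(ℝ, E) x₀).target)
    (hyV : (extChartAt 𝓘(ℝ, E) x₀).symm y ∈ V) :
    (frameMap (fun a => vfInChart (Y a) x₀ y)).IsInvertible :=
  frameMap_isInvertible (linearIndependent_inChart hy (h.independent _ hyV))
    (by rw [h.finrank_eq, Fintype.card_fin])

theorem sum_frameCoeff {x : M} (hx : x ∈ V) (Z : VField E M) :
    Z x = ∑ a, frameCoeff Y Z a x • Y a x := by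
  exact (frameMap_inverse_apply (h.isInvertible hx) (Z x)).symm.trans (frameMap_apply (E := E) _ _)

theorem frameCoeff_eq_zero {x : M} (hx : x ∈ V) {Z : VField E M} {s : Set (Fin m)}
    (hZ : Z x ∈ Submodule.span ℝ ((fun a => Y a x) '' s)) {a : Fin m} (ha : a ∉ s) :
    frameCoeff Y Z a x = 0 :=
  inverse_frameMap_of_mem_span (h.isInvertible hx) hZ ha

/-- The derivative of the chart carries the frame to the coordinate frame without changing
coefficients. In coordinates they come from the inverse of the frame map, which depends smoothly on
the point. -/
theorem smoothFunAt_frameCoeff {x : M} (hx : x ∈ V) {Z : VField E M} (hZ : SmoothVFAt Z x)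
    (a : Fin m) : SmoothFunAt (E := E) (frameCoeff Y Z a) x := by
  have hxs := mem_extChartAt_source (I := 𝓘(ℝ, E)) x
  have hl := (extChartAt 𝓘(ℝ, E) x).left_inv hxs
  rw [smoothFunAt_iff hxs]
  have h1 := contDiffAt_frameMap_inverse (fun a => (smoothVFAt_iff hxs).1 (h.smoothVFAt hx a))
    (h.isInvertible_inChart ((extChartAt 𝓘(ℝ, E) x).map_source hxs) (by rwa [hl]))
  refine (contDiffAt_pi.1 (h1.clm_apply ((smoothVFAt_iff hxs).1 hZ)) a).congr_of_eventuallyEq ?_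
  filter_upwards [eventually_target hxs, eventually_chart_symm hxs (h.isOpen.mem_nhds hx)]
    with y hyt hyV
  refine congrFun (?_ : (frameMap (E := E) _).inverse _ = _) a
  refine inverse_apply_of_eq (h.isInvertible hyV) ?_
  have h2 := frameMap_inverse_apply (h.isInvertible_inChart hyt hyV) (vfInChart Z x y)
  refine (frameMap_apply (E := E) _ _).trans ?_
  rw [frameMap_apply] at h2
  have h3 := congrArg (chartSymmDeriv x y) h2
  rw [map_sum, chartSymmDeriv_vfInChart hyt] at h3
  simp only [map_smul, chartSymmDeriv_vfInChart hyt] at h3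
  exact h3

theorem bracket_mem {x : M} (hx : x ∈ V) {a b d : Fin m} (ha : a ≤ d) (hb : b ≤ d) :
    VectorField.mlieBracket 𝓘(ℝ, E) (Y a) (Y b) x ∈
      Submodule.span ℝ ((fun c => Y c x) '' Set.Iic d) := by
  rcases lt_trichotomy a b with hab | rfl | hab
  · exact Submodule.span_mono (Set.image_mono (Set.Iic_subset_Iic.2 hb)) (h.bracket x hx a b hab)
  · rw [VectorField.mlieBracket_self]
    exact Submodule.zero_mem _
  · rw [VectorField.mlieBracket_swap_apply, Submodule.neg_mem_iff]
    exact Submodule.span_mono (Set.image_mono (Set.Iic_subset_Iic.2 ha)) (h.bracket x hx b a hab)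

/-- Pointwise membership in the span of a subframe is enough: the frame coefficients are smooth on
all of `V`, and those off the subframe vanish. -/
theorem inModuleOn {κ : Type*} [Fintype κ] {e : κ → Fin m} (he : Function.Injective e)
    {X : κ → VField E M} (hX : ∀ k, X k = Y (e k)) {Z : VField E M} (hZ : SmoothVFOn V Z)
    (hZs : ∀ x ∈ V, Z x ∈ Submodule.span ℝ ((fun a => Y a x) '' Set.range e)) :
    InModuleOn V X Z := by
  refine ⟨fun k => frameCoeff Y Z (e k), fun k => (smoothFunOn_iff h.isOpen).2 fun x hx =>
    h.smoothFunAt_frameCoeff hx ((smoothVFOn_iff h.isOpen).1 hZ x hx) _, fun x hx => ?_⟩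
  rw [h.sum_frameCoeff hx Z]
  refine (Fintype.sum_of_injective e he _ _ (fun a ha => ?_) fun k => ?_).symm
  · rw [h.frameCoeff_eq_zero hx (hZs x hx) ha, zero_smul]
  · rw [hX]

end TriangularFrame

/-- The last `r` members of a triangular frame are a `C^∞`-structure for the first. -/
theorem TriangularFrame.isCInfStructureOn {r : ℕ} {V : Set M} {Y : Fin (r + 1) → VField E M}
    (h : TriangularFrame V Y) :
    IsCInfStructureOn V (fun _ : Fin 1 => Y 0) (fun j : Fin r => Y j.succ) := by
  refine ⟨by rw [h.finrank_eq, add_comm], fun _ => h.smooth 0, fun j => h.smooth _,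
    fun x hx => ?_, fun j => ?_⟩
  · exact (h.independent x hx).comp (fun _ : Fin 1 => 0) fun a b _ => Subsingleton.elim a b
  -- The generators of `D_{j-1}` are the frame members of index below `j.succ`; `e` records this
  -- relabelling, and `e'` below adds `j.succ` itself.
  let e : Fin 1 ⊕ {i : Fin r // i < j} → Fin (r + 1) := Sum.elim (fun _ => 0) fun i => i.1.succ
  have he : Function.Injective e := by
    rintro (a | a) (b | b) hab
    · exact congrArg _ (Subsingleton.elim a b)
    · exact absurd hab.symm (Fin.succ_ne_zero _)
    · exact absurd hab (Fin.succ_ne_zero _)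
    · exact congrArg _ (Subtype.ext (Fin.succ_injective _ hab))
  have hej : ∀ k, e k < j.succ := by
    rintro (a | a)
    · exact Fin.succ_pos j
    · exact Fin.succ_lt_succ_iff.2 a.2
  have hrange : ∀ a < j.succ, a ∈ Set.range e := by
    intro a ha
    refine Fin.cases (fun _ => ⟨.inl 0, rfl⟩) (fun i hi => ?_) a ha
    exact ⟨.inr ⟨i, Fin.succ_lt_succ_iff.1 hi⟩, rfl⟩
  have hYe : ∀ k, (Sum.elim (fun _ : Fin 1 => Y 0) fun i : {i : Fin r // i < j} => Y i.1.succ) k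
      = Y (e k) := by
    rintro (a | a) <;> rfl
  refine ⟨fun x hx hmem => ?_, fun Z hZ => ?_⟩
  · refine (h.independent x hx).notMem_span_image (s := Set.range e) (x := j.succ) ?_ ?_
    · rintro ⟨k, hk⟩
      exact (hej k).ne hk
    · rw [← Set.range_comp]
      simp only [hYe] at hmem
      exact hmem
  obtain ⟨c, hc, hZc⟩ := hZ
  simp only [hYe] at hZc
  have hZev : ∀ x ∈ V, Z =ᶠ[𝓝 x] fun z => ∑ k, c k z • Y (e k) z := fun x hx =>
    Filter.mem_of_superset (h.isOpen.mem_nhds hx) fun z hz => hZc z hz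
  have hcs : ∀ x ∈ V, ∀ k, SmoothFunAt (E := E) (c k) x := fun x hx k =>
    (smoothFunOn_iff h.isOpen).1 (hc k) x hx
  have hZs : ∀ x ∈ V, SmoothVFAt Z x := fun x hx => by
    refine ContMDiffAt.congr_of_eventuallyEq
      (SmoothVFAt.sum_smul Finset.univ (hcs x hx) fun k => h.smoothVFAt hx (e k)) ?_
    filter_upwards [hZev x hx] with z hz
    exact congrArg (fun v => (⟨z, v⟩ : TangentBundle 𝓘(ℝ, E) M)) hz
  let e' : (Fin 1 ⊕ {i : Fin r // i < j}) ⊕ Unit → Fin (r + 1) := Sum.elim e fun _ => j.succ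
  have he' : Function.Injective e' := by
    rintro (a | a) (b | b) hab
    · exact congrArg _ (he hab)
    · exact absurd hab (hej a).ne
    · exact absurd hab.symm (hej b).ne
    · rfl
  have hrange' : Set.Iic j.succ ⊆ Set.range e' := by
    intro a ha
    rcases (Set.mem_Iic.1 ha).lt_or_eq with ha | rfl
    · obtain ⟨k, rfl⟩ := hrange a ha
      exact ⟨.inl k, rfl⟩
    · exact ⟨.inr (), rfl⟩
  refine h.inModuleOn he' (fun k => ?_) ((smoothVFOn_iff h.isOpen).2 fun x hx => ?_)
    fun x hx => ?_
  · rcases k with k | k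
    · exact hYe k
    · rfl
  · have : IsManifold 𝓘(ℝ, E) (((⊤ : ℕ∞) : WithTop ℕ∞) + 1) M := .of_le (n := ∞) (by simp)
    have : IsManifold 𝓘(ℝ, E) (minSmoothness ℝ 2) M := .of_le (n := ∞) (by
      rw [minSmoothness_of_isRCLikeNormedField]; exact ENat.LEInfty.out)
    exact ContMDiffAt.mlieBracket_vectorField (n := ⊤) (m := ⊤) (h.smoothVFAt hx _) (hZs x hx)
      (by rw [minSmoothness_of_isRCLikeNormedField]; simp)
  · refine Submodule.span_mono (Set.image_mono hrange') ?_
    -- `Z` is a combination of the generators only on `V`; as `V` is open, the bracket at `x` may be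
    -- computed from that combination.
    rw [Filter.EventuallyEq.mlieBracket_vectorField_eq (Filter.EventuallyEq.refl _ (Y j.succ))
      (hZev x hx)]
    refine mlieBracket_sum_smul_mem _ (hcs x hx) (fun k => h.smoothVFAt hx _)
      (fun k => Submodule.subset_span ⟨e k, (hej k).le, rfl⟩) fun k => ?_
    exact h.bracket_mem hx le_rfl (hej k).le

end Coefficients

/-! ### Triangular families of covectors -/

section Triangular

variable {T : Type*} [AddCommGroup T] [Module ℝ T]

/-- Expand `v` in `y` and solve the triangular system from the top: once the coefficients beyond
`j.succ` vanish, `α j v = 0` kills the one at `j.succ`. The threshold `k` serves both full families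
(`k = 0`) and those of which only the upper part is known. -/
theorem mem_span_of_triangular {N : ℕ} {y : Fin (N + 1) → T}
    (hy : Submodule.span ℝ (Set.range y) = ⊤) {α : Fin N → T →ₗ[ℝ] ℝ} {k : Fin (N + 1)}
    (h0 : ∀ j : Fin N, k < j.succ → ∀ l < j.succ, α j (y l) = 0)
    (h1 : ∀ j : Fin N, k < j.succ → α j (y j.succ) ≠ 0) {v : T}
    (hv : ∀ j : Fin N, k < j.succ → α j v = 0) : v ∈ Submodule.span ℝ (y '' Set.Iic k) := by
  obtain ⟨c, rfl⟩ := (Submodule.mem_span_range_iff_exists_fun ℝ).1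
    (hy ▸ Submodule.mem_top : v ∈ Submodule.span ℝ (Set.range y))
  have hc : ∀ a, k < a → c a = 0 := by
    intro a
    induction a using (wellFounded_gt (α := Fin (N + 1))).induction with
    | _ a ih =>
      intro ha
      obtain ⟨j, rfl⟩ := Fin.exists_succ_eq.2 (Fin.ne_zero_of_lt ha)
      have h := hv j ha
      rw [map_sum, Finset.sum_eq_single j.succ] at h
      · rw [map_smul, smul_eq_mul] at h
        exact (mul_eq_zero.1 h).resolve_right (h1 j ha)
      · intro b _ hb
        rw [map_smul]
        rcases lt_or_gt_of_ne hb with hb | hb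
        · rw [h0 j ha b hb, smul_zero]
        · rw [ih b hb (ha.trans hb), zero_smul]
      · simp
  refine sum_mem fun a _ => ?_
  rcases le_or_gt a k with ha | ha
  · exact Submodule.smul_mem _ _ (Submodule.subset_span ⟨a, ha, rfl⟩)
  · rw [hc a ha, zero_smul]
    exact Submodule.zero_mem _

theorem linearMap_eq_zero_of_mem_span {α : T →ₗ[ℝ] ℝ} {s : Set T} (h : ∀ z ∈ s, α z = 0) {v : T}
    (hv : v ∈ Submodule.span ℝ s) : α v = 0 :=
  (Submodule.span_le (p := LinearMap.ker α)).2 (fun z hz => h z hz) hv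

/-- `c` is a coefficient of `y a` in an expansion of `v` and does not depend on `α`. Two functionals
vanishing below `a` are therefore proportional on the span, which is how wedge products are shown to
vanish. -/
theorem exists_multiple_of_mem_span_Iic {m : ℕ} {y : Fin m → T} {a : Fin m} {v : T}
    (hv : v ∈ Submodule.span ℝ (y '' Set.Iic a)) :
    ∃ c : ℝ, ∀ α : T →ₗ[ℝ] ℝ, (∀ l < a, α (y l) = 0) → α v = c * α (y a) := by
  rw [← Set.Iio_insert, Set.image_insert_eq, Submodule.mem_span_insert] at hv
  obtain ⟨c, z, hz, rfl⟩ := hv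
  refine ⟨c, fun α hα => ?_⟩
  rw [map_add, map_smul, smul_eq_mul, linearMap_eq_zero_of_mem_span _ hz, add_zero]
  rintro _ ⟨l, hl, rfl⟩
  exact hα l hl

variable [TopologicalSpace T] [IsTopologicalAddGroup T] [ContinuousSMul ℝ T]

/-- The linear functional underlying a one-form at a point. -/
def covector (η : T [⋀^Fin 1]→L[ℝ] ℝ) : T →ₗ[ℝ] ℝ := (η.toContinuousLinearMap ![0] 0).toLinearMap

theorem covector_apply (η : T [⋀^Fin 1]→L[ℝ] ℝ) (v : T) : covector η v = η ![v] := by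
  change η (Function.update ![0] 0 v) = _
  congr 1
  ext i
  fin_cases i
  rfl

theorem two_form_eq_zero_of_mem_span {σ : T [⋀^Fin 2]→L[ℝ] ℝ} {s : Set T}
    (h : ∀ a ∈ s, ∀ b ∈ s, σ ![a, b] = 0) {u v : T} (hu : u ∈ Submodule.span ℝ s)
    (hv : v ∈ Submodule.span ℝ s) : σ ![u, v] = 0 := by
  have e1 : ∀ a b : T, (σ.toContinuousLinearMap ![a, 0] 1).toLinearMap b = σ ![a, b] := by
    intro a b
    change σ (Function.update ![a, 0] 1 b) = _
    congr 1
    ext i; fin_cases i <;> rfl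
  have e2 : ∀ a b : T, (σ.toContinuousLinearMap ![0, b] 0).toLinearMap a = σ ![a, b] := by
    intro a b
    change σ (Function.update ![0, b] 0 a) = _
    congr 1
    ext i; fin_cases i <;> rfl
  rw [← e2]
  refine linearMap_eq_zero_of_mem_span (fun a ha => ?_) hu
  rw [e2, ← e1]
  exact linearMap_eq_zero_of_mem_span (fun b hb => by rw [e1, h a ha b hb]) hv

end Triangular

/-! ### Pfaffian forms and their solutions in terms of the frame -/

section Pfaff

variable {E : Type*} [NormedAddCommGroup E] [NormedSpace ℝ E] [FiniteDimensional ℝ E]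
  {M : Type*} [TopologicalSpace M] [ChartedSpace E M] [IsManifold 𝓘(ℝ, E) ∞ M]

theorem pfaffForm_apply {N : ℕ} (Ω : DForm E M (N + 1)) (Y : Fin (N + 1) → VField E M)
    (i : Fin (N + 1)) (x : M) (v : TangentSpace 𝓘(ℝ, E) x) :
    pfaffForm Ω Y i x ![v] = Ω x
      (Fin.snoc (α := fun _ => TangentSpace 𝓘(ℝ, E) x) (fun j => Y (i.succAbove j) x) v) := by
  change Ω x (Function.update (Fin.snoc (α := fun _ => TangentSpace 𝓘(ℝ, E) x)
    (fun j => Y (i.succAbove j) x) 0) (Fin.last N) v) = _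
  rw [Fin.update_snoc_last]

theorem pfaffForm_frame_of_ne {N : ℕ} (Ω : DForm E M (N + 1)) (Y : Fin (N + 1) → VField E M)
    {i l : Fin (N + 1)} (hl : l ≠ i) (x : M) : pfaffForm Ω Y i x ![Y l x] = 0 := by
  obtain ⟨j, rfl⟩ := Fin.exists_succAbove_eq hl
  rw [pfaffForm_apply]
  refine (Ω x).map_eq_zero_of_eq _ (i := j.castSucc) (j := Fin.last N) ?_ (Fin.castSucc_ne_last j)
  rw [Fin.snoc_castSucc, Fin.snoc_last]

/-- The arguments of `Ω` are then the whole frame, reordered with `Y i` last. A nonzero form of top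
degree does not vanish on a basis. -/
theorem pfaffForm_frame_self_ne_zero {N : ℕ} {Ω : DForm E M (N + 1)}
    {Y : Fin (N + 1) → VField E M} (i : Fin (N + 1)) {x : M} (hE : Module.finrank ℝ E = N + 1)
    (hY : LinearIndependent ℝ (fun a => Y a x)) (hΩ : Ω x ≠ 0) :
    pfaffForm Ω Y i x ![Y i x] ≠ 0 := by
  rw [pfaffForm_apply]
  let e : Fin (N + 1) → Fin (N + 1) := Fin.snoc (α := fun _ => Fin (N + 1)) i.succAbove i
  have he : Function.Injective e := by
    refine Fin.snoc_injective_iff.2 ⟨Fin.succAbove_right_injective, ?_⟩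
    rintro ⟨j, hj⟩
    exact Fin.succAbove_ne i j hj
  have h1 : (Fin.snoc (α := fun _ => TangentSpace 𝓘(ℝ, E) x) (fun j => Y (i.succAbove j) x)
      (Y i x)) = fun a => Y (e a) x := by
    funext a
    refine Fin.lastCases ?_ (fun j => ?_) a <;> simp [e]
  rw [h1]
  have h2 : LinearIndependent ℝ (fun a => Y (e a) x) := hY.comp e he
  let b := basisOfLinearIndependentOfCardEqFinrank h2
    (by rw [Fintype.card_fin]; exact hE.symm)
  have hb : ⇑b = fun a => Y (e a) x := coe_basisOfLinearIndependentOfCardEqFinrank _ _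
  intro h3
  rw [← hb] at h3
  have h4 := ((Ω x).toAlternatingMap.map_basis_eq_zero_iff b).1 h3
  exact hΩ (ContinuousAlternatingMap.toAlternatingMap_injective h4)

theorem formInChart_pfaffForm {N : ℕ} (Ω : DForm E M (N + 1)) (Y : Fin (N + 1) → VField E M)
    (i : Fin (N + 1)) {x₀ : M} {y : E} (hy : y ∈ (extChartAt 𝓘(ℝ, E) x₀).target) (v : Fin 1 → E) :
    formInChart (pfaffForm Ω Y i) x₀ y v = formInChart Ω x₀ y (fun a =>
      Fin.snoc (α := fun _ => E) (fun j => vfInChart (Y (i.succAbove j)) x₀ y) (v 0) a) := by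
  rw [formInChart_apply, vec_one fun i => chartSymmDeriv x₀ y (v i), pfaffForm_apply,
    formInChart_apply]
  congr 1
  funext a
  refine Fin.lastCases ?_ (fun j => ?_) a
  · simp
  · simp only [Fin.snoc_castSucc, chartSymmDeriv_vfInChart hy]

variable {N : ℕ} {V : Set M} {Y : Fin (N + 1) → VField E M} {Ω : DForm E M (N + 1)}

theorem smoothFormOn_pfaffForm (hV : IsOpen V) (hY : ∀ a, SmoothVFOn V (Y a))
    (hΩ : SmoothFormOn V Ω) (i : Fin (N + 1)) : SmoothFormOn V (pfaffForm Ω Y i) := by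
  refine (smoothFormOn_iff hV).2 fun x₀ y hy hyV => contDiffAt_form_of_apply fun v => ?_
  have h1 : ContDiffAt ℝ ∞ (fun z => formInChart Ω x₀ z (fun a =>
      Fin.snoc (α := fun _ => E → E) (fun j z => vfInChart (Y (i.succAbove j)) x₀ z)
        (fun _ => v 0) a z)) y := by
    refine contDiffAt_form_apply (hΩ.contDiffAt hV hy hyV) fun a => ?_
    refine Fin.lastCases ?_ (fun j => ?_) a
    · simpa using contDiffAt_const
    · simpa using (hY _).contDiffAt hV hy hyV
  refine h1.congr_of_eventuallyEq ?_
  filter_upwards [(isOpen_extChartAt_target x₀).mem_nhds hy] with z hz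
  rw [formInChart_pfaffForm Ω Y i hz]
  congr 1
  funext a
  refine Fin.lastCases ?_ (fun j => ?_) a <;> simp

variable (h : TriangularFrame V Y) (hΩ : SmoothFormOn V Ω) (hΩ0 : ∀ x ∈ V, Ω x ≠ 0)
include h

theorem TriangularFrame.span_eq_top {x : M} (hx : x ∈ V) :
    Submodule.span ℝ (Set.range fun a => Y a x) = ⊤ :=
  span_range_eq_top h.finrank_eq (h.independent x hx)

include hΩ0

theorem TriangularFrame.pfaffForm_ne_zero {x : M} (hx : x ∈ V) (i : Fin (N + 1)) :
    pfaffForm Ω Y i x ![Y i x] ≠ 0 :=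
  pfaffForm_frame_self_ne_zero i h.finrank_eq (h.independent x hx) (hΩ0 x hx)

theorem TriangularFrame.mem_span_of_pfaffForm {x : M} (hx : x ∈ V) {k : Fin (N + 1)}
    {v : TangentSpace 𝓘(ℝ, E) x}
    (hv : ∀ j : Fin N, k < j.succ → pfaffForm Ω Y j.succ x ![v] = 0) :
    v ∈ Submodule.span ℝ ((fun a => Y a x) '' Set.Iic k) := by
  refine mem_span_of_triangular (α := fun j => covector (pfaffForm Ω Y j.succ x))
    (h.span_eq_top hx) ?_ ?_ ?_
  · intro j _ l hl
    rw [covector_apply, pfaffForm_frame_of_ne Ω Y hl.ne]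
  · intro j _
    rw [covector_apply]
    exact h.pfaffForm_ne_zero hΩ0 hx _
  · intro j hj
    rw [covector_apply, hv j hj]

theorem TriangularFrame.pfaffForm_annihilator {x : M} (hx : x ∈ V) (v : TangentSpace 𝓘(ℝ, E) x) :
    (∀ i : Fin N, pfaffForm Ω Y i.succ x ![v] = 0) ↔ v ∈ Submodule.span ℝ {Y 0 x} := by
  refine ⟨fun hv => ?_, fun hv i => ?_⟩
  · have h1 := h.mem_span_of_pfaffForm hΩ0 hx (k := 0) fun j _ => hv j
    have h2 : Set.Iic (0 : Fin (N + 1)) = {0} := by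
      ext a
      simp
    rwa [h2, Set.image_singleton] at h1
  · rw [← covector_apply]
    refine linearMap_eq_zero_of_mem_span (fun z hz => ?_) hv
    rw [Set.mem_singleton_iff.1 hz, covector_apply,
      pfaffForm_frame_of_ne Ω Y (Fin.succ_ne_zero i).symm]

include hΩ in
-- Independence is seen by evaluating on the frame. The common kernel of the forms from the `i`-th
-- on is spanned by the frame members up to `i.castSucc`. On these the `i`-th form vanishes
-- identically, so Cartan's formula leaves only its value on their brackets, which stay in that
-- span.
theorem TriangularFrame.completelyIntegrableOn :
    CompletelyIntegrableOn V (fun i : Fin N => pfaffForm Ω Y i.succ) := by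
  have hs : ∀ i : Fin N, SmoothFormOn V (pfaffForm Ω Y i.succ) := fun i =>
    smoothFormOn_pfaffForm h.isOpen h.smooth hΩ _
  refine ⟨hs, fun x hx => ?_, fun i x hx u v hu hiu hv hiv => ?_⟩
  · rw [Fintype.linearIndependent_iff]
    intro g hg i
    have h1 := congrArg (fun σ : (TangentSpace 𝓘(ℝ, E) x) [⋀^Fin 1]→L[ℝ] ℝ => σ ![Y i.succ x]) hg
    simp only [ContinuousAlternatingMap.sum_apply, ContinuousAlternatingMap.smul_apply] at h1
    change _ = (0 : ℝ) at h1
    rw [Finset.sum_eq_single i] at h1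
    · exact (mul_eq_zero.1 h1).resolve_right (h.pfaffForm_ne_zero hΩ0 hx _)
    · intro j _ hj
      rw [pfaffForm_frame_of_ne Ω Y (by simpa using hj.symm), smul_zero]
    · simp
  · have hmem : ∀ u : TangentSpace 𝓘(ℝ, E) x, KerAbove (fun i : Fin N => pfaffForm Ω Y i.succ) i x u →
        pfaffForm Ω Y i.succ x ![u] = 0 →
        u ∈ Submodule.span ℝ ((fun a => Y a x) '' Set.Iic i.castSucc) := by
      intro u hu hiu
      refine h.mem_span_of_pfaffForm hΩ0 hx fun j hj => ?_
      rcases (Fin.castSucc_lt_succ_iff.1 hj).lt_or_eq with hj | rfl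
      · exact hu j hj
      · exact hiu
    refine two_form_eq_zero_of_mem_span ?_ (hmem u hu hiu) (hmem v hv hiv)
    rintro _ ⟨a, ha, rfl⟩ _ ⟨b, hb, rfl⟩
    have hlt : ∀ c ∈ Set.Iic i.castSucc, c ≠ i.succ := fun c hc =>
      (lt_of_le_of_lt hc (Fin.castSucc_lt_succ)).ne
    have hzero : ∀ c ∈ Set.Iic i.castSucc,
        dfun (E := E) (fun x => pfaffForm Ω Y i.succ x ![Y c x]) x = 0 := fun c hc => by
      have : (fun x => pfaffForm Ω Y i.succ x ![Y c x]) = fun _ => 0 :=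
        funext fun z => pfaffForm_frame_of_ne Ω Y (hlt c hc) z
      rw [this]
      exact mfderiv_const
    rw [dForm_one_apply ⟨V, h.isOpen, hx, hs i⟩ (h.smoothVFAt hx a) (h.smoothVFAt hx b),
      hzero a ha, hzero b hb, ← covector_apply (pfaffForm Ω Y i.succ x)]
    have h1 : covector (pfaffForm Ω Y i.succ x)
        (VectorField.mlieBracket 𝓘(ℝ, E) (Y a) (Y b) x) = 0 := by
      refine linearMap_eq_zero_of_mem_span ?_ (h.bracket_mem hx ha hb)
      rintro _ ⟨c, hc, rfl⟩
      rw [covector_apply, pfaffForm_frame_of_ne Ω Y (hlt c hc)]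
    rw [h1]
    simp

/-- Solutions of the Pfaffian equations with index above `i` are triangular with respect to the
frame. -/
theorem TriangularFrame.dfun_of_solves {W : Set M} (hWV : W ⊆ V) {I : Fin N → M → ℝ} {i : Fin N}
    (hI : ∀ j, i ≤ j → SolvesPfaffOn W (fun i : Fin N => pfaffForm Ω Y i.succ) I j) {x : M}
    (hx : x ∈ W) :
    (∀ l < i.succ, dfun (I i) x (Y l x) = 0) ∧ dfun (I i) x (Y i.succ x) ≠ 0 := by
  -- Downward induction: triangularity of the later solutions identifies the tangent space of their
  -- common level set with the span of the frame members up to `i.succ`.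
  induction i using (wellFounded_gt (α := Fin N)).induction with
  | _ i ih =>
    have ih' := fun j (hj : i < j) => ih j hj fun j' hj' => hI j' (hj.le.trans hj')
    have hker : ∀ u : TangentSpace 𝓘(ℝ, E) x, (∀ j, i < j → dfun (I j) x u = 0) →
        u ∈ Submodule.span ℝ ((fun a => Y a x) '' Set.Iic i.succ) := fun u hu =>
      mem_span_of_triangular (α := fun j => (dfun (E := E) (I j) x).toLinearMap)
        (h.span_eq_top (hWV hx)) (fun j hj => (ih' j (Fin.succ_lt_succ_iff.1 hj)).1)
        (fun j hj => (ih' j (Fin.succ_lt_succ_iff.1 hj)).2)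
        fun j hj => hu j (Fin.succ_lt_succ_iff.1 hj)
    have hY : ∀ l ≤ i.succ, ∀ j, i < j → dfun (I j) x (Y l x) = 0 := fun l hl j hj =>
      (ih' j hj).1 l (hl.trans_lt (Fin.succ_lt_succ_iff.2 hj))
    have h0 : ∀ l < i.succ, dfun (I i) x (Y l x) = 0 := by
      intro l hl
      -- In the wedge equation on `Y i.succ` and `Y l` one term drops out, since the form kills `Y
      -- l`. The other has a nonzero factor, the form on `Y i.succ`.
      have h1 := (hI i le_rfl).wedge_eq_zero x hx (Y i.succ x) (Y l x) (hY _ le_rfl) (hY l hl.le)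
      simp only [pfaffForm_frame_of_ne Ω Y hl.ne, zero_mul, sub_zero] at h1
      exact (mul_eq_zero.1 h1).resolve_left (h.pfaffForm_ne_zero hΩ0 (hWV hx) _)
    refine ⟨h0, fun h1 => ?_⟩
    -- If `dI_i` also killed `Y i.succ`, it would vanish on the whole tangent space of the level
    -- set, against regularity.
    obtain ⟨u, hu, hu'⟩ := (hI i le_rfl).regular x hx
    refine hu' (linearMap_eq_zero_of_mem_span (α := (dfun (E := E) (I i) x).toLinearMap) ?_
      (hker u hu))
    rintro _ ⟨l, hl, rfl⟩
    rcases (Set.mem_Iic.1 hl).lt_or_eq with hl | rfl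
    · exact h0 l hl
    · exact h1

/-- A function that is triangular with respect to the frame solves its Pfaffian equation. -/
theorem TriangularFrame.solves_of_dfun {W : Set M} (hWV : W ⊆ V) {I : Fin N → M → ℝ} {i : Fin N}
    (hI : ∀ j, i < j → SolvesPfaffOn W (fun i : Fin N => pfaffForm Ω Y i.succ) I j)
    (hs : SmoothFunOn (E := E) W (I i))
    (h0 : ∀ x ∈ W, ∀ l < i.succ, dfun (I i) x (Y l x) = 0)
    (h1 : ∀ x ∈ W, dfun (I i) x (Y i.succ x) ≠ 0) :
    SolvesPfaffOn W (fun i : Fin N => pfaffForm Ω Y i.succ) I i := by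
  have hI' := fun x (hx : x ∈ W) j (hj : i < j) => h.dfun_of_solves hΩ0 hWV
    (fun j' (hj' : j ≤ j') => hI j' (hj.trans_le hj')) hx
  refine ⟨hs, fun x hx u v hu hv => ?_, fun x hx => ⟨Y i.succ x, fun j hj => ?_, h1 x hx⟩⟩
  · have hker : ∀ u : TangentSpace 𝓘(ℝ, E) x, (∀ j, i < j → dfun (I j) x u = 0) →
        u ∈ Submodule.span ℝ ((fun a => Y a x) '' Set.Iic i.succ) := fun u hu =>
      mem_span_of_triangular (α := fun j => (dfun (E := E) (I j) x).toLinearMap)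
        (h.span_eq_top (hWV hx)) (fun j hj => (hI' x hx j (Fin.succ_lt_succ_iff.1 hj)).1)
        (fun j hj => (hI' x hx j (Fin.succ_lt_succ_iff.1 hj)).2)
        fun j hj => hu j (Fin.succ_lt_succ_iff.1 hj)
    -- The form and `dI_i` both kill the members below `i.succ`, so on the kernel each is a multiple
    -- of the same coordinate and their wedge vanishes.
    obtain ⟨c, hc⟩ := exists_multiple_of_mem_span_Iic (hker u hu)
    obtain ⟨d, hd⟩ := exists_multiple_of_mem_span_Iic (hker v hv)
    have e1 : ∀ l < i.succ, covector (pfaffForm Ω Y i.succ x) (Y l x) = 0 := fun l hl => by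
      rw [covector_apply, pfaffForm_frame_of_ne Ω Y hl.ne]
    have e2 : ∀ l < i.succ, (dfun (E := E) (I i) x).toLinearMap (Y l x) = 0 := h0 x hx
    have c1 := hc _ e1
    have c2 := hc _ e2
    have d1 := hd _ e1
    have d2 := hd _ e2
    rw [covector_apply, covector_apply] at c1 d1
    simp only [ContinuousLinearMap.coe_coe] at c2 d2
    rw [c1, c2, d1, d2]
    ring
  · exact (hI' x hx j hj).1 _ (Fin.succ_lt_succ_iff.2 hj)

end Pfaff

/-! ### Local solutions of the Pfaffian equations -/

section Step

variable {E : Type*} [NormedAddCommGroup E] [NormedSpace ℝ E] [FiniteDimensional ℝ E]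
  {M : Type*} [TopologicalSpace M] [ChartedSpace E M] [IsManifold 𝓘(ℝ, E) ∞ M]

theorem vfInChart_mem_span {κ : Type*} {Y : κ → VField E M} {Z : VField E M} {x₀ : M} {y : E}
    {s : Set κ} (h : Z ((extChartAt 𝓘(ℝ, E) x₀).symm y) ∈
      Submodule.span ℝ ((fun a => Y a ((extChartAt 𝓘(ℝ, E) x₀).symm y)) '' s)) :
    vfInChart Z x₀ y ∈ Submodule.span ℝ ((fun a => vfInChart (Y a) x₀ y) '' s) := by
  have h1 := Submodule.mem_map_of_mem (f := (chartSymmDeriv x₀ y).inverse.toLinearMap) h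
  rw [Submodule.map_span, Set.image_image] at h1
  exact h1

variable {N : ℕ} {V : Set M} {Y : Fin (N + 1) → VField E M} {Ω : DForm E M (N + 1)}

/-- Near every point there is a function that is triangular with respect to the frame. -/
theorem TriangularFrame.exists_triangular_function (h : TriangularFrame V Y) {W : Set M}
    (hW : IsOpen W) (hWV : W ⊆ V) (i : Fin N) {p : M} (hp : p ∈ W) :
    ∃ W' : Set M, IsOpen W' ∧ W' ⊆ W ∧ p ∈ W' ∧ ∃ g : M → ℝ, SmoothFunOn (E := E) W' g ∧
      ∀ x ∈ W', (∀ l < i.succ, dfun g x (Y l x) = 0) ∧ dfun g x (Y i.succ x) ≠ 0 := by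
  have hps := mem_extChartAt_source (I := 𝓘(ℝ, E)) p
  have hpt := (extChartAt 𝓘(ℝ, E) p).map_source hps
  have hl := (extChartAt 𝓘(ℝ, E) p).left_inv hps
  have hev : ∀ᶠ y in 𝓝 (extChartAt 𝓘(ℝ, E) p p), y ∈ (extChartAt 𝓘(ℝ, E) p).target ∧
      (extChartAt 𝓘(ℝ, E) p).symm y ∈ V :=
    eventually_mem_chart h.isOpen hpt (by rw [hl]; exact hWV hp)
  have hYs : ∀ᶠ y in 𝓝 (extChartAt 𝓘(ℝ, E) p p), ∀ a, ContDiffAt ℝ ∞ (vfInChart (Y a) p) y :=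
    hev.mono fun y hy a => (h.smooth a).contDiffAt h.isOpen hy.1 hy.2
  -- The members up to `i.castSucc` are in involution, and `i.succ` is the next index. The
  -- derivative along `Y i.succ` is `1` at the base point only, so it is nonzero merely nearby.
  obtain ⟨g, hg, hg0, hg1⟩ := exists_first_integral (Y := fun a => vfInChart (Y a) p)
    (S := Set.Iic i.castSucc) (b := i.succ) hYs
    (h.isInvertible_inChart hpt (by rw [hl]; exact hWV hp))
    (hev.mono fun y hy a ha b hb => by
      rw [← vfInChart_mlieBracket hy.1 (h.smoothVFAt hy.2 a) (h.smoothVFAt hy.2 b)]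
      exact vfInChart_mem_span (h.bracket_mem hy.2 ha hb))
    (fun hb => absurd (Set.mem_Iic.1 hb) (not_le.2 Fin.castSucc_lt_succ))
  have hne : ∀ᶠ y in 𝓝 (extChartAt 𝓘(ℝ, E) p p), fderiv ℝ g y (vfInChart (Y i.succ) p y) ≠ 0 := by
    have h1 := hg.self_of_nhds.fderiv_right (m := 0) (by simp)
    have h2 := h1.continuousAt.clm_apply (hYs.self_of_nhds i.succ).continuousAt
    refine h2.eventually_ne ?_
    rw [hg1]
    exact one_ne_zero
  obtain ⟨W', hW', hW'o, hpW'⟩ := eventually_nhds_iff.1 ((eventually_of_chart hps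
    (hg.and (hg0.and hne))).and (hW.mem_nhds hp))
  have hc : ∀ z ∈ W', funInChart (fun x => g (extChartAt 𝓘(ℝ, E) p x)) p
      =ᶠ[𝓝 (extChartAt 𝓘(ℝ, E) p z)] g := fun z hz => by
    filter_upwards [eventually_target (hW' z hz).1.1] with y hy
    exact congrArg g ((extChartAt 𝓘(ℝ, E) p).right_inv hy)
  have hs : ∀ z ∈ W', SmoothFunAt (E := E) (fun x => g (extChartAt 𝓘(ℝ, E) p x)) z := fun z hz =>
    (smoothFunAt_iff (hW' z hz).1.1).2 ((hW' z hz).1.2.1.congr_of_eventuallyEq (hc z hz))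
  refine ⟨W', hW'o, fun z hz => (hW' z hz).2, hpW', fun x => g (extChartAt 𝓘(ℝ, E) p x),
    (smoothFunOn_iff hW'o).2 hs, fun z hz => ⟨fun l hl => ?_, ?_⟩⟩
  · rw [dfun_vfield_eq (hW' z hz).1.1 (hs z hz), (hc z hz).fderiv_eq]
    exact (hW' z hz).1.2.2.1 l (Fin.le_castSucc_iff.2 hl)
  · rw [dfun_vfield_eq (hW' z hz).1.1 (hs z hz), (hc z hz).fderiv_eq]
    exact (hW' z hz).1.2.2.2

theorem SolvesPfaffOn.mono {r : ℕ} {W W' : Set M} {η : Fin r → DForm E M 1} {I : Fin r → M → ℝ}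
    {i : Fin r} (h : SolvesPfaffOn W η I i) (hW : W' ⊆ W) : SolvesPfaffOn W' η I i :=
  ⟨ContMDiffOn.mono h.smooth hW, fun x hx => h.wedge_eq_zero x (hW hx),
    fun x hx => h.regular x (hW hx)⟩

/-- The `i`-th condition involves only the functions of index at least `i`, so changing an earlier
entry keeps later solutions valid. -/
theorem SolvesPfaffOn.congr {r : ℕ} {W : Set M} {η : Fin r → DForm E M 1} {I I' : Fin r → M → ℝ}
    {i : Fin r} (h : SolvesPfaffOn W η I i) (hI : ∀ j, i ≤ j → I' j = I j) :
    SolvesPfaffOn W η I' i := by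
  have e1 := hI i le_rfl
  have e2 : ∀ (x : M) (u : TangentSpace 𝓘(ℝ, E) x),
      (∀ j, i < j → dfun (I' j) x u = 0) ↔ ∀ j, i < j → dfun (I j) x u = 0 := fun x u =>
    forall₂_congr fun j hj => by rw [hI j hj.le]
  exact ⟨e1 ▸ h.smooth, fun x hx u v hu hv =>
    e1 ▸ h.wedge_eq_zero x hx u v ((e2 x u).1 hu) ((e2 x v).1 hv), fun x hx => by
      obtain ⟨u, hu, hu'⟩ := h.regular x hx
      exact ⟨u, (e2 x u).2 hu, e1 ▸ hu'⟩⟩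

/-- The triangular function is found on `M` without reference to the `I j`, so the same one works
whatever solutions of the preceding equations were chosen. -/
theorem TriangularFrame.exists_solution (h : TriangularFrame V Y) (hΩ0 : ∀ x ∈ V, Ω x ≠ 0)
    (i : Fin N) {W : Set M} (hW : IsOpen W) (hWV : W ⊆ V) {I : Fin N → M → ℝ}
    (hI : ∀ j, i < j → SolvesPfaffOn W (fun i : Fin N => pfaffForm Ω Y i.succ) I j) {p : M}
    (hp : p ∈ W) :
    ∃ W' : Set M, IsOpen W' ∧ W' ⊆ W ∧ p ∈ W' ∧ ∃ g : M → ℝ,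
      SolvesPfaffOn W' (fun i : Fin N => pfaffForm Ω Y i.succ) (Function.update I i g) i := by
  obtain ⟨W', hW', hW'W, hpW', g, hg, hg'⟩ := h.exists_triangular_function hW hWV i hp
  refine ⟨W', hW', hW'W, hpW', g, h.solves_of_dfun hΩ0 (hW'W.trans hWV) (fun j hj => ?_) ?_ ?_ ?_⟩
  · refine ((hI j hj).mono hW'W).congr fun j' hj' => ?_
    exact Function.update_of_ne (hj.trans_le hj').ne' _ _
  · rwa [Function.update_self]
  · rw [Function.update_self]
    exact fun x hx => (hg' x hx).1
  · rw [Function.update_self]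
    exact fun x hx => (hg' x hx).2

end Step

/-! ### Common level sets of first integrals -/

/-- Solutions of the autonomous scalar equation `T' = a(T)` with `a > 0` sweep out intervals. -/
theorem exists_time_change {a : ℝ → ℝ} {l u t₀ : ℝ} (ht : t₀ ∈ Set.Ioo l u)
    (ha : ContinuousOn a (Set.Icc l u)) (hpos : ∀ t ∈ Set.Icc l u, a t ∈ Set.Ioo (1 / 2) 2) :
    ∃ (T : ℝ → ℝ) (α β : ℝ), α < 0 ∧ 0 < β ∧ T 0 = t₀ ∧
      (∀ s ∈ Set.Ioo α β, HasDerivAt T (a (T s)) s) ∧ T '' Set.Ioo α β = Set.Ioo l u := by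
  have hlu : l ≤ u := (ht.1.trans ht.2).le
  -- Separation of variables: elapsed time is `S = ∫ dt / a`, and `T` is the inverse of `S`.
  -- Clamping to `[l, u]` makes the integrand continuous on the whole line.
  let r : ℝ → ℝ := fun t => (a (Set.projIcc l u hlu t))⁻¹
  have hrpos : ∀ t, 1 / 2 < r t := fun t => by
    have h := hpos _ (Set.projIcc l u hlu t).2
    rw [one_div]
    exact inv_strictAnti₀ ((by norm_num : (0 : ℝ) < 1 / 2).trans h.1) h.2
  have hrc : Continuous r := by
    refine Continuous.inv₀ ?_ fun t => ?_
    · exact ha.comp_continuous (continuous_subtype_val.comp continuous_projIcc) fun t =>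
        (Set.projIcc l u hlu t).2
    · exact (lt_trans (by norm_num) (hpos _ (Set.projIcc l u hlu t).2).1).ne'
  let S : ℝ → ℝ := fun t => ∫ s in t₀..t, r s
  have hS : ∀ t, HasDerivAt S (r t) t := fun t => hrc.integral_hasStrictDerivAt t₀ t |>.hasDerivAt
  have hS0 : S t₀ = 0 := intervalIntegral.integral_same
  have hmono : StrictMono S := strictMono_of_deriv_pos fun t => by
    rw [(hS t).deriv]
    exact lt_trans (by norm_num) (hrpos t)
  have hcont : Continuous S := continuous_iff_continuousAt.2 fun t => (hS t).continuousAt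
  -- From `a < 2` the slope of `S` exceeds `1 / 2`, so `S` grows at least linearly in both
  -- directions and is onto.
  have hm : Monotone fun t => S t - 1 / 2 * t := by
    have hd : ∀ t, HasDerivAt (fun t => S t - 1 / 2 * t) (r t - 1 / 2) t := fun t => by
      simpa only [mul_one] using (hS t).fun_sub ((hasDerivAt_id' t).const_mul (1 / 2))
    refine monotone_of_deriv_nonneg (fun t => (hd t).differentiableAt) fun t => ?_
    rw [(hd t).deriv]
    exact sub_nonneg.2 (hrpos t).le
  have hsurj : Function.Surjective S := by
    refine hcont.surjective ?_ ?_
    · refine Filter.tendsto_atTop_mono' _ (f₁ := fun t => 1 / 2 * t + (S 0 - 1 / 2 * 0)) ?_ ?_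
      · filter_upwards [Filter.eventually_ge_atTop 0] with t ht
        have := hm ht
        simp only at this
        linarith
      · exact Filter.tendsto_atTop_add_const_right _ _
          (Filter.tendsto_id.const_mul_atTop (by norm_num))
    · refine Filter.tendsto_atBot_mono' _ (f₁ := fun t => 1 / 2 * t + (S 0 - 1 / 2 * 0)) ?_ ?_
      · filter_upwards [Filter.eventually_le_atBot 0] with t ht
        have := hm ht
        simp only at this
        linarith
      · exact Filter.tendsto_atBot_add_const_right _ _
          (Filter.tendsto_id.const_mul_atBot (by norm_num))
  let o : ℝ ≃o ℝ := StrictMono.orderIsoOfSurjective S hmono hsurj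
  have ho : ∀ t, o t = S t := fun t => rfl
  have hSo : ∀ s, S (o.symm s) = s := o.apply_symm_apply
  refine ⟨o.symm, S l, S u, ?_, ?_, ?_, fun s hs => ?_, ?_⟩
  · rw [← hS0]; exact hmono ht.1
  · rw [← hS0]; exact hmono ht.2
  · rw [← hS0, ← ho, o.symm_apply_apply]
  · have h1 : o.symm s ∈ Set.Icc l u := by
      constructor
      · exact (o.le_symm_apply).2 hs.1.le
      · exact (o.symm_apply_le).2 hs.2.le
    have h2 := HasDerivAt.of_local_left_inverse (o.symm.continuous.continuousAt (x := s))
      (hS (o.symm s)) (lt_trans (by norm_num) (hrpos _)).ne' (.of_forall hSo)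
    simp only [r, inv_inv, Set.projIcc_of_mem hlu h1] at h2
    exact h2
  · rw [← ho, ← ho, o.symm.image_Ioo, o.symm_apply_apply, o.symm_apply_apply]

/-- Common level sets of a maximal family of independent first integrals are locally integral
curves. -/
theorem exists_orbit_box {E : Type*} [NormedAddCommGroup E] [NormedSpace ℝ E]
    [FiniteDimensional ℝ E] {N : ℕ} (hE : Module.finrank ℝ E = N + 1) {X : E → E}
    {J : Fin N → E → ℝ} {p : E} (hX : ∀ᶠ x in 𝓝 p, ContinuousAt X x)
    (hJ : ∀ᶠ x in 𝓝 p, ∀ i, ContDiffAt ℝ ∞ (J i) x)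
    (hJX : ∀ᶠ x in 𝓝 p, ∀ i, fderiv ℝ (J i) x (X x) = 0) (hX0 : X p ≠ 0)
    (hker : ∀ v, (∀ i, fderiv ℝ (J i) p v = 0) → v ∈ Submodule.span ℝ {X p})
    {O : Set E} (hO : O ∈ 𝓝 p) :
    ∃ O' : Set E, IsOpen O' ∧ O' ⊆ O ∧ p ∈ O' ∧ ∀ q ∈ O', ∃ (γ : ℝ → E) (α β : ℝ),
      α < 0 ∧ 0 < β ∧ γ 0 = q ∧ (∀ t ∈ Set.Ioo α β, HasDerivAt γ (X (γ t)) t) ∧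
      γ '' Set.Ioo α β = {y ∈ O' | ∀ i, J i y = J i q} := by
  -- The common kernel of the `dJ_i` at `p` is the line of `X p`. A linear functional equal to `1`
  -- on `X p` thus completes the first integrals to local coordinates.
  obtain ⟨τ, hτ⟩ := SeparatingDual.exists_eq_one (R := ℝ) hX0
  let f : E → (Fin N → ℝ) × ℝ := fun x => (fun i => J i x, τ x)
  let f' : E → E →L[ℝ] (Fin N → ℝ) × ℝ := fun x =>
    (ContinuousLinearMap.pi fun i => fderiv ℝ (J i) x).prod τ
  have hf' : ∀ x, (∀ i, ContDiffAt ℝ ∞ (J i) x) → HasFDerivAt f (f' x) x := fun x hx =>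
    (hasFDerivAt_pi.2 fun i => ((hx i).differentiableAt (by simp)).hasFDerivAt).prodMk
      τ.hasFDerivAt
  have hf : ∀ᶠ x in 𝓝 p, ContDiffAt ℝ ∞ f x := hJ.mono fun x hx =>
    (contDiffAt_pi.2 hx).prodMk τ.contDiff.contDiffAt
  have hinj : Function.Injective (f' p).toLinearMap := by
    refine (injective_iff_map_eq_zero _).2 fun v hv => ?_
    have hv1 : (fun i => fderiv ℝ (J i) p v) = 0 := congrArg Prod.fst hv
    have hv2 : τ v = 0 := congrArg Prod.snd hv
    obtain ⟨c, rfl⟩ := Submodule.mem_span_singleton.1 (hker v fun i => congrFun hv1 i)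
    rw [map_smul, hτ, smul_eq_mul, mul_one] at hv2
    rw [hv2, zero_smul]
  let A : E ≃L[ℝ] (Fin N → ℝ) × ℝ := (LinearEquiv.ofInjectiveOfFinrankEq (f' p).toLinearMap hinj
    (by rw [hE, Module.finrank_prod, Module.finrank_fin_fun, Module.finrank_self])
      ).toContinuousLinearEquiv
  have hA : HasFDerivAt f (A : E →L[ℝ] (Fin N → ℝ) × ℝ) p := by
    have h1 : (A : E →L[ℝ] (Fin N → ℝ) × ℝ) = f' p := by
      ext v : 1
      rfl
    rw [h1]
    exact hf' p hJ.self_of_nhds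
  obtain ⟨e, hpe, hef, he, hesymm⟩ := exists_smooth_openPartialHomeomorph hf A hA
  have hτX : ∀ᶠ x in 𝓝 p, τ (X x) ∈ Set.Ioo (1 / 2) 2 :=
    (τ.continuous.continuousAt.comp hX.self_of_nhds).eventually_mem
      (Ioo_mem_nhds (by simp only [Function.comp_apply, hτ]; norm_num)
        (by simp only [Function.comp_apply, hτ]; norm_num))
  obtain ⟨G, hG, hGo, hpG⟩ := eventually_nhds_iff.1
    (hX.and (hJ.and (hJX.and (hτX.and hO))))
  have hD : e.target ∩ e.symm ⁻¹' G ∈ 𝓝 (e p) :=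
    (e.symm.isOpen_inter_preimage hGo).mem_nhds
      ⟨e.map_source hpe, by rw [Set.mem_preimage, e.left_inv hpe]; exact hpG⟩
  -- Balls of the product norm are products, so a level set in the box is `{c}` times an interval.
  -- The closed ball keeps the endpoints in the domain, as `exists_time_change` requires.
  obtain ⟨ε, hε, hεD⟩ := Metric.nhds_basis_closedBall.mem_iff.1 hD
  have hmem : ∀ {c : Fin N → ℝ} {t : ℝ}, c ∈ Metric.ball (e p).1 ε →
      t ∈ Set.Icc ((e p).2 - ε) ((e p).2 + ε) → (c, t) ∈ e.target ∧ e.symm (c, t) ∈ G := by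
    intro c t hc ht
    refine hεD ?_
    rw [← closedBall_prod_same, Real.closedBall_eq_Icc]
    exact ⟨Metric.ball_subset_closedBall hc, ht⟩
  refine ⟨e.source ∩ e ⁻¹' Metric.ball (e p) ε, e.isOpen_inter_preimage Metric.isOpen_ball,
    fun x hx => ?_, ⟨hpe, Metric.mem_ball_self hε⟩, fun q hq => ?_⟩
  · have h1 := (hεD (Metric.ball_subset_closedBall hx.2)).2
    rw [Set.mem_preimage, e.left_inv hx.1] at h1
    exact (hG x h1).2.2.2.2
  obtain ⟨hqs, hqb⟩ := hq
  rw [Set.mem_preimage, ← ball_prod_same, Real.ball_eq_Ioo] at hqb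
  obtain ⟨hqc, hqt⟩ := hqb
  set c : Fin N → ℝ := (e q).1 with hc
  have hy : ∀ t ∈ Set.Icc ((e p).2 - ε) ((e p).2 + ε), (c, t) ∈ e.target ∧ e.symm (c, t) ∈ G :=
    fun t ht => hmem hqc ht
  have hpair : ∀ t : ℝ, HasDerivAt (fun t => (c, t)) ((0 : Fin N → ℝ), (1 : ℝ)) t := fun t =>
    (hasDerivAt_const t c).prodMk (hasDerivAt_id t)
  -- The derivative of the coordinate map sends both the velocity and `X / τ(X)` to `(0, 1)`,
  -- because the `J_i` are first integrals; it is injective.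
  have hyd : ∀ t ∈ Set.Icc ((e p).2 - ε) ((e p).2 + ε), HasDerivAt (fun t => e.symm (c, t))
      ((τ (X (e.symm (c, t))))⁻¹ • X (e.symm (c, t))) t := by
    intro t ht
    obtain ⟨htar, hGt⟩ := hy t ht
    have hg := hG _ hGt
    have h1 : DifferentiableAt ℝ (fun t => e.symm (c, t)) t :=
      ((hesymm _ htar).differentiableAt (by simp)).comp t (hpair t).differentiableAt
    refine h1.hasDerivAt.congr_deriv ?_
    obtain ⟨-, B, hB⟩ := he _ (e.map_target htar)
    have h2 : (B : E →L[ℝ] (Fin N → ℝ) × ℝ) = f' (e.symm (c, t)) := hB.unique (hf' _ hg.2.1)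
    have h3 : HasDerivAt (fun t => f (e.symm (c, t)))
        ((B : E →L[ℝ] (Fin N → ℝ) × ℝ) (deriv (fun t => e.symm (c, t)) t)) t :=
      hB.comp_hasDerivAt t h1.hasDerivAt
    have h4 : (fun t => f (e.symm (c, t))) =ᶠ[𝓝 t] fun t => (c, t) := by
      have h5 : ∀ᶠ s in 𝓝 t, (c, s) ∈ e.target :=
        (hpair t).continuousAt.eventually (e.open_target.mem_nhds htar)
      filter_upwards [h5] with s hs
      rw [← hef]
      exact e.right_inv hs
    have h6 := h3.unique ((hpair t).congr_of_eventuallyEq h4)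
    refine B.injective (h6.trans ?_)
    change _ = (B : E →L[ℝ] (Fin N → ℝ) × ℝ) _
    rw [h2, map_smul]
    have h7 : f' (e.symm (c, t)) (X (e.symm (c, t))) = (0, τ (X (e.symm (c, t)))) :=
      Prod.ext (funext fun i => hg.2.2.1 i) rfl
    rw [h7, Prod.smul_mk, smul_zero, smul_eq_mul,
      inv_mul_cancel₀ (lt_trans (by norm_num) hg.2.2.2.1.1).ne']
  have hqy : e.symm (c, (e q).2) = q := e.left_inv hqs
  -- Running along the segment at speed `τ(X)` turns the velocity `X / τ(X)` into `X`.
  obtain ⟨T, α, β, hα, hβ, hT0, hT, hTi⟩ := exists_time_change (a := fun t =>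
    τ (X (e.symm (c, t)))) hqt (fun t ht => ContinuousAt.continuousWithinAt
      (τ.continuous.continuousAt.comp (ContinuousAt.comp (hG _ (hy t ht).2).1
        (hyd t ht).continuousAt)))
    fun t ht => (hG _ (hy t ht).2).2.2.2.1
  refine ⟨fun s => e.symm (c, T s), α, β, hα, hβ, ?_, fun s hs => ?_, ?_⟩
  · simp only [hT0]
    exact hqy
  · have hTs := Set.Ioo_subset_Icc_self (hTi ▸ Set.mem_image_of_mem T hs)
    have h1 := (hyd (T s) hTs).scomp s (hT s hs)
    refine h1.congr_deriv ?_
    rw [smul_smul, mul_inv_cancel₀ (lt_trans (by norm_num) (hG _ (hy _ hTs).2).2.2.2.1.1).ne',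
      one_smul]
  · have h0 : (fun s => e.symm (c, T s)) '' Set.Ioo α β =
        (fun t => e.symm (c, t)) '' Set.Ioo ((e p).2 - ε) ((e p).2 + ε) := by
      rw [← hTi, Set.image_image]
    have hJe : ∀ y i, J i y = (e y).1 i := fun y i => by rw [hef]
    rw [h0]
    ext y
    constructor
    · rintro ⟨t, ht, rfl⟩
      obtain ⟨htar, -⟩ := hy t (Set.Ioo_subset_Icc_self ht)
      refine ⟨⟨e.map_target htar, ?_⟩, fun i => ?_⟩
      · simp only [Set.mem_preimage]
        rw [e.right_inv htar, ← ball_prod_same, Real.ball_eq_Ioo]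
        exact ⟨hqc, ht⟩
      · rw [hJe, hJe, e.right_inv htar]
    · rintro ⟨⟨hys, hyb⟩, hyJ⟩
      rw [Set.mem_preimage, ← ball_prod_same, Real.ball_eq_Ioo] at hyb
      have h1 : (e y).1 = c := funext fun i => by rw [← hJe, hyJ i, hJe]
      refine ⟨(e y).2, hyb.2, ?_⟩
      simp only
      rw [← h1]
      exact e.left_inv hys

/-! ### Orbits of `X_H` as common level sets on the manifold -/

section Orbits

variable {E : Type*} [NormedAddCommGroup E] [NormedSpace ℝ E] [FiniteDimensional ℝ E]
  {M : Type*} [TopologicalSpace M] [ChartedSpace E M] [IsManifold 𝓘(ℝ, E) ∞ M]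
  {N : ℕ} {V : Set M} {Y : Fin (N + 1) → VField E M} {Ω : DForm E M (N + 1)}

/-- Evaluate a vanishing combination at `y i.succ`: later functionals vanish there, and earlier
coefficients are zero by induction. -/
theorem linearIndependent_of_triangular {T : Type*} [AddCommGroup T] [Module ℝ T]
    [TopologicalSpace T] [IsTopologicalAddGroup T] [ContinuousSMul ℝ T] {y : Fin (N + 1) → T}
    {α : Fin N → T →L[ℝ] ℝ}
    (h0 : ∀ i, ∀ l < i.succ, α i (y l) = 0) (h1 : ∀ i, α i (y i.succ) ≠ 0) :
    LinearIndependent ℝ α := by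
  rw [Fintype.linearIndependent_iff]
  intro g hg i
  induction i using (wellFounded_lt (α := Fin N)).induction with
  | _ i ih =>
    have h := congrArg (fun β : T →L[ℝ] ℝ => β (y i.succ)) hg
    simp only [sum_apply, smul_apply, zero_apply] at h
    rw [Finset.sum_eq_single i] at h
    · exact (mul_eq_zero.1 h).resolve_right (h1 i)
    · intro j _ hj
      rcases lt_or_gt_of_ne hj with hj | hj
      · rw [ih j hj, zero_smul]
      · rw [h0 j _ (Fin.succ_lt_succ_iff.2 hj), smul_zero]
    · simp

theorem hasMFDerivWithinAt_of_inChart {X : VField E M} {x₀ : M} {γ : ℝ → E} {s : Set ℝ} {t : ℝ}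
    (ht : γ t ∈ (extChartAt 𝓘(ℝ, E) x₀).target)
    (h : HasDerivAt γ (vfInChart X x₀ (γ t)) t) :
    HasMFDerivWithinAt 𝓘(ℝ, ℝ) 𝓘(ℝ, E) (fun t => (extChartAt 𝓘(ℝ, E) x₀).symm (γ t)) s t
      ((1 : ℝ →L[ℝ] ℝ).smulRight (X ((extChartAt 𝓘(ℝ, E) x₀).symm (γ t)))) := by
  have h1 : HasMFDerivAt 𝓘(ℝ, E) 𝓘(ℝ, E) (extChartAt 𝓘(ℝ, E) x₀).symm (γ t)
      (chartSymmDeriv x₀ (γ t)) :=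
    ((contMDiffAt_chart_symm ht).mdifferentiableAt (by simp)).hasMFDerivAt
  have h2 := (h1.comp t h.hasFDerivAt.hasMFDerivAt).hasMFDerivWithinAt (s := s)
  refine h2.congr_mfderiv ?_
  ext
  have h3 := chartSymmDeriv_vfInChart ht X
  have h4 : (ContinuousLinearMap.toSpanSingleton ℝ (vfInChart X x₀ (γ t)) : ℝ →L[ℝ] E) 1
      = vfInChart X x₀ (γ t) := by simp
  refine ((congrArg (chartSymmDeriv x₀ (γ t)) h4).trans h3).trans ?_
  exact (one_smul ℝ _).symm

/-- The differentials are triangular with respect to the frame, hence independent, zero on `Y 0`,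
and with common kernel the line of `Y 0`. These are the hypotheses of `exists_orbit_box` in the
chart at `p`; its box, taken inside the coordinate image of `W`, is carried back by the chart. -/
theorem TriangularFrame.orbits (h : TriangularFrame V Y) (hΩ0 : ∀ x ∈ V, Ω x ≠ 0)
    {W : Set M} (hW : IsOpen W) (hWV : W ⊆ V) {I : Fin N → M → ℝ}
    (hI : ∀ i, SolvesPfaffOn W (fun i : Fin N => pfaffForm Ω Y i.succ) I i) :
    (∀ x ∈ W, LinearIndependent ℝ (fun i => dfun (E := E) (I i) x)) ∧
      (∀ x ∈ W, ∀ i, dfun (I i) x (Y 0 x) = 0) ∧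
      ∀ p ∈ W, ∃ W' : Set M, IsOpen W' ∧ W' ⊆ W ∧ p ∈ W' ∧
        ∀ q ∈ W', ∃ (γ : ℝ → M) (a b : ℝ), a < 0 ∧ 0 < b ∧ γ 0 = q ∧
          IsMIntegralCurveOn (I := 𝓘(ℝ, E)) γ (Y 0) (Set.Ioo a b) ∧
          γ '' Set.Ioo a b = {x ∈ W' | ∀ i, I i x = I i q} := by
  have hd : ∀ x ∈ W, ∀ i, (∀ l < i.succ, dfun (I i) x (Y l x) = 0) ∧
      dfun (I i) x (Y i.succ x) ≠ 0 := fun x hx i =>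
    h.dfun_of_solves hΩ0 hWV (fun j _ => hI j) hx
  have hX : ∀ x ∈ W, ∀ i, dfun (I i) x (Y 0 x) = 0 := fun x hx i =>
    (hd x hx i).1 0 (Fin.succ_pos i)
  refine ⟨fun x hx => ?_, hX, fun p hp => ?_⟩
  · exact linearIndependent_of_triangular (y := fun a => Y a x) (fun i => (hd x hx i).1)
      fun i => (hd x hx i).2
  have hIs : ∀ x ∈ W, ∀ i, SmoothFunAt (E := E) (I i) x := fun x hx i =>
    (smoothFunOn_iff hW).1 (hI i).smooth x hx
  have hps := mem_extChartAt_source (I := 𝓘(ℝ, E)) p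
  have hpt := (extChartAt 𝓘(ℝ, E) p).map_source hps
  have hl := (extChartAt 𝓘(ℝ, E) p).left_inv hps
  have hev : ∀ᶠ y in 𝓝 (extChartAt 𝓘(ℝ, E) p p), y ∈ (extChartAt 𝓘(ℝ, E) p).target ∧
      (extChartAt 𝓘(ℝ, E) p).symm y ∈ W :=
    eventually_mem_chart hW hpt (by rwa [hl])
  obtain ⟨O', hO', hO'O, hpO', horb⟩ := exists_orbit_box h.finrank_eq
    (X := vfInChart (Y 0) p) (J := fun i => funInChart (I i) p) (p := extChartAt 𝓘(ℝ, E) p p)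
    (hev.mono fun y hy => ((h.smooth 0).contDiffAt h.isOpen hy.1 (hWV hy.2)).continuousAt)
    (hev.mono fun y hy i => contDiffAt_funInChart hy.1 (hIs _ hy.2 i))
    (hev.mono fun y hy i => by
      rw [← dfun_vfield hy.1 (hIs _ hy.2 i)]
      exact hX _ hy.2 i)
    ((linearIndependent_inChart hpt (h.independent _ (by rw [hl]; exact hWV hp))).ne_zero 0)
    (fun v hv => by
      have h1 := mem_span_of_triangular (k := 0)
        (α := fun i => (fderiv ℝ (funInChart (I i) p) (extChartAt 𝓘(ℝ, E) p p)).toLinearMap)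
        (y := fun a => vfInChart (Y a) p (extChartAt 𝓘(ℝ, E) p p))
        ((linearIndependent_inChart hpt (h.independent _ (by rw [hl]; exact hWV hp))
          ).span_eq_top_of_card_eq_finrank (by rw [Fintype.card_fin, h.finrank_eq]))
        (fun i _ l hli => by
          have := (hd p hp i).1 l hli
          rwa [dfun_vfield_eq hps (hIs p hp i)] at this)
        (fun i _ => by
          have := (hd p hp i).2
          rwa [dfun_vfield_eq hps (hIs p hp i)] at this)
        (fun i _ => hv i)
      have h2 : Set.Iic (0 : Fin (N + 1)) = {0} := by
        ext a
        simp
      rwa [h2, Set.image_singleton] at h1)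
    hev
  have hO'W : ∀ y ∈ O', y ∈ (extChartAt 𝓘(ℝ, E) p).target ∧
      (extChartAt 𝓘(ℝ, E) p).symm y ∈ W := fun y hy => hO'O hy
  refine ⟨(extChartAt 𝓘(ℝ, E) p).source ∩ extChartAt 𝓘(ℝ, E) p ⁻¹' O',
    isOpen_extChartAt_preimage' p hO', ?_, ⟨hps, hpO'⟩, ?_⟩
  · rintro x ⟨hxs, hxO⟩
    have h1 := (hO'W _ hxO).2
    rwa [(extChartAt 𝓘(ℝ, E) p).left_inv hxs] at h1
  · rintro q ⟨hqs, hqO⟩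
    obtain ⟨γ, a, b, ha, hb, hγ0, hγ, hγi⟩ := horb _ hqO
    have hγO : ∀ t ∈ Set.Ioo a b, γ t ∈ O' := fun t ht =>
      (hγi ▸ Set.mem_image_of_mem γ ht : γ t ∈ {y ∈ O' | _}).1
    refine ⟨fun t => (extChartAt 𝓘(ℝ, E) p).symm (γ t), a, b, ha, hb, ?_, fun t ht => ?_, ?_⟩
    · simp only [hγ0]
      exact (extChartAt 𝓘(ℝ, E) p).left_inv hqs
    · exact hasMFDerivWithinAt_of_inChart (hO'W _ (hγO t ht)).1 (hγ t ht)
    · rw [← Set.image_image (extChartAt 𝓘(ℝ, E) p).symm γ, hγi]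
      ext x
      constructor
      · rintro ⟨y, ⟨hyO, hyJ⟩, rfl⟩
        have hyt := (hO'W y hyO).1
        refine ⟨⟨(extChartAt 𝓘(ℝ, E) p).map_target hyt, ?_⟩, fun i => (hyJ i).trans ?_⟩
        · rwa [Set.mem_preimage, (extChartAt 𝓘(ℝ, E) p).right_inv hyt]
        · exact congrArg (I i) ((extChartAt 𝓘(ℝ, E) p).left_inv hqs)
      · rintro ⟨⟨hxs, hxO⟩, hxI⟩
        refine ⟨extChartAt 𝓘(ℝ, E) p x, ⟨hxO, fun i => ?_⟩,
          (extChartAt 𝓘(ℝ, E) p).left_inv hxs⟩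
        simp only [funInChart, (extChartAt 𝓘(ℝ, E) p).left_inv hxs,
          (extChartAt 𝓘(ℝ, E) p).left_inv hqs]
        exact hxI i

theorem TriangularFrame.integratedByPfaff (h : TriangularFrame V Y) (hΩ : SmoothFormOn V Ω)
    (hΩ0 : ∀ x ∈ V, Ω x ≠ 0) :
    IntegratedByPfaff V (Y 0) (fun i : Fin N => pfaffForm Ω Y i.succ) :=
  ⟨fun _ hx v => h.pfaffForm_annihilator hΩ0 hx v, h.completelyIntegrableOn hΩ hΩ0,
    fun i _ hW hWV _ hI _ hp => h.exists_solution hΩ0 i hW hWV hI hp,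
    fun _ hW hWV _ hI => h.orbits hΩ0 hW hWV hI⟩

end Orbits

/-! ### Local existence of the transverse field and the volume form -/

section Existence

variable {E : Type*} [NormedAddCommGroup E] [NormedSpace ℝ E] [FiniteDimensional ℝ E]
  {M : Type*} [TopologicalSpace M] [ChartedSpace E M] [IsManifold 𝓘(ℝ, E) ∞ M]

theorem exists_volume_form_at {m : ℕ} (hE : Module.finrank ℝ E = m) :
    ∃ (D : E [⋀^Fin m]→L[ℝ] ℝ) (b : Fin m → E), D b ≠ 0 := by
  let b := Module.finBasisOfFinrankEq ℝ E hE
  refine ⟨{ b.det with cont := ?_ }, b, ?_⟩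
  · change Continuous fun v => b.det v
    simp only [b.det_apply]
    refine Continuous.matrix_det (continuous_matrix fun i j => ?_)
    exact (LinearMap.continuous_of_finiteDimensional (b.coord i)).comp (continuous_apply j)
  · change b.det b ≠ 0
    rw [b.det_self]
    exact one_ne_zero

/-- The form with constant coefficients `D` in the preferred chart at `p`. -/
def formOfChart {m : ℕ} (D : E [⋀^Fin m]→L[ℝ] ℝ) (p : M) : DForm E M m := fun x =>
  D.compContinuousLinearMap (mfderiv 𝓘(ℝ, E) 𝓘(ℝ, E) (extChartAt 𝓘(ℝ, E) p) x)

/-- In any other chart the form is the pullback of the constant form `D` by the transition map,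
which is smooth. -/
theorem smoothFormOn_formOfChart {m : ℕ} (D : E [⋀^Fin m]→L[ℝ] ℝ) (p : M) :
    SmoothFormOn (extChartAt 𝓘(ℝ, E) p).source (formOfChart D p) := by
  refine (smoothFormOn_iff (isOpen_extChartAt_source p)).2 fun x₀ y hy hyp =>
    contDiffAt_form_of_apply fun v => ?_
  let τ : E → E := extChartAt 𝓘(ℝ, E) p ∘ (extChartAt 𝓘(ℝ, E) x₀).symm
  have hτ : ContDiffAt ℝ ∞ τ y := contMDiffAt_iff_contDiffAt.1
    ((contMDiffAt_chart hyp).comp y (contMDiffAt_chart_symm hy))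
  have h1 : ContDiffAt ℝ ∞ (fun z => D fun i => fderiv ℝ τ z (v i)) y :=
    contDiffAt_form_apply (β := fun _ => D) contDiffAt_const fun i =>
      (hτ.fderiv_right (m := ∞) (by simp)).clm_apply contDiffAt_const
  refine h1.congr_of_eventuallyEq ?_
  filter_upwards [eventually_mem_chart (isOpen_extChartAt_source p) hy hyp] with z hz
  have h2 : mfderiv 𝓘(ℝ, E) 𝓘(ℝ, E) τ z = _ := mfderiv_comp z
    ((contMDiffAt_chart hz.2).mdifferentiableAt (by simp))
    ((contMDiffAt_chart_symm hz.1).mdifferentiableAt (by simp))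
  rw [mfderiv_eq_fderiv] at h2
  rw [h2]
  rfl

theorem formOfChart_ne_zero {m : ℕ} {D : E [⋀^Fin m]→L[ℝ] ℝ} {b : Fin m → E} (hD : D b ≠ 0)
    {p x : M} (hx : x ∈ (extChartAt 𝓘(ℝ, E) p).source) : formOfChart D p x ≠ 0 := by
  intro h
  refine hD ?_
  have h1 : formOfChart D p x (fun i => vfOfChart p (fun _ => b i) x) = 0 := by
    rw [h]
    rfl
  rw [← h1]
  refine congrArg D (funext fun i => ?_)
  exact (apply_inverse (mpullback_chart_isInvertible hx) (b i)).symm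

/-- A pointwise independent family of vector fields can be completed locally to a frame by a smooth
vector field. -/
theorem exists_transverse_vfield {m : ℕ} (hE : Module.finrank ℝ E = m + 1) {Y : Fin m → VField E M}
    (hY : ∀ k x, SmoothVFAt (Y k) x) {p : M} (hp : LinearIndependent ℝ (fun k => Y k p)) :
    ∃ R : VField E M, ∀ᶠ x in 𝓝 p, SmoothVFAt R x ∧
      R x ∉ Submodule.span ℝ (Set.range fun k => Y k x) := by
  have hps := mem_extChartAt_source (I := 𝓘(ℝ, E)) p
  have hpt := (extChartAt 𝓘(ℝ, E) p).map_source hps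
  have hl := (extChartAt 𝓘(ℝ, E) p).left_inv hps
  -- The `m` vectors cannot span a space of dimension `m + 1`. The constant field `w` stays
  -- transverse nearby because invertibility of the frame map is an open condition.
  obtain ⟨w, hw⟩ : ∃ w : E, w ∉ Submodule.span ℝ
      (Set.range fun k => vfInChart (Y k) p (extChartAt 𝓘(ℝ, E) p p)) := by
    by_contra! hall
    have h1 := finrank_range_le_card (R := ℝ)
      (fun k => vfInChart (Y k) p (extChartAt 𝓘(ℝ, E) p p))
    rw [Set.finrank, Submodule.eq_top_iff'.2 hall, finrank_top, hE, Fintype.card_fin] at h1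
    omega
  let Z : Fin (m + 1) → E → E := Fin.snoc (α := fun _ => E → E)
    (fun k y => vfInChart (Y k) p y) (fun _ => w)
  have hZ : ∀ y, (fun a => Z a y) =
      Fin.snoc (α := fun _ => E) (fun k => vfInChart (Y k) p y) w := fun y => by
    funext a
    refine Fin.lastCases ?_ (fun k => ?_) a <;> simp [Z]
  have hinv : (frameMap (fun a => Z a (extChartAt 𝓘(ℝ, E) p p))).IsInvertible := by
    refine frameMap_isInvertible ?_ (by rw [hE, Fintype.card_fin])
    rw [hZ]
    exact linearIndependent_finSnoc.2 ⟨linearIndependent_inChart hpt (by rwa [hl]), hw⟩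
  have hZc : ∀ a, ContinuousAt (Z a) (extChartAt 𝓘(ℝ, E) p p) := by
    intro a
    refine Fin.lastCases ?_ (fun k => ?_) a
    · simpa [Z] using continuousAt_const
    · simpa [Z] using ((smoothVFAt_iff hps).1 (hY k p)).continuousAt
  refine ⟨vfOfChart p fun _ => w, ?_⟩
  filter_upwards [eventually_of_chart hps (eventually_frameMap_isInvertible hZc hinv)] with x hx
  refine ⟨contMDiffAt_vfOfChart hx.1 contDiffAt_const, fun hmem => ?_⟩
  have hxt := (extChartAt 𝓘(ℝ, E) p).map_source hx.1
  rw [← Set.image_univ] at hmem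
  have h1 := vfInChart_mem_span (Y := Y) (Z := vfOfChart p fun _ => w) (x₀ := p)
    (y := extChartAt 𝓘(ℝ, E) p x) (s := Set.univ)
    (by rwa [(extChartAt 𝓘(ℝ, E) p).left_inv hx.1])
  rw [vfInChart_vfOfChart hxt] at h1
  have h2 : w ∈ Submodule.span ℝ
      ((fun a => Z a (extChartAt 𝓘(ℝ, E) p x)) '' Set.range Fin.castSucc) := by
    rw [← Set.range_comp]
    have h3 : (fun a => Z a (extChartAt 𝓘(ℝ, E) p x)) ∘ Fin.castSucc =
        fun k => vfInChart (Y k) p (extChartAt 𝓘(ℝ, E) p x) := by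
      funext k
      simp [Z]
    rwa [h3, ← Set.image_univ]
  have h4 := inverse_frameMap_of_mem_span hx.2 h2 (l := Fin.last m)
    (by rintro ⟨k, hk⟩; exact Fin.castSucc_ne_last k hk)
  have h5 : frameMap (fun a => Z a (extChartAt 𝓘(ℝ, E) p x)) (Pi.single (Fin.last m) 1) = w := by
    rw [frameMap_single]
    simp [Z]
  rw [← h5, inverse_frameMap_apply hx.2, Pi.single_eq_same] at h4
  exact one_ne_zero h4

theorem LCS.exists_frame_and_volume (S : LCS E M) {N : ℕ} {H : M → ℝ}
    (hH : SmoothFunOn (E := E) Set.univ H) {F : Fin N → M → ℝ} {U : Set M}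
    (hF : IsJacobiCInfStructure S.jacobi H F U) {p : M} (hp : p ∈ U) :
    ∃ V : Set M, IsOpen V ∧ V ⊆ U ∧ p ∈ V ∧
      (∃ R : VField E M, SmoothVFOn V R ∧ ∀ x ∈ V, R x ∉ Submodule.span ℝ
        (Set.range fun k : Fin (N + 1) =>
          S.jacobi.ham ((Fin.cons H F : Fin (N + 1) → M → ℝ) k) x)) ∧
      ∃ Ω : DForm E M (N + 1 + 1), SmoothFormOn V Ω ∧ ∀ x ∈ V, Ω x ≠ 0 := by
  have hs : ∀ (k : Fin (N + 1)) x,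
      SmoothFunAt (E := E) ((Fin.cons H F : Fin (N + 1) → M → ℝ) k) x := by
    intro k x
    refine Fin.cases ?_ (fun j => ?_) k
    · exact (smoothFunOn_iff isOpen_univ).1 hH x trivial
    · exact (smoothFunOn_iff isOpen_univ).1 (hF.smooth j) x trivial
  obtain ⟨R, hR⟩ := exists_transverse_vfield hF.card_eq
    (fun k x => S.smoothVFAt_ham (.of_forall (hs k))) (hF.independent p hp)
  obtain ⟨D, b, hD⟩ := exists_volume_form_at hF.card_eq
  obtain ⟨V, hV, hVo, hpV⟩ := eventually_nhds_iff.1 (hR.and ((hF.isOpen.eventually_mem hp).and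
    ((isOpen_extChartAt_source (I := 𝓘(ℝ, E)) p).eventually_mem (mem_extChartAt_source p))))
  refine ⟨V, hVo, fun x hx => (hV x hx).2.1, hpV,
    ⟨R, (smoothVFOn_iff hVo).2 fun x hx => (hV x hx).1.1, fun x hx => (hV x hx).1.2⟩,
    formOfChart D p, fun x₀ => (smoothFormOn_formOfChart D p x₀).mono fun y hy =>
      ⟨hy.1, (hV _ hy.2).2.2⟩, fun x hx => formOfChart_ne_zero hD (hV x hx).2.2⟩

end Existence

end LCSInt

end

theorem mainTheorem5
    {E : Type*} [NormedAddCommGroup E] [NormedSpace ℝ E] [FiniteDimensional ℝ E]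
    {M : Type*} [TopologicalSpace M] [ChartedSpace E M] [IsManifold 𝓘(ℝ, E) ∞ M]
    [T2Space M] [SecondCountableTopology M]
    (n : ℕ) (hn : 1 ≤ n) (hE : Module.finrank ℝ E = 2 * n)
    (S : LCSInt.LCS E M)
    (H : M → ℝ) (hH : LCSInt.SmoothFunOn (E := E) Set.univ H)
    (F : Fin (2 * n - 2) → M → ℝ) (U : Set M)
    (hF : LCSInt.IsJacobiCInfStructure S.jacobi H F U) :
    -- local frames `X_H, X_{f₁}, …, X_{f_{2n-2}}, R` and volume forms exist on `U`
    (∀ p ∈ U, ∃ V : Set M, IsOpen V ∧ V ⊆ U ∧ p ∈ V ∧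
      (∃ R : LCSInt.VField E M, LCSInt.SmoothVFOn V R ∧
        ∀ x ∈ V, R x ∉ Submodule.span ℝ
          (Set.range fun k : Fin (2 * n - 2 + 1) =>
            S.jacobi.ham ((Fin.cons H F : Fin (2 * n - 2 + 1) → M → ℝ) k) x)) ∧
      ∃ Ω : LCSInt.DForm E M (2 * n - 2 + 1 + 1),
        LCSInt.SmoothFormOn V Ω ∧ ∀ x ∈ V, Ω x ≠ 0) ∧
    -- and for all of them the dynamics is integrated by `2n - 1` Pfaffian equations
    ∀ V : Set M, IsOpen V → V ⊆ U →
      ∀ R : LCSInt.VField E M, LCSInt.SmoothVFOn V R →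
        (∀ x ∈ V, R x ∉ Submodule.span ℝ
          (Set.range fun k : Fin (2 * n - 2 + 1) =>
            S.jacobi.ham ((Fin.cons H F : Fin (2 * n - 2 + 1) → M → ℝ) k) x)) →
        LCSInt.IsCInfStructureOn V (fun _ : Fin 1 => S.jacobi.ham H)
          (Fin.snoc (α := fun _ => LCSInt.VField E M) (fun j => S.jacobi.ham (F j)) R) ∧
        ∀ Ω : LCSInt.DForm E M (2 * n - 2 + 1 + 1),
          LCSInt.SmoothFormOn V Ω → (∀ x ∈ V, Ω x ≠ 0) →
          LCSInt.IntegratedByPfaff V (S.jacobi.ham H)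
            (fun i : Fin (2 * n - 2 + 1) => LCSInt.pfaffForm Ω
              (Fin.cons (S.jacobi.ham H)
                (Fin.snoc (α := fun _ => LCSInt.VField E M) (fun j => S.jacobi.ham (F j)) R))
              i.succ) := by
  -- The triangular frame was built by appending `R` to the `X_{f_k}`, while the statement prepends
  -- `X_H` to the `C^∞`-structure; the two lists agree.
  have hcons : ∀ R : LCSInt.VField E M,
      (Fin.snoc (α := fun _ => LCSInt.VField E M) (fun k : Fin (2 * n - 2 + 1) =>
        S.jacobi.ham ((Fin.cons H F : Fin (2 * n - 2 + 1) → M → ℝ) k)) R :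
          Fin (2 * n - 2 + 1 + 1) → LCSInt.VField E M) =
      Fin.cons (S.jacobi.ham H)
        (Fin.snoc (α := fun _ => LCSInt.VField E M) (fun j => S.jacobi.ham (F j)) R) := by
    intro R
    rw [Fin.cons_snoc_eq_snoc_cons]
    congr 1
    funext k
    refine Fin.cases ?_ (fun j => ?_) k <;> rfl
  refine ⟨fun p hp => S.exists_frame_and_volume hH hF hp, fun V hV hVU R hR hRs => ?_⟩
  have h := S.triangularFrame hH hF hV hVU hR hRs
  rw [hcons R] at h
  exact ⟨h.isCInfStructureOn, fun Ω hΩ hΩ0 => h.integratedByPfaff hΩ hΩ0⟩
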